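/- **Conventions.** $T_xf(t)=f(t-x)$, $M_\xi f(t)=e^{2\pi i t\cdot\xi}f(t)$, $\check f(t)=f(-t)$, $\mathcal F f(\xi)=\int f(x)e^{-2\pi i x\cdot\xi}dx$. A *TMIB* on $\mathbb R^n$ is a Banach space $E$ with dense continuous inclusions $\mathcal S(\mathbb R^n)\hookrightarrow E\hookrightarrow\mathcal S'(\mathbb R^n)$ that is invariant under all $T_x$, $M_\xi$ and for which $\omega_E(x):=\|T_x\|_{\mathcal L(E)}$ and $\nu_E(\xi):=\|M_{-\xi}\|_{\mathcal L(E)}$ are polynomially bounded; a *DTMIB* is the strong dual $E=E_0'\subset\mathcal S'(\mathbb R^n)$ of a TMIB $E_0$. Put $\tilde\nu_E=\max\{1,\nu_E\}$. For a non-zero test function $\eta\in\mathcal D(\mathbb R^n)$ and a weight $w\in\{\omega_E,\check\omega_E\}$, $W(\mathcal FL^1_{\tilde\nu_E},L^1_{w})$ is the space of all $f$ that are locally in $\mathcal FL^1_{\tilde\nu_E}$ with $\|f\|_W=\int\|f\,T_x\eta\|_{\mathcal FL^1_{\tilde\nu_E}}w(x)\,dx<\infty$, where $\|g\|_{\mathcal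 FL^1_{\tilde\nu_E}}=\int|\mathcal F^{-1}g|\,\tilde\nu_E$. Let $E$ be a TMIB or a DTMIB, $B$ a real $n\times n$ matrix, $\Lambda\subset\mathbb R^n$ a lattice and $U$ a bounded open neighbourhood of $0$ such that the sets $\lambda+U$, $\lambda\in\Lambda$, are pairwise disjoint. Put $T^B_xf(t)=f(t-x)e^{-2\pi i Bx\cdot(t-x)}$ and $\theta_Bf(x)=e^{2\pi i Bx\cdot x}f(x)$. Fix $\chi\in\mathcal D(U)\setminus\{0\}$ and let $E^B_d(\Lambda)$ be the space of all $c\in\mathbb C^\Lambda$ with $S_\chi(c)=\sum_\lambda c_\lambda T^B_\lambda\chi\in E$, with norm $\|c\|=\|S_\chi(c)\|_E$. For $e\in E$ and $\varphi$ with $\theta_B\check\varphi\in W(\mathcal FL^1_{\tilde\nu_E},L^1_{\check\omega_E})$ put $(e\ast_B\varphi)(x)=\langle e,T^{-B}_x\theta_B\check\varphi\rangle$, where $T^{-B}_x\theta_B\check\varphi$ is an element of $E'$ if $E$ is a TMIB, and of $E_0$ if $E=E_0'$ is a DTMIB. **Synthesis.** For $c\in E^B_d(\Lambda)$ and $\varphi\in\mathcal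 S(\mathbb R^n)$ the series $S_\varphi(c)=\sum_\lambda c_\lambda T^B_\lambda\varphi$ converges in $\mathcal S'(\mathbb R^n)$ (unconditionally, for the weak-$*$ topology) to an element of $E$, the bilinear map $(c,\varphi)\mapsto S_\varphi(c)$, $E^B_d(\Lambda)\times\mathcal S(\mathbb R^n)\to E$, is continuous, and it extends uniquely to a continuous bilinear map $\tilde S:E^B_d(\Lambda)\times W(\mathcal FL^1_{\tilde\nu_E},L^1_{\omega_E})\to E$ (with $\mathcal S(\mathbb R^n)$ continuously included in $W$). If moreover $E=E_0'$ is a DTMIB, there is $\chi_0\in\mathcal D(U)\setminus\{0\}$ such that for all $g\in E_0$ and $\varphi\in W(\mathcal FL^1_{\tilde\nu_E},L^1_{\omega_E})$ there is $h\in E_0$ with $\langle\tilde S_\varphi(c),g\rangle=\langle S_{\chi_0}(c),h\rangle$ for all $c\in E^B_d(\Lambda)$. **Sampling.** $(e,\varphi)\mapsto R_\varphi(e)=\big((e\ast_B\varphi)(\lambda)\big)_{\lambda\in\Lambda}$ is a well-defined continuous bilinear map $$E\times\big(\theta_{-B}W(\mathcal FL^1_{\tilde\nu_E},L^1_{\check\omega_E})\big)\check{}\to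 E^B_d(\Lambda),$$ where $\big(\theta_{-B}W\big)\check{}=\{\varphi:\theta_B\check\varphi\in W\}$ with norm $\|\theta_B\check\varphi\|_W$. **Consequence.** For all $\chi_1,\psi\in\mathcal D(U)\setminus\{0\}$ with $\int\theta_B(\psi)\chi_1\,dx\ne0$ one has $R_{\check\psi}(S_{\chi_1}(c))=\big(\int\theta_B(\psi)\chi_1\,dx\big)\,c$ for all $c\in E^B_d(\Lambda)$; and for every $\chi_1\in\mathcal D(U)\setminus\{0\}$ the subspace $S_{\chi_1}(E^B_d(\Lambda))$ is complemented in $E$. -/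

import Mathlib

open Set Filter Topology MeasureTheory
open scoped SchwartzMap FourierTransform ENNReal Pointwise

noncomputable section

namespace TwistedSeq

/-- The Euclidean space `ℝⁿ`. -/
abbrev Rn (n : ℕ) : Type := EuclideanSpace ℝ (Fin n)

variable {n : ℕ}

/-! ### Translation and modulation of tempered distributions -/

/-- The character `t ↦ exp (2πi t·ξ)`. -/
def character (ξ t : Rn n) : ℂ := Complex.exp (2 * Real.pi * Complex.I * (inner ℝ t ξ : ℝ))

/-- Characters are smooth functions with polynomially bounded derivatives, so multiplication by
them is an honest operation on Schwartz functions and on tempered distributions. -/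
theorem character_hasTemperateGrowth (ξ : Rn n) :
    Function.HasTemperateGrowth (character ξ) := by
  have h1 : Function.HasTemperateGrowth
      (fun s : ℝ => Complex.exp (2 * Real.pi * Complex.I * (s : ℂ))) := by
    have hd : ∀ k : ℕ, iteratedDeriv k
        (fun s : ℝ => Complex.exp (2 * Real.pi * Complex.I * (s : ℂ))) =
        fun s : ℝ => (2 * Real.pi * Complex.I) ^ k *
          Complex.exp (2 * Real.pi * Complex.I * (s : ℂ)) := by
      intro k
      induction k with
      | zero => simp
      | succ k ih =>
        rw [iteratedDeriv_succ, ih]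
        ext s
        have h : HasDerivAt (fun s : ℝ => Complex.exp (2 * Real.pi * Complex.I * (s : ℂ)))
            (Complex.exp (2 * Real.pi * Complex.I * (s : ℂ)) * (2 * Real.pi * Complex.I * 1)) s :=
          (((hasDerivAt_id s).ofReal_comp).const_mul (2 * Real.pi * Complex.I)).cexp
        rw [(h.const_mul _).deriv]
        ring
    refine ⟨?_, fun k => ⟨0, (2 * Real.pi) ^ k, fun s => ?_⟩⟩
    · exact (contDiff_const.mul Complex.ofRealCLM.contDiff).cexp
    · rw [norm_iteratedFDeriv_eq_norm_iteratedDeriv, hd]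
      have : ‖Complex.exp (2 * Real.pi * Complex.I * (s : ℂ))‖ = 1 := by
        rw [show (2 * Real.pi * Complex.I * (s : ℂ)) = ((2 * Real.pi * s : ℝ) : ℂ) * Complex.I by
          push_cast; ring]
        exact Complex.norm_exp_ofReal_mul_I _
      rw [norm_mul, this, norm_pow]
      simp [abs_of_pos Real.pi_pos]
  have h2 : Function.HasTemperateGrowth (fun t : Rn n => (inner ℝ t ξ : ℝ)) := by
    have := (innerSL ℝ ξ).hasTemperateGrowth
    simpa [real_inner_comm] using! this
  exact h1.comp h2

/-- `T_x u`, the translate of a tempered distribution: `⟨T_x u, φ⟩ = ⟨u, φ(· + x)⟩`. -/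
def translate (x : Rn n) : 𝓢'(Rn n, ℂ) →L[ℂ] 𝓢'(Rn n, ℂ) :=
  PointwiseConvergenceCLM.precomp ℂ (SchwartzMap.compSubConstCLM ℂ (-x))

/-- `M_ξ u`, the modulation of a tempered distribution: `⟨M_ξ u, φ⟩ = ⟨u, e^{2πi t·ξ} φ⟩`. -/
def modulate (ξ : Rn n) : 𝓢'(Rn n, ℂ) →L[ℂ] 𝓢'(Rn n, ℂ) :=
  TemperedDistribution.smulLeftCLM ℂ (character ξ)

/-- The tempered distribution `u` is given by the function `h`, i.e. `⟨u, ψ⟩ = ∫ h ψ`. -/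
def IsFunction (u : 𝓢'(Rn n, ℂ)) (h : Rn n → ℂ) : Prop :=
  ∀ ψ : 𝓢(Rn n, ℂ), Integrable (fun t => h t * ψ t) ∧ u ψ = ∫ t, h t * ψ t

/-! ### TMIB and DTMIB -/

/-- A normed space `E` continuously included in `𝓢'(ℝⁿ)`.  (For a Banach space `E`, continuity of
the inclusion for the topology of pointwise convergence and for the strong topology are the same
thing, by the uniform boundedness principle.) -/
structure Inclusion (n : ℕ) (E : Type*) [NormedAddCommGroup E] [NormedSpace ℂ E] where
  toDist : E →L[ℂ] 𝓢'(Rn n, ℂ)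
  injective : Function.Injective toDist

variable {E F : Type*} [NormedAddCommGroup E] [NormedSpace ℂ E]
  [NormedAddCommGroup F] [NormedSpace ℂ F]

/-- `E ⊂ 𝓢'(ℝⁿ)` is a translation-modulation invariant Banach space of distributions (TMIB). -/
structure IsTMIB (ι : Inclusion n E) : Prop where
  complete : CompleteSpace E
  dense_schwartz : ∃ j : 𝓢(Rn n, ℂ) →L[ℂ] E,
    (∀ φ : 𝓢(Rn n, ℂ), ι.toDist (j φ) = (φ : 𝓢'(Rn n, ℂ))) ∧ DenseRange j
  dense_distribution : DenseRange ι.toDist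
  translate_mem : ∀ (x : Rn n) (e : E), ∃ e' : E, ι.toDist e' = translate x (ι.toDist e)
  modulate_mem : ∀ (ξ : Rn n) (e : E), ∃ e' : E, ι.toDist e' = modulate ξ (ι.toDist e)
  /-- `‖T_x‖ ≤ C₀ (1 + |x|) ^ τ₀` -/
  translate_bound : ∃ C > (0 : ℝ), ∃ τ > (0 : ℝ), ∀ (x : Rn n) (e e' : E),
    ι.toDist e' = translate x (ι.toDist e) → ‖e'‖ ≤ C * (1 + ‖x‖) ^ τ * ‖e‖
  /-- `‖M_ξ‖ ≤ C₁ (1 + |ξ|) ^ τ₁` -/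
  modulate_bound : ∃ C > (0 : ℝ), ∃ τ > (0 : ℝ), ∀ (ξ : Rn n) (e e' : E),
    ι.toDist e' = modulate ξ (ι.toDist e) → ‖e'‖ ≤ C * (1 + ‖ξ‖) ^ τ * ‖e‖

/-- `E ⊂ 𝓢'(ℝⁿ)` is, via the pairing `pair : E × F → ℂ`, the strong dual of `F ⊂ 𝓢'(ℝⁿ)`:
`e ↦ ⟨e, ·⟩` is an isometry of `E` onto the normed dual of `F`, and `⟨e, φ⟩` is the value of the
distribution `e` at `φ` for every Schwartz function `φ` in `F`. -/
structure IsStrongDual (ι : Inclusion n E) (κ : Inclusion n F) (pair : E →L[ℂ] F →L[ℂ] ℂ) :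
    Prop where
  isometry : ∀ e : E, ‖pair e‖ = ‖e‖
  surjective : ∀ L : F →L[ℂ] ℂ, ∃ e : E, pair e = L
  compatible : ∀ (e : E) (f : F) (φ : 𝓢(Rn n, ℂ)),
    κ.toDist f = (φ : 𝓢'(Rn n, ℂ)) → pair e f = ι.toDist e φ

/-- The operator norm of the restriction to `E` of an operator `A` on `𝓢'(ℝⁿ)` that leaves `E`
invariant. -/
def opNormOn (ι : Inclusion n E) (A : 𝓢'(Rn n, ℂ) → 𝓢'(Rn n, ℂ)) : ℝ :=
  sInf {C : ℝ | 0 ≤ C ∧ ∀ e e' : E, ι.toDist e' = A (ι.toDist e) → ‖e'‖ ≤ C * ‖e‖}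

/-- `ω_E(x) = ‖T_x‖`. -/
def transWeight (ι : Inclusion n E) (x : Rn n) : ℝ := opNormOn ι (translate x)

/-- `ν_E(ξ) = ‖M_{-ξ}‖`. -/
def modWeight (ι : Inclusion n E) (ξ : Rn n) : ℝ := opNormOn ι (modulate (-ξ))

/-- `ν̃_E = max {1, ν_E}`. -/
def modWeightTilde (ι : Inclusion n E) (ξ : Rn n) : ℝ := max 1 (modWeight ι ξ)

/-! ### The amalgam space `W(𝓕L¹_ν, L¹_w)` -/

/-- The measure `w(x) dx`, so that `L¹_w` is the `L¹`-space of this measure. -/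
def weighted (w : Rn n → ℝ) : Measure (Rn n) := volume.withDensity fun x => ENNReal.ofReal (w x)

instance (w : Rn n → ℝ) : SFinite (weighted w) := by unfold weighted; infer_instance

/-- The norm in `𝓕L¹_ν` of an integrable function `g`: the `L¹_ν`-norm of `𝓕⁻¹ g`
(it is `∞` if `g` does not belong to `𝓕L¹_ν`). -/
def fourierNorm (ν : Rn n → ℝ) (g : Rn n → ℂ) : ℝ≥0∞ := ∫⁻ ξ, ‖𝓕⁻ g ξ‖ₑ ∂(weighted ν)

/-- The norm `∫ ‖f T_xη‖_{𝓕L¹_ν} w(x) dx` of `W(𝓕L¹_ν, L¹_w)` with respect to the window `η`. -/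
def amalgamNorm (ν w : Rn n → ℝ) (η : 𝓢(Rn n, ℂ)) (f : Rn n → ℂ) : ℝ≥0∞ :=
  ∫⁻ x, fourierNorm ν (fun t => f t * η (t - x)) ∂(weighted w)

theorem integrable_window {f : Rn n → ℂ} (hf : Continuous f) (η : 𝓢(Rn n, ℂ))
    (hη : HasCompactSupport η) (x : Rn n) : Integrable (fun t => f t * η (t - x)) := by
  refine Continuous.integrable_of_hasCompactSupport ?_ ?_
  · have := η.continuous
    fun_prop
  · exact (hη.comp_homeomorph (Homeomorph.subRight x)).mul_left

theorem fourierNorm_add_le (ν : Rn n → ℝ) {f g : Rn n → ℂ} (hf : Integrable f)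
    (hg : Integrable g) (h : Rn n → ℂ) (hh : h = fun t => f t + g t) :
    fourierNorm ν h ≤ fourierNorm ν f + fourierNorm ν g := by
  subst hh
  have hc : Continuous (𝓕⁻ f) := by
    have h : Continuous (𝓕 f) := VectorFourier.fourierIntegral_continuous (μ := volume)
      (L := innerₗ (Rn n)) Real.continuous_fourierChar (by exact continuous_inner) hf
    have h2 : 𝓕⁻ f = fun ξ => 𝓕 f (-ξ) := funext fun ξ => Real.fourierInv_eq_fourier_neg f ξ
    rw [h2]
    exact h.comp continuous_neg
  have hi : ∀ (k : Rn n → ℂ), Integrable k → ∀ ξ : Rn n,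
      Integrable (fun t => Real.fourierChar (inner ℝ t ξ : ℝ) • k t) := by
    intro k hk ξ
    simpa using (Real.fourierIntegral_convergent_iff (μ := volume) (-ξ)).2 hk
  have hadd : ∀ ξ, 𝓕⁻ (fun t => f t + g t) ξ = 𝓕⁻ f ξ + 𝓕⁻ g ξ := by
    intro ξ
    simp only [Real.fourierInv_eq]
    rw [← integral_add (hi f hf ξ) (hi g hg ξ)]
    simp only [smul_add]
  unfold fourierNorm
  rw [← lintegral_add_left hc.measurable.enorm]
  refine lintegral_mono fun ξ => ?_
  rw [hadd]
  exact enorm_add_le _ _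

theorem fourierNorm_smul (ν : Rn n → ℝ) (c : ℂ) (f : Rn n → ℂ) (h : Rn n → ℂ)
    (hh : h = fun t => c * f t) :
    fourierNorm ν h = ‖c‖ₑ * fourierNorm ν f := by
  subst hh
  have hs : ∀ ξ, 𝓕⁻ (fun t => c * f t) ξ = c * 𝓕⁻ f ξ := by
    intro ξ
    simp only [Real.fourierInv_eq]
    rw [← integral_const_mul]
    refine integral_congr_ae (Eventually.of_forall fun t => ?_)
    simp [Circle.smul_def, mul_left_comm]
  unfold fourierNorm
  rw [← lintegral_const_mul' _ _ (by simp)]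
  simp only [hs, enorm_mul]

theorem measurable_fourierNorm_window (ν : Rn n → ℝ) {f : Rn n → ℂ} (hf : Continuous f)
    (η : 𝓢(Rn n, ℂ)) :
    Measurable fun x => fourierNorm ν (fun t => f t * η (t - x)) := by
  have h1 : StronglyMeasurable (fun p : Rn n × Rn n =>
      𝓕⁻ (fun t => f t * η (t - p.1)) p.2) := by
    simp only [Real.fourierInv_eq]
    refine StronglyMeasurable.integral_prod_right (ν := volume)
      (f := fun (p : Rn n × Rn n) (t : Rn n) =>
        Real.fourierChar (inner ℝ t p.2) • (f t * η (t - p.1))) ?_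
    refine Continuous.stronglyMeasurable ?_
    have := η.continuous
    have := Real.continuous_fourierChar
    simp only [Circle.smul_def, Function.uncurry_def]
    fun_prop
  exact Measurable.lintegral_prod_right' h1.measurable.enorm

theorem amalgamNorm_add_le (ν w : Rn n → ℝ) (η : 𝓢(Rn n, ℂ)) (hη : HasCompactSupport η)
    {f g : Rn n → ℂ} (hf : Continuous f) (hg : Continuous g) :
    amalgamNorm ν w η (f + g) ≤ amalgamNorm ν w η f + amalgamNorm ν w η g := by
  unfold amalgamNorm
  rw [← lintegral_add_left (measurable_fourierNorm_window ν hf η)]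
  refine lintegral_mono fun x => ?_
  refine fourierNorm_add_le ν (integrable_window hf η hη x) (integrable_window hg η hη x) _ ?_
  ext t; simp [add_mul]

theorem amalgamNorm_smul (ν w : Rn n → ℝ) (η : 𝓢(Rn n, ℂ)) (c : ℂ) {f : Rn n → ℂ}
    (hf : Continuous f) :
    amalgamNorm ν w η (c • f) = ‖c‖ₑ * amalgamNorm ν w η f := by
  unfold amalgamNorm
  rw [← lintegral_const_mul _ (measurable_fourierNorm_window ν hf η)]
  refine lintegral_congr fun x => fourierNorm_smul ν c _ _ ?_
  ext t; simp [mul_assoc]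

/-- The amalgam space `W(𝓕L¹_ν, L¹_w)`, for `ν ≥ 1`.  Its elements are locally in
`𝓕L¹_ν ⊂ C(ℝⁿ)` and hence continuous functions; so it is realised as the space of all continuous
functions `f` such that `χ f ∈ 𝓕L¹_ν` for all test functions `χ` and
`∫ ‖f T_xη‖_{𝓕L¹_ν} w(x) dx < ∞`. -/
def amalgam (ν w : Rn n → ℝ) (η : 𝓢(Rn n, ℂ)) (hη : HasCompactSupport η) :
    Submodule ℂ (Rn n → ℂ) where
  carrier := {f | Continuous f ∧
    (∀ χ : 𝓢(Rn n, ℂ), HasCompactSupport χ → fourierNorm ν (fun t => f t * χ t) < ∞) ∧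
    amalgamNorm ν w η f < ∞}
  add_mem' := by
    rintro f g ⟨hf, hf1, hf2⟩ ⟨hg, hg1, hg2⟩
    refine ⟨hf.add hg, fun χ hχ => ?_, (amalgamNorm_add_le ν w η hη hf hg).trans_lt
      (ENNReal.add_lt_top.2 ⟨hf2, hg2⟩)⟩
    refine (fourierNorm_add_le ν ?_ ?_ _ ?_).trans_lt
      (ENNReal.add_lt_top.2 ⟨hf1 χ hχ, hg1 χ hχ⟩)
    · simpa using integrable_window hf χ hχ 0
    · simpa using integrable_window hg χ hχ 0
    · ext t; simp [add_mul]
  zero_mem' := by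
    have h0 : fourierNorm ν (fun _ : Rn n => (0 : ℂ)) = 0 := by
      simpa using fourierNorm_smul ν 0 (fun _ => 0) (fun _ => 0) (by simp)
    refine ⟨continuous_const, fun χ _ => ?_, ?_⟩
    · simp [h0]
    · simp [amalgamNorm, h0]
  smul_mem' := by
    rintro c f ⟨hf, hf1, hf2⟩
    refine ⟨hf.const_smul c, fun χ hχ => ?_, ?_⟩
    · rw [fourierNorm_smul ν c (fun t => f t * χ t) _ (by ext t; simp [mul_assoc])]
      exact ENNReal.mul_lt_top (by simp) (hf1 χ hχ)
    · rw [amalgamNorm_smul ν w η c hf]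
      exact ENNReal.mul_lt_top (by simp) hf2

/-- The space `W(𝓕L¹_ν, L¹_w)` as a (semi)normed space. -/
def Amalgam (ν w : Rn n → ℝ) (η : 𝓢(Rn n, ℂ)) (hη : HasCompactSupport η) : Type :=
  ↥(amalgam ν w η hη)

namespace Amalgam

variable {ν w : Rn n → ℝ} {η : 𝓢(Rn n, ℂ)} {hη : HasCompactSupport η}

instance : AddCommGroup (Amalgam ν w η hη) := inferInstanceAs (AddCommGroup ↥(amalgam ν w η hη))

instance : Module ℂ (Amalgam ν w η hη) := inferInstanceAs (Module ℂ ↥(amalgam ν w η hη))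

/-- An element of `W(𝓕L¹_ν, L¹_w)` as a function. -/
def toFun : Amalgam ν w η hη →ₗ[ℂ] (Rn n → ℂ) := (amalgam ν w η hη).subtype

instance : CoeFun (Amalgam ν w η hη) fun _ => Rn n → ℂ := ⟨fun f => toFun f⟩

instance : SeminormedAddCommGroup (Amalgam ν w η hη) :=
  AddGroupSeminorm.toSeminormedAddCommGroup
    { toFun := fun f => (amalgamNorm ν w η (toFun f)).toReal
      map_zero' := by
        have h := amalgamNorm_smul ν w η 0 (f := 0) continuous_zero
        rw [zero_smul, enorm_zero, zero_mul] at h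
        rw [map_zero, h, ENNReal.toReal_zero]
      add_le' := fun f g => by
        have hf : amalgamNorm ν w η (toFun f) < ∞ := f.2.2.2
        have hg : amalgamNorm ν w η (toFun g) < ∞ := g.2.2.2
        rw [map_add, ← ENNReal.toReal_add hf.ne hg.ne]
        exact ENNReal.toReal_mono (ENNReal.add_lt_top.2 ⟨hf, hg⟩).ne
          (amalgamNorm_add_le ν w η hη f.2.1 g.2.1)
      neg' := fun f => by
        have h := amalgamNorm_smul ν w η (-1) (f := toFun f) f.2.1
        rw [neg_one_smul, enorm_neg, enorm_one, one_mul] at h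
        rw [map_neg, h] }

theorem norm_def (f : Amalgam ν w η hη) : ‖f‖ = (amalgamNorm ν w η (toFun f)).toReal := rfl

instance : NormedSpace ℂ (Amalgam ν w η hη) where
  norm_smul_le c f := by
    rw [norm_def, norm_def, map_smul, amalgamNorm_smul ν w η c (f := toFun f) f.2.1]
    simp

end Amalgam

/-! ### Twisted translation and the discrete space `E^B_d(Λ)` -/

/-- A tempered distribution that vanishes on all test functions is zero. -/
theorem eq_zero_of_test (u : 𝓢'(Rn n, ℂ))
    (hu : ∀ ψ : 𝓢(Rn n, ℂ), HasCompactSupport ψ → u ψ = 0) : u = 0 := by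
  let g : ContDiffBump (0 : Rn n) := ⟨1, 2, one_pos, one_lt_two⟩
  have hGs : ContDiff ℝ (⊤ : ℕ∞) (fun x : Rn n => (g x : ℂ)) :=
    Complex.ofRealCLM.contDiff.comp g.contDiff
  have hGc : HasCompactSupport (fun x : Rn n => (g x : ℂ)) :=
    g.hasCompactSupport.comp_left (g := fun r : ℝ => (r : ℂ)) (by simp)
  let G : 𝓢(Rn n, ℂ) := hGc.toSchwartzMap hGs
  have hG : ∀ x, G x = (g x : ℂ) := fun x => rfl
  let H : Rn n → ℂ := fun x => G x - 1
  have hHs : ContDiff ℝ (⊤ : ℕ∞) H := (G.smooth _).sub contDiff_const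
  have hH0 : ∀ x : Rn n, ‖x‖ < 1 → H =ᶠ[𝓝 x] fun _ => 0 := by
    intro x hx
    filter_upwards [Metric.isOpen_ball.mem_nhds (mem_ball_zero_iff.2 hx)] with y hy
    have : g y = 1 := g.one_of_mem_closedBall (Metric.ball_subset_closedBall hy)
    simp [H, hG, this]
  have hHb : ∀ i : ℕ, ∃ A : ℝ, 0 ≤ A ∧ ∀ x, ‖iteratedFDeriv ℝ i H x‖ ≤ A * ‖x‖ := by
    intro i
    refine ⟨SchwartzMap.seminorm ℝ 0 i G + 1, by positivity, fun x => ?_⟩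
    rcases lt_or_ge ‖x‖ 1 with hx | hx
    · rw [((hH0 x hx).iteratedFDeriv ℝ i).self_of_nhds]
      have : iteratedFDeriv ℝ i (fun _ : Rn n => (0 : ℂ)) x = 0 := by
        simp
      rw [this, norm_zero]
      positivity
    · have h1 : ‖iteratedFDeriv ℝ i H x‖ ≤ SchwartzMap.seminorm ℝ 0 i G + 1 := by
        have : iteratedFDeriv ℝ i H x = iteratedFDeriv ℝ i G x -
            iteratedFDeriv ℝ i (fun _ : Rn n => (1 : ℂ)) x :=
          iteratedFDeriv_sub_apply (G.contDiffAt _) contDiffAt_const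
        rw [this]
        refine (norm_sub_le _ _).trans (add_le_add ?_ ?_)
        · simpa using SchwartzMap.le_seminorm ℝ 0 i G x
        · rcases Nat.eq_zero_or_pos i with rfl | hi
          · simp
          · rw [iteratedFDeriv_const_of_ne hi.ne']; simp
      exact h1.trans (le_mul_of_one_le_right (by positivity) hx)
  choose A hA0 hA using hHb
  ext φ
  let c : ℕ → ℝ := fun k => ((k : ℝ) + 1)⁻¹
  have hc0 : ∀ k, 0 < c k := fun k => by positivity
  have hc1 : ∀ k, c k ≤ 1 := fun k => inv_le_one_of_one_le₀ (by simp)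
  have hXs : ∀ k, ContDiff ℝ (⊤ : ℕ∞) (fun x : Rn n => G (c k • x)) := fun k =>
    (G.smooth _).comp (contDiff_const_smul _)
  have hXc : ∀ k, HasCompactSupport (fun x : Rn n => G (c k • x)) := fun k =>
    HasCompactSupport.comp_homeomorph (f := G) hGc (Homeomorph.smulOfNeZero (c k) (hc0 k).ne')
  have hXt : ∀ k, Function.HasTemperateGrowth (fun x : Rn n => G (c k • x)) := fun k =>
    (hXc k).hasTemperateGrowth (hXs k)
  let φk : ℕ → 𝓢(Rn n, ℂ) := fun k =>
    SchwartzMap.smulLeftCLM ℂ (fun x : Rn n => G (c k • x)) φ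
  have hφk : ∀ k x, φk k x = G (c k • x) * φ x := fun k x => by
    simp [φk, SchwartzMap.smulLeftCLM_apply_apply (hXt k)]
  have hz : ∀ k, u (φk k) = 0 := fun k => hu _ (by
    have : (φk k : Rn n → ℂ) = fun x => G (c k • x) * φ x := funext (hφk k)
    rw [this]
    exact (hXc k).mul_right)
  have hlim : Tendsto φk atTop (𝓝 φ) := by
    rw [(schwartz_withSeminorms ℝ (Rn n) ℂ).tendsto_nhds]
    rintro ⟨a, l⟩ ε hε
    let M : ℝ := ∑ i ∈ Finset.range (l + 1),
      (l.choose i : ℝ) * A i * SchwartzMap.seminorm ℝ (a + 1) (l - i) φ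
    have hM : 0 ≤ M := Finset.sum_nonneg fun i _ => by
      have := hA0 i; positivity
    have hb : ∀ k, SchwartzMap.seminorm ℝ a l (φk k - φ) ≤ M * c k := by
      intro k
      refine SchwartzMap.seminorm_le_bound ℝ a l _ (mul_nonneg hM (hc0 k).le) fun x => ?_
      have he : ((φk k - φ : 𝓢(Rn n, ℂ)) : Rn n → ℂ) = fun y => H (c k • y) * φ y := by
        ext y
        simp [H, hφk, sub_mul]
      rw [he]
      have h2 := norm_iteratedFDeriv_mul_le (𝕜 := ℝ) (f := fun y => H (c k • y)) (g := φ)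
        (N := (⊤ : ℕ∞)) (hHs.comp (contDiff_const_smul _)) (φ.smooth _) x
        (n := l) (mod_cast le_top)
      refine (mul_le_mul_of_nonneg_left h2 (by positivity)).trans ?_
      rw [Finset.mul_sum, Finset.sum_mul]
      refine Finset.sum_le_sum fun i _ => ?_
      have h3 : ‖iteratedFDeriv ℝ i (fun y => H (c k • y)) x‖ ≤ A i * ‖x‖ * c k := by
        rw [iteratedFDeriv_comp_const_smul (c k) (hHs.of_le (mod_cast le_top))]
        rw [norm_smul, norm_pow, Real.norm_of_nonneg (hc0 k).le]
        calc c k ^ i * ‖iteratedFDeriv ℝ i H (c k • x)‖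
            ≤ 1 * (A i * ‖c k • x‖) := mul_le_mul (pow_le_one₀ (hc0 k).le (hc1 k)) (hA i _)
              (norm_nonneg _) zero_le_one
          _ = A i * ‖x‖ * c k := by
              rw [norm_smul, Real.norm_of_nonneg (hc0 k).le]; ring
      have h4 := SchwartzMap.le_seminorm ℝ (a + 1) (l - i) φ x
      have h5 := hA0 i
      have h6 := (hc0 k).le
      calc ‖x‖ ^ a * ((l.choose i : ℝ) * ‖iteratedFDeriv ℝ i (fun y => H (c k • y)) x‖ *
            ‖iteratedFDeriv ℝ (l - i) φ x‖)
          ≤ ‖x‖ ^ a * ((l.choose i : ℝ) * (A i * ‖x‖ * c k) *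
            ‖iteratedFDeriv ℝ (l - i) φ x‖) := by gcongr
        _ = (l.choose i : ℝ) * A i * (‖x‖ ^ (a + 1) * ‖iteratedFDeriv ℝ (l - i) φ x‖) * c k := by
            ring
        _ ≤ (l.choose i : ℝ) * A i * SchwartzMap.seminorm ℝ (a + 1) (l - i) φ * c k := by
            gcongr
    have ht : Tendsto (fun k => M * c k) atTop (𝓝 0) := by
      simpa [c, one_div] using (tendsto_one_div_add_atTop_nhds_zero_nat (𝕜 := ℝ)).const_mul M
    filter_upwards [ht.eventually (gt_mem_nhds hε)] with k hk
    exact (hb k).trans_lt hk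
  have h1 : Tendsto (fun k => u (φk k)) atTop (𝓝 (u φ)) := (u.continuous.tendsto φ).comp hlim
  simp only [hz] at h1
  exact tendsto_nhds_unique h1 tendsto_const_nhds |>.trans (by simp)

/-- `Bx` for a real `n × n` matrix `B` and `x ∈ ℝⁿ`. -/
def mulVec (B : Matrix (Fin n) (Fin n) ℝ) (x : Rn n) : Rn n := Matrix.toEuclideanCLM (𝕜 := ℝ) B x

/-- The twisted translation `T^B_x f(t) = f(t - x) exp (-2πi Bx·(t - x))`. -/
def twistedTranslate (B : Matrix (Fin n) (Fin n) ℝ) (x : Rn n) (f : Rn n → ℂ) (t : Rn n) : ℂ :=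
  f (t - x) * Complex.exp (-(2 * Real.pi * Complex.I * (inner ℝ (mulVec B x) (t - x) : ℝ)))

/-- `θ_B(f)(x) = exp (2πi Bx·x) f(x)`. -/
def chirp (B : Matrix (Fin n) (Fin n) ℝ) (f : Rn n → ℂ) (x : Rn n) : ℂ :=
  Complex.exp (2 * Real.pi * Complex.I * (inner ℝ (mulVec B x) x : ℝ)) * f x

/-- `u = ∑_λ c_λ T^B_λ φ`, with (unconditional) convergence in `𝓢'(ℝⁿ)`. -/
def IsSynthesis (B : Matrix (Fin n) (Fin n) ℝ) (Λ : Submodule ℤ (Rn n)) (φ : Rn n → ℂ)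
    (c : Λ → ℂ) (u : 𝓢'(Rn n, ℂ)) : Prop :=
  ∀ ψ : 𝓢(Rn n, ℂ),
    HasSum (fun l : Λ => c l * ∫ t, twistedTranslate B (l : Rn n) φ t * ψ t) (u ψ)

/-- `u = ∑_λ c_λ T^B_λ φ` in the space `𝓓'(ℝⁿ)` of distributions, i.e. tested against smooth
compactly supported functions. -/
def IsLocalSynthesis (B : Matrix (Fin n) (Fin n) ℝ) (Λ : Submodule ℤ (Rn n)) (φ : Rn n → ℂ)
    (c : Λ → ℂ) (u : 𝓢'(Rn n, ℂ)) : Prop :=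
  ∀ ψ : 𝓢(Rn n, ℂ), HasCompactSupport ψ →
    HasSum (fun l : Λ => c l * ∫ t, twistedTranslate B (l : Rn n) φ t * ψ t) (u ψ)

/-- The set of all `c ∈ ℂ^Λ` such that `S_χ(c) = ∑_λ c_λ T^B_λ χ ∈ 𝓓'(ℝⁿ)` belongs to `E`. -/
def discrete (ι : Inclusion n E) (B : Matrix (Fin n) (Fin n) ℝ) (Λ : Submodule ℤ (Rn n))
    (χ : 𝓢(Rn n, ℂ)) : Submodule ℂ (Λ → ℂ) where
  carrier := {c | ∃ e : E, IsLocalSynthesis B Λ χ c (ι.toDist e)}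
  add_mem' := by
    rintro c d ⟨e, he⟩ ⟨f, hf⟩
    refine ⟨e + f, fun ψ hψ => ?_⟩
    simpa [add_mul] using! (he ψ hψ).add (hf ψ hψ)
  zero_mem' := ⟨0, fun ψ _ => by simp⟩
  smul_mem' := by
    rintro a c ⟨e, he⟩
    refine ⟨a • e, fun ψ hψ => ?_⟩
    simpa [mul_assoc] using! (he ψ hψ).mul_left a

/-- The space `E^B_d(Λ) = E^B_{d,χ}(Λ)` as a (semi)normed space. -/
def Discrete (ι : Inclusion n E) (B : Matrix (Fin n) (Fin n) ℝ) (Λ : Submodule ℤ (Rn n))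
    (χ : 𝓢(Rn n, ℂ)) : Type := ↥(discrete ι B Λ χ)

namespace Discrete

variable {ι : Inclusion n E} {B : Matrix (Fin n) (Fin n) ℝ} {Λ : Submodule ℤ (Rn n)}
  {χ : 𝓢(Rn n, ℂ)}

instance : AddCommGroup (Discrete ι B Λ χ) := inferInstanceAs (AddCommGroup ↥(discrete ι B Λ χ))

instance : Module ℂ (Discrete ι B Λ χ) := inferInstanceAs (Module ℂ ↥(discrete ι B Λ χ))

/-- An element of `E^B_d(Λ)` as a sequence. -/
def toSeq : Discrete ι B Λ χ →ₗ[ℂ] (Λ → ℂ) := (discrete ι B Λ χ).subtype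

instance : CoeFun (Discrete ι B Λ χ) fun _ => Λ → ℂ := ⟨fun c => toSeq c⟩

theorem exists_synthesis (c : Discrete ι B Λ χ) :
    ∃ e : E, IsLocalSynthesis B Λ χ (toSeq c) (ι.toDist e) := c.2

theorem synthesis_unique {c : Λ → ℂ} {e e' : E} (h : IsLocalSynthesis B Λ χ c (ι.toDist e))
    (h' : IsLocalSynthesis B Λ χ c (ι.toDist e')) : e = e' := by
  apply ι.injective
  rw [← sub_eq_zero]
  refine eq_zero_of_test _ fun ψ hψ => ?_
  have := (h ψ hψ).unique (h' ψ hψ)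
  simpa [sub_eq_zero] using this

/-- `S_χ(c) = ∑_λ c_λ T^B_λ χ ∈ E` for `c ∈ E^B_{d,χ}(Λ)`. -/
def synthesis : Discrete ι B Λ χ →ₗ[ℂ] E where
  toFun c := (exists_synthesis c).choose
  map_add' c d := by
    refine synthesis_unique (exists_synthesis (c + d)).choose_spec fun ψ hψ => ?_
    have h := ((exists_synthesis c).choose_spec ψ hψ).add ((exists_synthesis d).choose_spec ψ hψ)
    simpa [add_mul] using! h
  map_smul' a c := by
    refine synthesis_unique (exists_synthesis (a • c)).choose_spec fun ψ hψ => ?_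
    have h := ((exists_synthesis c).choose_spec ψ hψ).mul_left a
    simpa [mul_assoc] using! h

theorem synthesis_spec (c : Discrete ι B Λ χ) :
    IsLocalSynthesis B Λ χ (toSeq c) (ι.toDist (synthesis c)) := (exists_synthesis c).choose_spec

/-- The norm of `E^B_d(Λ)` is `‖c‖ = ‖S_χ(c)‖_E`. -/
instance : SeminormedAddCommGroup (Discrete ι B Λ χ) :=
  SeminormedAddCommGroup.induced _ _ (synthesis (ι := ι) (B := B) (Λ := Λ) (χ := χ))

theorem norm_def (c : Discrete ι B Λ χ) : ‖c‖ = ‖synthesis c‖ := rfl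

instance : NormedSpace ℂ (Discrete ι B Λ χ) where
  norm_smul_le a c := by rw [norm_def, norm_def, map_smul, norm_smul]

end Discrete

/-! ### The domain of the sampling operators -/

/-- The linear map `φ ↦ θ_B(φˇ)`, where `φˇ(x) = φ(-x)`. -/
def chirpReflect (B : Matrix (Fin n) (Fin n) ℝ) : (Rn n → ℂ) →ₗ[ℂ] (Rn n → ℂ) where
  toFun φ := chirp B fun x => φ (-x)
  map_add' φ ψ := by ext x; simp [chirp, mul_add]
  map_smul' a φ := by ext x; simp [chirp, mul_left_comm]

/-- The space `(θ_{-B} W(𝓕L¹_ν, L¹_w))ˇ = {φ | θ_B(φˇ) ∈ W(𝓕L¹_ν, L¹_w)}`. -/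
def SamplingDomain (B : Matrix (Fin n) (Fin n) ℝ) (ν w : Rn n → ℝ) (η : 𝓢(Rn n, ℂ))
    (hη : HasCompactSupport η) : Type := ↥((amalgam ν w η hη).comap (chirpReflect B))

namespace SamplingDomain

variable {B : Matrix (Fin n) (Fin n) ℝ} {ν w : Rn n → ℝ} {η : 𝓢(Rn n, ℂ)}
  {hη : HasCompactSupport η}

instance : AddCommGroup (SamplingDomain B ν w η hη) :=
  inferInstanceAs (AddCommGroup ↥((amalgam ν w η hη).comap (chirpReflect B)))

instance : Module ℂ (SamplingDomain B ν w η hη) :=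
  inferInstanceAs (Module ℂ ↥((amalgam ν w η hη).comap (chirpReflect B)))

/-- An element of `(θ_{-B} W(𝓕L¹_ν, L¹_w))ˇ` as a function. -/
def toFun : SamplingDomain B ν w η hη →ₗ[ℂ] (Rn n → ℂ) :=
  ((amalgam ν w η hη).comap (chirpReflect B)).subtype

instance : CoeFun (SamplingDomain B ν w η hη) fun _ => Rn n → ℂ := ⟨fun f => toFun f⟩

/-- The map `φ ↦ θ_B(φˇ)` into `W(𝓕L¹_ν, L¹_w)`. -/
def toAmalgam : SamplingDomain B ν w η hη →ₗ[ℂ] Amalgam ν w η hη where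
  toFun φ := ⟨chirpReflect B (toFun φ), φ.2⟩
  map_add' φ ψ := Subtype.ext (map_add (chirpReflect B) (toFun φ) (toFun ψ))
  map_smul' a φ := Subtype.ext (map_smul (chirpReflect B) a (toFun φ))

/-- The norm is `‖φ‖ = ‖θ_B(φˇ)‖_W`. -/
instance : SeminormedAddCommGroup (SamplingDomain B ν w η hη) :=
  SeminormedAddCommGroup.induced _ _ (toAmalgam (B := B) (ν := ν) (w := w) (η := η) (hη := hη))

theorem norm_def (φ : SamplingDomain B ν w η hη) : ‖φ‖ = ‖toAmalgam φ‖ := rfl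

instance : NormedSpace ℂ (SamplingDomain B ν w η hη) where
  norm_smul_le a φ := by rw [norm_def, norm_def, map_smul, norm_smul]

end SamplingDomain

/-- `z = (e ∗_B φ)(x)`: the twisted convolution `(e ∗_B φ)(x) = ⟨e, T^{-B}_x θ_B(φˇ)⟩`, where
`T^{-B}_x θ_B(φˇ)` belongs to the space `F` in duality with `E`. -/
def IsTwistedConvolution (κ : Inclusion n F) (pair : E →L[ℂ] F →L[ℂ] ℂ)
    (B : Matrix (Fin n) (Fin n) ℝ) (e : E) (φ : Rn n → ℂ) (x : Rn n) (z : ℂ) : Prop :=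
  ∃ f : F, IsFunction (κ.toDist f) (twistedTranslate (-B) x (chirpReflect B φ)) ∧ z = pair e f

/-- `χ ∈ 𝓓(U) \ {0}`. -/
def IsTest (U : Set (Rn n)) (χ : 𝓢(Rn n, ℂ)) : Prop :=
  HasCompactSupport χ ∧ tsupport χ ⊆ U ∧ χ ≠ 0

end TwistedSeq

end

open TwistedSeq

/-! Everything is reduced to the single window χ by an atomic decomposition of the amalgam spaces
that respects the twist. A shift T_pM_q commutes with all T^B_λ, λ ∈ Λ, when Bλ·p + λ·q is always an
integer, that is, when q lies in the coset of -Bᵀp modulo the dual lattice. One coset per point p is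
enough: the translates of U by Λ are disjoint, so a function supported in U agrees on U with its
Λ-periodization, whose Fourier series has frequencies in the dual lattice only. Cutting f by a
partition of unity Σ_l T_{c_l}(σχ) = 1 and expanding each piece f·T_{c_l}σ in this way gives f = Σ_j
a_j T_{p_j}M_{q_j}χ with Σ_j |a_j| w(p_j)ν(-q_j) ≤ C‖f‖_W (`exists_atomicSystem`, with the estimate
in `exists_tsum_fourierInv_window_le`).

Synthesis. Because ‖T_pM_q‖ ≤ ω_E(p)ν̃_E(-q), the series L_f = Σ_j a_j T_{p_j}M_{q_j} converges
absolutely in the operator norm of E, and commutation gives S_f(c) = L_f S_χ(c), where ‖S_χ(c)‖ =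
‖c‖ by definition. This proves continuity. The transposed series acts on the space in duality and
produces h, with χ₀ = χ. Partial sums of atomic series are Schwartz functions, so the Schwartz space
is dense in the amalgam space and the extension is unique.

Sampling. Let f = θ_B(φˇ), decomposed into atoms adapted to -B. Moving the atoms onto e gives (e ∗_B
φ)(λ) = ⟨Le, T^{-B}_λχ⟩ for an operator L on E bounded by ‖f‖_W. It remains to see that the
coefficients ⟨u, T^{-B}_λχ⟩ belong to E^B_d(Λ), i.e. that the frame operator P u = Σ_λ ⟨u,
T^{-B}_λχ⟩ T^B_λχ is bounded on E. Along the diagonals t = s + z its kernel is, up to a phase,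
periodic in s; a Fourier expansion in s turns P into Σ_k ∫ β_k(z) T_zM_{-r_k(z)} dz with rapidly
decaying β_k (`exists_kernel`, `Shifts.exists_frameOperator`). On a TMIB these integrals make sense
by strong continuity of translations and modulations; on a DTMIB, P is the transpose of the frame
operator for -B on the predual.

Consequence. Pairing S_{χ₁}(c) with T^{-B}_λθ_B(ψ) leaves only the term with index λ, by
disjointness of supports, and there the twisting phases cancel. Choosing ψ with θ_B(ψ) equal to the
conjugate of χ₁ makes the constant nonzero, and a multiple of S_{χ₁}R_{ψˇ} is a bounded projection
onto the range. -/

namespace TwistedSeq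

variable {n : ℕ}

/-! ### Phases -/

/-- The phase `exp (2πi s)`. -/
noncomputable def phase (s : ℝ) : ℂ := Complex.exp (2 * Real.pi * Complex.I * (s : ℂ))

theorem phase_add (s t : ℝ) : phase (s + t) = phase s * phase t := by
  unfold phase
  rw [← Complex.exp_add]
  push_cast
  ring_nf

theorem phase_zero : phase 0 = 1 := by simp [phase]

theorem phase_neg (s : ℝ) : phase (-s) = (phase s)⁻¹ := by
  unfold phase
  rw [← Complex.exp_neg]
  push_cast
  ring_nf

theorem phase_int (k : ℤ) : phase k = 1 := by
  unfold phase
  rw [Complex.exp_eq_one_iff]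
  exact ⟨k, by push_cast; ring⟩

theorem norm_phase (s : ℝ) : ‖phase s‖ = 1 := by
  unfold phase
  rw [show (2 * Real.pi * Complex.I * (s : ℂ)) = ((2 * Real.pi * s : ℝ) : ℂ) * Complex.I by
    push_cast; ring]
  exact Complex.norm_exp_ofReal_mul_I _

theorem phase_ne_zero (s : ℝ) : phase s ≠ 0 := Complex.exp_ne_zero _

theorem phase_mul_phase_neg (s : ℝ) : phase s * phase (-s) = 1 := by
  rw [← phase_add, add_neg_cancel, phase_zero]

theorem contDiff_phase : ContDiff ℝ (⊤ : ℕ∞) phase :=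
  (contDiff_const.mul Complex.ofRealCLM.contDiff).cexp

@[fun_prop]
theorem continuous_phase : Continuous phase := contDiff_phase.continuous

theorem fourierChar_eq_phase (s : ℝ) : (Real.fourierChar s : ℂ) = phase s := by
  rw [Real.fourierChar_apply, phase]
  congr 1
  push_cast
  ring

theorem character_eq_phase (ξ t : Rn n) : character ξ t = phase (inner ℝ t ξ) := rfl

theorem fourierInv_eq_phase (f : Rn n → ℂ) (ξ : Rn n) :
    𝓕⁻ f ξ = ∫ t, phase (inner ℝ t ξ) * f t := by
  rw [Real.fourierInv_eq]
  simp only [Circle.smul_def, fourierChar_eq_phase, smul_eq_mul]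

theorem twistedTranslate_eq (B : Matrix (Fin n) (Fin n) ℝ) (x : Rn n) (f : Rn n → ℂ) (t : Rn n) :
    twistedTranslate B x f t = phase (-inner ℝ (mulVec B x) (t - x)) * f (t - x) := by
  rw [twistedTranslate, phase, mul_comm]
  congr 2
  push_cast
  ring

theorem chirp_eq (B : Matrix (Fin n) (Fin n) ℝ) (f : Rn n → ℂ) (x : Rn n) :
    chirp B f x = phase (inner ℝ (mulVec B x) x) * f x := rfl

/-! ### Polynomial decay -/

/-- The decaying function `(1 + ‖x‖)⁻ᴺ`. -/
noncomputable def bracket (N : ℕ) (x : Rn n) : ℝ := ((1 + ‖x‖) ^ N)⁻¹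

theorem bracket_pos (N : ℕ) (x : Rn n) : 0 < bracket N x := by unfold bracket; positivity

theorem bracket_nonneg (N : ℕ) (x : Rn n) : 0 ≤ bracket N x := (bracket_pos N x).le

theorem bracket_le_one (N : ℕ) (x : Rn n) : bracket N x ≤ 1 :=
  inv_le_one_of_one_le₀ (one_le_pow₀ (by simp))

theorem bracket_neg (N : ℕ) (x : Rn n) : bracket N (-x) = bracket N x := by simp [bracket]

theorem bracket_anti {N M : ℕ} (h : N ≤ M) (x : Rn n) : bracket M x ≤ bracket N x := by
  unfold bracket
  gcongr
  simp

theorem bracket_add (N M : ℕ) (x : Rn n) : bracket (N + M) x = bracket N x * bracket M x := by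
  simp [bracket, pow_add, mul_comm]

theorem pow_mul_bracket (N : ℕ) (x : Rn n) : (1 + ‖x‖) ^ N * bracket N x = 1 :=
  mul_inv_cancel₀ (by positivity)

theorem one_add_norm_add_le (x y : Rn n) : 1 + ‖x + y‖ ≤ (1 + ‖x‖) * (1 + ‖y‖) := by
  nlinarith [norm_add_le x y, norm_nonneg x, norm_nonneg y]

/-- Peetre's inequality. -/
theorem bracket_add_le (N : ℕ) (x y : Rn n) :
    bracket N (x + y) ≤ (1 + ‖y‖) ^ N * bracket N x := by
  have h := one_add_norm_add_le (x + y) (-y)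
  rw [add_neg_cancel_right, norm_neg] at h
  unfold bracket
  rw [← div_eq_mul_inv, le_div_iff₀ (by positivity), inv_mul_le_iff₀ (by positivity), ← mul_pow]
  gcongr

theorem bracket_mul_le (N : ℕ) (x y : Rn n) : bracket N x * bracket N y ≤ bracket N (x + y) := by
  unfold bracket
  rw [← mul_inv, ← mul_pow]
  gcongr
  exact one_add_norm_add_le x y

theorem continuous_bracket (N : ℕ) : Continuous (bracket N : Rn n → ℝ) := by
  unfold bracket
  refine Continuous.inv₀ (by fun_prop) fun x => by positivity

theorem integrable_bracket : Integrable (bracket (n + 1) : Rn n → ℝ) := by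
  have := integrable_one_add_norm (μ := (volume : Measure (Rn n))) (r := n + 1) (by simp)
  refine this.congr (Eventually.of_forall fun x => ?_)
  simp only [bracket]
  rw [Real.rpow_neg (by positivity)]
  norm_cast

/-! ### Lattice points -/

/-- The lattice point with integer coordinates `k` with respect to the basis `b`. -/
noncomputable def latticePt (b : Module.Basis (Fin n) ℝ (Rn n)) (k : Fin n → ℤ) : Rn n :=
  ∑ i, (k i : ℝ) • b i

theorem latticePt_add (b : Module.Basis (Fin n) ℝ (Rn n)) (k l : Fin n → ℤ) :
    latticePt b (k + l) = latticePt b k + latticePt b l := by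
  simp [latticePt, add_smul, Finset.sum_add_distrib]

theorem latticePt_neg (b : Module.Basis (Fin n) ℝ (Rn n)) (k : Fin n → ℤ) :
    latticePt b (-k) = -latticePt b k := by
  simp [latticePt]

theorem latticePt_eq (b : Module.Basis (Fin n) ℝ (Rn n)) (k : Fin n → ℤ) :
    latticePt b k = b.equivFun.symm (fun i => (k i : ℝ)) := by
  simp [latticePt, Module.Basis.equivFun_symm_apply]

/-- Integer coordinates of lattice points. -/
noncomputable def latticeEquiv (b : Module.Basis (Fin n) ℝ (Rn n)) :
    (Fin n → ℤ) ≃ Submodule.span ℤ (Set.range b) :=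
  (b.restrictScalars ℤ).equivFun.symm.toEquiv

theorem coe_latticeEquiv (b : Module.Basis (Fin n) ℝ (Rn n)) (k : Fin n → ℤ) :
    (latticeEquiv b k : Rn n) = latticePt b k := by
  simp [latticeEquiv, latticePt, Module.Basis.equivFun_symm_apply, Int.cast_smul_eq_zsmul]

theorem summable_bracket_latticePt (b : Module.Basis (Fin n) ℝ (Rn n)) :
    Summable fun k => bracket (n + 1) (latticePt b k) := by
  classical
  have hr : Module.finrank ℤ (Submodule.span ℤ (Set.range b)) < n + 1 := by
    rw [ZLattice.rank ℝ]; simp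
  have h := ZLattice.summable_norm_pow_inv (Submodule.span ℤ (Set.range b)) (n + 1) hr
  have h2 : Summable fun z : Submodule.span ℤ (Set.range b) => bracket (n + 1) (z : Rn n) := by
    refine Summable.of_norm_bounded_eventually h ?_
    filter_upwards [(Set.finite_singleton
      (0 : Submodule.span ℤ (Set.range b))).compl_mem_cofinite] with z hz
    have hz' : 0 < ‖z‖ := norm_pos_iff.2 hz
    rw [Real.norm_of_nonneg (bracket_nonneg _ _)]
    rw [bracket, ← inv_pow]
    have : ‖z‖ ≤ 1 + ‖(z : Rn n)‖ := by simp
    gcongr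
  have := (latticeEquiv b).summable_iff.2 h2
  simpa [Function.comp_def, coe_latticeEquiv] using this

/-- Uniformity in the shift: the sum does not change when s is replaced by its fractional part with
respect to the lattice, which is bounded, and Peetre's inequality removes a bounded shift. -/
theorem exists_tsum_bracket_le (b : Module.Basis (Fin n) ℝ (Rn n)) :
    ∃ C : ℝ, 0 ≤ C ∧ ∀ s : Rn n,
      ∑' k, ENNReal.ofReal (bracket (n + 1) (latticePt b k + s)) ≤ ENNReal.ofReal C := by
  let R : ℝ := ∑ i, ‖b i‖
  have hR : 0 ≤ R := Finset.sum_nonneg fun i _ => norm_nonneg _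
  have hs := summable_bracket_latticePt b
  refine ⟨(1 + R) ^ (n + 1) * ∑' k, bracket (n + 1) (latticePt b k),
    mul_nonneg (by positivity) (tsum_nonneg fun k => bracket_nonneg _ _), fun s => ?_⟩
  obtain ⟨k₀, hk₀⟩ := (latticeEquiv b).surjective (ZSpan.floor b s)
  have e : ∀ k, latticePt b k + s = latticePt b (k + k₀) + ZSpan.fract b s := by
    intro k
    rw [ZSpan.fract_apply, latticePt_add, ← coe_latticeEquiv b k₀, hk₀]
    abel
  simp only [e]
  refine ((Equiv.addRight k₀).tsum_eq (fun k => ENNReal.ofReal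
    (bracket (n + 1) (latticePt b k + ZSpan.fract b s)))).trans_le ?_
  rw [← tsum_mul_left, ENNReal.ofReal_tsum_of_nonneg (fun k => mul_nonneg (by positivity) (bracket_nonneg _ _))
      (hs.mul_left _)]
  refine ENNReal.tsum_le_tsum fun k => ENNReal.ofReal_le_ofReal ?_
  refine (bracket_add_le _ _ _).trans ?_
  gcongr
  · exact bracket_nonneg _ _
  · exact ZSpan.norm_fract_le b s

/-! ### Moderate weights -/

/-- A positive weight that is moderate with respect to a polynomial. -/
structure Moderate (w : Rn n → ℝ) : Prop where
  pos : ∀ x, 0 < w x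
  bound : ∃ (C : ℝ) (τ : ℕ), 0 < C ∧ ∀ x y, w (x + y) ≤ C * (1 + ‖y‖) ^ τ * w x

theorem Moderate.reflect {w : Rn n → ℝ} (hw : Moderate w) : Moderate fun x => w (-x) := by
  obtain ⟨C, τ, hC, h⟩ := hw.bound
  refine ⟨fun x => hw.pos _, C, τ, hC, fun x y => ?_⟩
  rw [neg_add, ← norm_neg y]
  exact h _ _

theorem Moderate.max_one {w : Rn n → ℝ} (hw : Moderate w) : Moderate fun x => max 1 (w x) := by
  obtain ⟨C, τ, hC, h⟩ := hw.bound
  refine ⟨fun x => lt_max_of_lt_left one_pos, max 1 C, τ, by positivity, fun x y => ?_⟩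
  have h1 : 1 ≤ (1 + ‖y‖) ^ τ := one_le_pow₀ (by simp)
  refine max_le ?_ ((h x y).trans ?_)
  · exact one_le_mul_of_one_le_of_one_le
      (one_le_mul_of_one_le_of_one_le (le_max_left _ _) h1) (le_max_left _ _)
  · have := hw.pos x
    gcongr
    · exact le_max_right _ _
    · exact le_max_right _ _

theorem moderate_one : Moderate fun _ : Rn n => (1 : ℝ) :=
  ⟨fun _ => one_pos, 1, 0, one_pos, fun x y => by simp⟩

theorem moderate_pow (N : ℕ) : Moderate fun x : Rn n => (1 + ‖x‖) ^ N := by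
  refine ⟨fun x => by positivity, 1, N, one_pos, fun x y => ?_⟩
  rw [one_mul, ← mul_pow, mul_comm]
  gcongr
  exact one_add_norm_add_le x y

/-- Moderateness trades w(λ + s) for w(y) at the price of τ powers of the distance to y; the
remaining n + 1 powers of decay are summable over the lattice. -/
theorem Moderate.exists_tsum_le {w : Rn n → ℝ} (hw : Moderate w)
    (b : Module.Basis (Fin n) ℝ (Rn n)) :
    ∃ (N : ℕ) (C : ℝ), 0 ≤ C ∧ ∀ s y : Rn n,
      ∑' k, ENNReal.ofReal (w (latticePt b k + s)) *
        ENNReal.ofReal (bracket N (latticePt b k + s - y)) ≤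
      ENNReal.ofReal C * ENNReal.ofReal (w y) := by
  obtain ⟨C, τ, hC, h⟩ := hw.bound
  obtain ⟨D, hD, hD'⟩ := exists_tsum_bracket_le b
  refine ⟨n + 1 + τ, D * C, by positivity, fun s y => ?_⟩
  have hy := hw.pos y
  calc _ ≤ ∑' k, ENNReal.ofReal (bracket (n + 1) (latticePt b k + (s - y))) *
        ENNReal.ofReal (C * w y) := by
        refine ENNReal.tsum_le_tsum fun k => ?_
        rw [← ENNReal.ofReal_mul (hw.pos _).le, ← ENNReal.ofReal_mul (bracket_nonneg _ _)]
        refine ENNReal.ofReal_le_ofReal ?_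
        have h1 := h y (latticePt b k + s - y)
        rw [add_sub_cancel] at h1
        have h2 := pow_mul_bracket τ (latticePt b k + s - y)
        have h3 := bracket_nonneg (n + 1) (latticePt b k + s - y)
        have h4 := bracket_nonneg τ (latticePt b k + s - y)
        rw [bracket_add, ← add_sub_assoc]
        calc _ ≤ (C * (1 + ‖latticePt b k + s - y‖) ^ τ * w y) *
              (bracket (n + 1) (latticePt b k + s - y) * bracket τ (latticePt b k + s - y)) := by
              gcongr
          _ = C * w y * bracket (n + 1) (latticePt b k + s - y) *
              ((1 + ‖latticePt b k + s - y‖) ^ τ * bracket τ (latticePt b k + s - y)) := by ring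
          _ = _ := by rw [h2]; ring
    _ ≤ ENNReal.ofReal D * ENNReal.ofReal (C * w y) := by
        rw [ENNReal.tsum_mul_right]
        gcongr
        exact hD' _
    _ = _ := by
        rw [ENNReal.ofReal_mul hC.le, ENNReal.ofReal_mul hD]
        ring

/-! ### Operations on Schwartz functions -/

/-- An increasing family of norms that defines the topology of the Schwartz space. -/
noncomputable def schwartzNorm (m : ℕ × ℕ) : Seminorm ℂ 𝓢(Rn n, ℂ) :=
  (Finset.Iic m).sup (schwartzSeminormFamily ℂ (Rn n) ℂ)

theorem continuous_schwartzNorm (m : ℕ × ℕ) :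
    Continuous (schwartzNorm m : Seminorm ℂ 𝓢(Rn n, ℂ)) :=
  (schwartz_withSeminorms ℂ (Rn n) ℂ).finset_sups.continuous_seminorm (Finset.Iic m)

theorem norm_iteratedFDeriv_le_schwartzNorm {m : ℕ × ℕ} {k l : ℕ} (hk : k ≤ m.1) (hl : l ≤ m.2)
    (φ : 𝓢(Rn n, ℂ)) (x : Rn n) :
    (1 + ‖x‖) ^ k * ‖iteratedFDeriv ℝ l φ x‖ ≤ 2 ^ m.1 * schwartzNorm m φ :=
  SchwartzMap.one_add_le_sup_seminorm_apply hk hl φ x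

theorem norm_le_schwartzNorm (N : ℕ) (φ : 𝓢(Rn n, ℂ)) (x : Rn n) :
    ‖φ x‖ ≤ 2 ^ N * schwartzNorm (N, 0) φ * bracket N x := by
  have h := norm_iteratedFDeriv_le_schwartzNorm (m := (N, 0)) le_rfl le_rfl φ x
  rw [norm_iteratedFDeriv_zero] at h
  rw [bracket, ← div_eq_mul_inv, le_div_iff₀ (by positivity), mul_comm]
  exact h

theorem exists_le_schwartzNorm {q : Seminorm ℂ 𝓢(Rn n, ℂ)} (hq : Continuous q) :
    ∃ (m : ℕ × ℕ) (C : ℝ), 0 ≤ C ∧ ∀ φ, q φ ≤ C * schwartzNorm m φ := by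
  obtain ⟨s, C, -, h⟩ := Seminorm.bound_of_continuous (schwartz_withSeminorms ℂ (Rn n) ℂ) q hq
  refine ⟨s.sup id, C, C.2, fun φ => (h φ).trans ?_⟩
  change (C : ℝ) * (s.sup (schwartzSeminormFamily ℂ (Rn n) ℂ)) φ ≤ _
  refine mul_le_mul_of_nonneg_left ?_ C.2
  refine Seminorm.le_def.1 (Finset.sup_mono fun i hi => ?_) φ
  exact Finset.mem_Iic.2 (Finset.le_sup (f := id) hi)

/-- The pointwise product of two Schwartz functions. -/
noncomputable def mulSchwartz (φ σ : 𝓢(Rn n, ℂ)) : 𝓢(Rn n, ℂ) :=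
  SchwartzMap.pairing (ContinuousLinearMap.mul ℂ ℂ) φ σ

@[simp]
theorem mulSchwartz_apply (φ σ : 𝓢(Rn n, ℂ)) (t : Rn n) : mulSchwartz φ σ t = φ t * σ t := rfl

/-- The translate `t ↦ φ (t - x)`. -/
noncomputable def transS (x : Rn n) : 𝓢(Rn n, ℂ) →L[ℂ] 𝓢(Rn n, ℂ) :=
  SchwartzMap.compSubConstCLM ℂ x

@[simp]
theorem transS_apply (x : Rn n) (φ : 𝓢(Rn n, ℂ)) (t : Rn n) : transS x φ t = φ (t - x) := rfl

/-- The modulation `t ↦ exp (2πi t·ξ) φ t`. -/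
noncomputable def modS (ξ : Rn n) : 𝓢(Rn n, ℂ) →L[ℂ] 𝓢(Rn n, ℂ) :=
  SchwartzMap.smulLeftCLM ℂ (character ξ)

@[simp]
theorem modS_apply (ξ : Rn n) (φ : 𝓢(Rn n, ℂ)) (t : Rn n) :
    modS ξ φ t = phase (inner ℝ t ξ) * φ t := by
  simp [modS, SchwartzMap.smulLeftCLM_apply_apply (character_hasTemperateGrowth ξ),
    character_eq_phase]

theorem hasCompactSupport_modS (ξ : Rn n) {φ : 𝓢(Rn n, ℂ)} (h : HasCompactSupport φ) :
    HasCompactSupport (modS ξ φ) := by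
  have : (modS ξ φ : Rn n → ℂ) = fun t => phase (inner ℝ t ξ) * φ t := funext (modS_apply ξ φ)
  rw [this]
  exact h.mul_left

theorem hasCompactSupport_transS (x : Rn n) {φ : 𝓢(Rn n, ℂ)} (h : HasCompactSupport φ) :
    HasCompactSupport (transS x φ) :=
  h.comp_homeomorph (Homeomorph.subRight x)

theorem hasCompactSupport_mulSchwartz {φ : 𝓢(Rn n, ℂ)} (σ : 𝓢(Rn n, ℂ))
    (h : HasCompactSupport φ) : HasCompactSupport (mulSchwartz φ σ) := h.mul_right

/-- Leibniz's rule together with 1 + ‖z‖ ≤ (1 + ‖x‖)(1 + ‖x - z‖): one factor is absorbed by φ,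
which needs N more powers of decay, and the other by the fixed σ. -/
theorem exists_schwartzNorm_mul_transS_le (σ : 𝓢(Rn n, ℂ)) (m : ℕ × ℕ) (N : ℕ) :
    ∃ C : ℝ, 0 ≤ C ∧ ∀ (φ : 𝓢(Rn n, ℂ)) (z : Rn n),
      schwartzNorm m (mulSchwartz φ (transS z σ)) ≤
        C * schwartzNorm (m.1 + N, m.2) φ * bracket N z := by
  let D : ℝ := ∑ i ∈ Finset.range (m.2 + 1), (m.2.choose i : ℝ) * 2 ^ (m.1 + N) *
    (2 ^ N * schwartzNorm (N, m.2) σ)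
  have hD : ∀ l ≤ m.2, ∑ i ∈ Finset.range (l + 1), (l.choose i : ℝ) * 2 ^ (m.1 + N) *
      (2 ^ N * schwartzNorm (N, m.2) σ) ≤ D := by
    intro l hl
    refine (Finset.sum_le_sum (f := fun i => (l.choose i : ℝ) * 2 ^ (m.1 + N) *
      (2 ^ N * schwartzNorm (N, m.2) σ)) (g := fun i => (m.2.choose i : ℝ) * 2 ^ (m.1 + N) *
      (2 ^ N * schwartzNorm (N, m.2) σ)) fun i _ => ?_).trans ?_
    · have : l.choose i ≤ m.2.choose i := Nat.choose_le_choose i hl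
      gcongr
    · refine Finset.sum_le_sum_of_subset_of_nonneg ?_ fun i _ _ => by positivity
      exact Finset.range_subset_range.2 (by omega)
  have hD0 : 0 ≤ D := Finset.sum_nonneg fun i _ => by positivity
  refine ⟨D, hD0, fun φ z => ?_⟩
  refine Seminorm.finset_sup_apply_le ?_ ?_
  · have := bracket_nonneg N z
    positivity
  rintro ⟨k, l⟩ hkl
  obtain ⟨hk, hl⟩ : k ≤ m.1 ∧ l ≤ m.2 := Finset.mem_Iic.1 hkl
  refine SchwartzMap.seminorm_le_bound ℂ k l _ ?_ fun x => ?_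
  · have := bracket_nonneg N z
    positivity
  have h1 := norm_iteratedFDeriv_mul_le (𝕜 := ℝ) (f := φ) (g := transS z σ)
    (N := (⊤ : ℕ∞)) (φ.smooth _) ((transS z σ).smooth _) x (n := l) (mod_cast le_top)
  change ‖iteratedFDeriv ℝ l (mulSchwartz φ (transS z σ)) x‖ ≤ _ at h1
  rw [bracket, ← div_eq_mul_inv, le_div_iff₀ (by positivity)]
  have h2 : ∀ i, iteratedFDeriv ℝ i (transS z σ) x = iteratedFDeriv ℝ i σ (x - z) := fun i =>
    iteratedFDeriv_comp_sub i z x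
  have h3 : (1 + ‖z‖) ^ N ≤ (1 + ‖x‖) ^ N * (1 + ‖x - z‖) ^ N := by
    rw [← mul_pow]
    have := one_add_norm_add_le x (z - x)
    rw [add_sub_cancel, norm_sub_rev] at this
    gcongr
  have h4 : ‖x‖ ^ k ≤ (1 + ‖x‖) ^ m.1 :=
    (pow_le_pow_left₀ (norm_nonneg _) (by simp) _).trans (pow_le_pow_right₀ (by simp) hk)
  calc ‖x‖ ^ k * ‖iteratedFDeriv ℝ l (mulSchwartz φ (transS z σ)) x‖ * (1 + ‖z‖) ^ N
      ≤ (1 + ‖x‖) ^ m.1 * (∑ i ∈ Finset.range (l + 1), (l.choose i : ℝ) *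
          ‖iteratedFDeriv ℝ i φ x‖ * ‖iteratedFDeriv ℝ (l - i) (transS z σ) x‖) *
          ((1 + ‖x‖) ^ N * (1 + ‖x - z‖) ^ N) := by gcongr
    _ = ∑ i ∈ Finset.range (l + 1), (l.choose i : ℝ) *
          ((1 + ‖x‖) ^ (m.1 + N) * ‖iteratedFDeriv ℝ i φ x‖) *
          ((1 + ‖x - z‖) ^ N * ‖iteratedFDeriv ℝ (l - i) σ (x - z)‖) := by
        rw [Finset.mul_sum, Finset.sum_mul]
        refine Finset.sum_congr rfl fun i _ => ?_
        rw [h2, pow_add]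
        ring
    _ ≤ ∑ i ∈ Finset.range (l + 1), (l.choose i : ℝ) *
          (2 ^ (m.1 + N) * schwartzNorm (m.1 + N, m.2) φ) *
          (2 ^ N * schwartzNorm (N, m.2) σ) := by
        refine Finset.sum_le_sum fun i hi => ?_
        have hi' : i ≤ l := Nat.lt_succ_iff.1 (Finset.mem_range.1 hi)
        have e1 := norm_iteratedFDeriv_le_schwartzNorm (m := (m.1 + N, m.2)) (le_refl (m.1 + N))
          (hi'.trans hl) φ x
        have e2 := norm_iteratedFDeriv_le_schwartzNorm (m := (N, m.2)) le_rfl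
          ((Nat.sub_le l i).trans hl) σ (x - z)
        gcongr
    _ = (∑ i ∈ Finset.range (l + 1), (l.choose i : ℝ) * 2 ^ (m.1 + N) *
          (2 ^ N * schwartzNorm (N, m.2) σ)) * schwartzNorm (m.1 + N, m.2) φ := by
        rw [Finset.sum_mul]
        exact Finset.sum_congr rfl fun i _ => by ring
    _ ≤ D * schwartzNorm (m.1 + N, m.2) φ := by
        have := hD l hl
        gcongr

theorem exists_norm_fourierInv_le (N : ℕ) : ∃ (m : ℕ × ℕ) (C : ℝ), 0 ≤ C ∧
    ∀ (φ : 𝓢(Rn n, ℂ)) (ξ : Rn n),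
      ‖𝓕⁻ (φ : Rn n → ℂ) ξ‖ ≤ C * schwartzNorm m φ * bracket N ξ := by
  let q : Seminorm ℂ 𝓢(Rn n, ℂ) := (schwartzNorm (N, 0)).comp
    (FourierTransform.fourierInvCLM ℂ 𝓢(Rn n, ℂ)).toLinearMap
  have hq : Continuous q :=
    (continuous_schwartzNorm (N, 0)).comp (FourierTransform.fourierInvCLM ℂ 𝓢(Rn n, ℂ)).continuous
  obtain ⟨m, C, hC, h⟩ := exists_le_schwartzNorm hq
  refine ⟨m, 2 ^ N * C, by positivity, fun φ ξ => ?_⟩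
  have h1 := norm_le_schwartzNorm N (𝓕⁻ φ) ξ
  rw [SchwartzMap.fourierInv_coe] at h1
  refine h1.trans ?_
  have h2 := h φ
  have h3 := bracket_nonneg N ξ
  calc _ = 2 ^ N * q φ * bracket N ξ := rfl
    _ ≤ 2 ^ N * (C * schwartzNorm m φ) * bracket N ξ := by gcongr
    _ = _ := by ring

/-- Windowed Fourier transforms of Schwartz functions decay rapidly. -/
theorem exists_norm_fourierInv_mul_le (σ : 𝓢(Rn n, ℂ)) (N : ℕ) :
    ∃ (m : ℕ × ℕ) (C : ℝ), 0 ≤ C ∧ ∀ (φ : 𝓢(Rn n, ℂ)) (z ξ : Rn n),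
      ‖𝓕⁻ (fun t => φ t * σ (t - z)) ξ‖ ≤
        C * schwartzNorm m φ * bracket N z * bracket N ξ := by
  obtain ⟨m, C, hC, h⟩ := exists_norm_fourierInv_le (n := n) N
  obtain ⟨D, hD, h'⟩ := exists_schwartzNorm_mul_transS_le σ m N
  refine ⟨(m.1 + N, m.2), C * D, by positivity, fun φ z ξ => ?_⟩
  refine (h (mulSchwartz φ (transS z σ)) ξ).trans ?_
  have h1 := h' φ z
  have h2 := bracket_nonneg N ξ
  calc _ ≤ C * (D * schwartzNorm (m.1 + N, m.2) φ * bracket N z) * bracket N ξ := by gcongr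
    _ = _ := by ring

/-- Translated Schwartz functions overlap little. -/
theorem exists_integral_mul_le (φ : 𝓢(Rn n, ℂ)) (N : ℕ) :
    ∃ (m : ℕ × ℕ) (C : ℝ), 0 ≤ C ∧ ∀ (ψ : 𝓢(Rn n, ℂ)) (x : Rn n),
      ∫ t, ‖φ (t - x)‖ * ‖ψ t‖ ≤ C * schwartzNorm m ψ * bracket N x := by
  let I : ℝ := ∫ t : Rn n, bracket (n + 1) t
  have hI : 0 ≤ I := integral_nonneg fun t => bracket_nonneg _ _
  refine ⟨(N + (n + 1), 0), 2 ^ N * schwartzNorm (N, 0) φ * 2 ^ (N + (n + 1)) * I, by positivity,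
    fun ψ x => ?_⟩
  have hb : ∀ t, ‖φ (t - x)‖ * ‖ψ t‖ ≤ (2 ^ N * schwartzNorm (N, 0) φ *
      (2 ^ (N + (n + 1)) * schwartzNorm (N + (n + 1), 0) ψ) * bracket N x) *
      bracket (n + 1) t := by
    intro t
    have h1 := norm_le_schwartzNorm N φ (t - x)
    have h2 := norm_le_schwartzNorm (N + (n + 1)) ψ t
    have h3 := bracket_mul_le N (x - t) t
    rw [sub_add_cancel, ← neg_sub t x, bracket_neg] at h3
    have h4 := bracket_nonneg (n + 1) t
    rw [bracket_add] at h2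
    calc _ ≤ (2 ^ N * schwartzNorm (N, 0) φ * bracket N (t - x)) * (2 ^ (N + (n + 1)) *
          schwartzNorm (N + (n + 1), 0) ψ * (bracket N t * bracket (n + 1) t)) := by
          gcongr
          have := bracket_nonneg N (t - x)
          positivity
      _ = 2 ^ N * schwartzNorm (N, 0) φ * (2 ^ (N + (n + 1)) * schwartzNorm (N + (n + 1), 0) ψ) *
          (bracket N (t - x) * bracket N t) * bracket (n + 1) t := by ring
      _ ≤ _ := by gcongr
  have hi : Integrable fun t => (2 ^ N * schwartzNorm (N, 0) φ *
      (2 ^ (N + (n + 1)) * schwartzNorm (N + (n + 1), 0) ψ) * bracket N x) *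
      bracket (n + 1) t := integrable_bracket.const_mul _
  refine (integral_mono_of_nonneg (Eventually.of_forall fun t => by positivity) hi
    (Eventually.of_forall hb)).trans (le_of_eq ?_)
  rw [integral_const_mul]
  ring

/-! ### The Fourier transform of a product -/

/-- Fourier inversion is needed for g alone: g is written as the Fourier transform of 𝓕⁻g, and the
transform is then moved to the other factor by Fubini. This is what allows θ to be merely
integrable. -/
theorem fourierInv_mul_eq {g : Rn n → ℂ} (hg : Continuous g) (hgi : Integrable g)
    (hg' : Integrable (𝓕⁻ g)) {θ : Rn n → ℂ} (hθ : Integrable θ) (ζ : Rn n) :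
    𝓕⁻ (fun t => g t * θ t) ζ = ∫ ξ, 𝓕⁻ g ξ * 𝓕⁻ θ (ζ - ξ) := by
  have hgF : Integrable (𝓕 g) := by
    have : 𝓕 g = fun ξ => 𝓕⁻ g (-ξ) := by
      ext ξ; rw [Real.fourierInv_eq_fourier_neg, neg_neg]
    rw [this]
    exact hg'.comp_neg
  have hinv : 𝓕 (𝓕⁻ g) = g := hg.fourier_fourierInv_eq hgi hgF
  have hθ' : Integrable fun t => phase (inner ℝ t ζ) * θ t :=
    hθ.bdd_mul (c := 1) (by fun_prop) (Eventually.of_forall fun t => (norm_phase _).le)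
  have key := VectorFourier.integral_fourierIntegral_smul_eq_flip
    (μ := (volume : Measure (Rn n))) (ν := (volume : Measure (Rn n)))
    (L := innerₗ (Rn n)) (f := 𝓕⁻ g) (g := fun t => phase (inner ℝ t ζ) * θ t)
    Real.continuous_fourierChar (by exact continuous_inner) hg' hθ'
  have e1 : ∀ t, VectorFourier.fourierIntegral Real.fourierChar volume (innerₗ (Rn n)) (𝓕⁻ g) t =
      g t := fun t => congrFun hinv t
  simp only [e1] at key
  rw [fourierInv_eq_phase]
  calc _ = ∫ t, g t • (phase (inner ℝ t ζ) * θ t) := by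
        refine integral_congr_ae (Eventually.of_forall fun t => ?_)
        simp only [smul_eq_mul]; ring
    _ = _ := key
    _ = _ := by
        refine integral_congr_ae (Eventually.of_forall fun ξ => ?_)
        simp only [smul_eq_mul]
        congr 1
        rw [fourierInv_eq_phase, VectorFourier.fourierIntegral]
        refine integral_congr_ae (Eventually.of_forall fun t => ?_)
        simp only [Circle.smul_def, fourierChar_eq_phase, smul_eq_mul, LinearMap.flip_apply,
          innerₗ_apply_apply]
        rw [← mul_assoc, ← phase_add, inner_sub_right, real_inner_comm]
        congr 2
        ring

theorem enorm_fourierInv_mul_le {g : Rn n → ℂ} (hg : Continuous g) (hgi : Integrable g)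
    (hg' : Integrable (𝓕⁻ g)) {θ : Rn n → ℂ} (hθ : Integrable θ) (ζ : Rn n) :
    ‖𝓕⁻ (fun t => g t * θ t) ζ‖ₑ ≤ ∫⁻ ξ, ‖𝓕⁻ g ξ‖ₑ * ‖𝓕⁻ θ (ζ - ξ)‖ₑ := by
  rw [fourierInv_mul_eq hg hgi hg' hθ]
  refine (enorm_integral_le_lintegral_enorm _).trans (le_of_eq ?_)
  simp only [enorm_mul]

theorem continuous_fourierInv {g : Rn n → ℂ} (hg : Integrable g) : Continuous (𝓕⁻ g) := by
  have h : Continuous (𝓕 g) := VectorFourier.fourierIntegral_continuous (μ := volume)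
    (L := innerₗ (Rn n)) Real.continuous_fourierChar (by exact continuous_inner) hg
  have h2 : 𝓕⁻ g = fun ξ => 𝓕 g (-ξ) := funext fun ξ => Real.fourierInv_eq_fourier_neg g ξ
  rw [h2]
  exact h.comp continuous_neg

theorem fourierInv_comp_sub (g : Rn n → ℂ) (x ξ : Rn n) :
    𝓕⁻ (fun t => g (t - x)) ξ = phase (inner ℝ x ξ) * 𝓕⁻ g ξ := by
  rw [fourierInv_eq_phase, fourierInv_eq_phase, ← integral_const_mul,
    ← integral_sub_right_eq_self (fun t => phase (inner ℝ x ξ) * _) x]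
  refine integral_congr_ae (Eventually.of_forall fun t => ?_)
  simp only
  rw [← mul_assoc, ← phase_add, ← inner_add_left, add_sub_cancel]

theorem fourierInv_phase_mul (g : Rn n → ℂ) (q ξ : Rn n) :
    𝓕⁻ (fun t => phase (inner ℝ t q) * g t) ξ = 𝓕⁻ g (ξ + q) := by
  rw [fourierInv_eq_phase, fourierInv_eq_phase]
  refine integral_congr_ae (Eventually.of_forall fun t => ?_)
  simp only
  rw [← mul_assoc, ← phase_add, ← inner_add_right]

/-! ### Periodization -/

theorem finite_latticePt_le (b : Module.Basis (Fin n) ℝ (Rn n)) (R : ℝ) :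
    {k | ‖latticePt b k‖ ≤ R}.Finite := by
  rcases lt_or_ge R 0 with hR | hR
  · refine Set.finite_empty.subset fun k hk => ?_
    have := norm_nonneg (latticePt b k)
    simp only [Set.mem_ofPred_eq] at hk
    linarith
  have h := (summable_bracket_latticePt b).tendsto_cofinite_zero.eventually
    (gt_mem_nhds (show 0 < ((1 + R) ^ (n + 1))⁻¹ by positivity))
  rw [Filter.eventually_cofinite] at h
  refine h.subset fun k hk => ?_
  simp only [Set.mem_ofPred_eq, not_lt] at hk ⊢
  unfold bracket
  gcongr

theorem finite_overlap (b : Module.Basis (Fin n) ℝ (Rn n)) {K V : Set (Rn n)}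
    (hK : Bornology.IsBounded K) (hV : Bornology.IsBounded V) :
    {k | ∃ t ∈ V, t + latticePt b k ∈ K}.Finite := by
  obtain ⟨R, hR⟩ := hK.exists_norm_le
  obtain ⟨S, hS⟩ := hV.exists_norm_le
  refine (finite_latticePt_le b (R + S)).subset ?_
  rintro k ⟨t, ht, htk⟩
  have := norm_sub_le (t + latticePt b k) t
  rw [add_sub_cancel_left] at this
  exact this.trans (add_le_add (hR _ htk) (hS _ ht))

/-- The periodization of `ρ` with respect to the lattice generated by `b`. -/
noncomputable def periodize (b : Module.Basis (Fin n) ℝ (Rn n)) (ρ : Rn n → ℂ) (t : Rn n) : ℂ :=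
  ∑ᶠ k, ρ (t + latticePt b k)

theorem continuous_periodize (b : Module.Basis (Fin n) ℝ (Rn n)) {ρ : Rn n → ℂ}
    (hρ : Continuous ρ) (hρc : HasCompactSupport ρ) : Continuous (periodize b ρ) := by
  refine continuous_finsum (fun k => by fun_prop) fun t => ?_
  refine ⟨Metric.ball t 1, Metric.ball_mem_nhds t one_pos, ?_⟩
  refine (finite_overlap b hρc.isCompact.isBounded
    (Metric.isBounded_ball (x := t) (r := 1))).subset ?_
  rintro k ⟨s, hs, hs'⟩
  exact ⟨s, hs', subset_tsupport _ hs⟩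

theorem periodize_add (b : Module.Basis (Fin n) ℝ (Rn n)) (ρ : Rn n → ℂ) (t : Rn n)
    (k : Fin n → ℤ) : periodize b ρ (t + latticePt b k) = periodize b ρ t := by
  unfold periodize
  refine (finsum_eq_of_bijective (Equiv.addLeft k) (Equiv.addLeft k).bijective fun l => ?_)
  simp [latticePt_add, add_assoc]

/-- The unit box. -/
def unitBox (n : ℕ) : Set (Fin n → ℝ) := {s | ∀ i, s i ∈ Ioc (0 : ℝ) (0 + 1)}

theorem measurableSet_unitBox : MeasurableSet (unitBox n) :=
  MeasurableSet.univ_pi' fun _ => measurableSet_Ioc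

theorem isBounded_unitBox : Bornology.IsBounded (unitBox n) := by
  refine (Metric.isBounded_Icc (0 : Fin n → ℝ) 1).subset fun s hs => ?_
  exact ⟨fun i => (hs i).1.le, fun i => by simpa using (hs i).2⟩

theorem hasSum_integral_unitBox {G : Type*} [NormedAddCommGroup G] [NormedSpace ℝ G]
    {u : (Fin n → ℝ) → G} (hu : Integrable u) :
    HasSum (fun k : Fin n → ℤ => ∫ s in unitBox n, u (s + fun i => (k i : ℝ))) (∫ s, u s) := by
  let T : (Fin n → ℤ) → Set (Fin n → ℝ) := fun k => {s | ∀ i, s i ∈ Ioc (k i : ℝ) (k i + 1)}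
  have hT : ∀ k, MeasurableSet (T k) := fun k => MeasurableSet.univ_pi' fun _ => measurableSet_Ioc
  have hd : Pairwise (Function.onFun Disjoint T) := by
    intro k l hkl
    refine Set.disjoint_left.2 fun s hs hs' => hkl ?_
    ext i
    have h1 := hs i
    have h2 := hs' i
    have h3 : (k i : ℝ) < l i + 1 := h1.1.trans_le h2.2
    have h4 : (l i : ℝ) < k i + 1 := h2.1.trans_le h1.2
    have h5 : k i < l i + 1 := by exact_mod_cast h3
    have h6 : l i < k i + 1 := by exact_mod_cast h4
    omega
  have hU : ⋃ k, T k = univ := by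
    refine eq_univ_of_forall fun s => mem_iUnion.2 ⟨fun i => ⌈s i⌉ - 1, fun i => ?_⟩
    have := Int.ceil_lt_add_one (s i)
    have := Int.le_ceil (s i)
    constructor
    · push_cast; linarith
    · push_cast; linarith
  have h := hasSum_integral_iUnion hT hd hu.integrableOn
  rw [hU, setIntegral_univ] at h
  refine h.congr_fun fun k => ?_
  have hm := measurePreserving_add_right (volume : Measure (Fin n → ℝ)) (fun i => (k i : ℝ))
  have := hm.setIntegral_preimage_emb (MeasurableEquiv.addRight _).measurableEmbedding u (T k)
  rw [← this]
  congr 2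
  ext s
  simp only [unitBox, T, Set.mem_ofPred_eq, mem_preimage, mem_Ioc, Pi.add_apply]
  refine forall_congr' fun i => ?_
  constructor <;> rintro ⟨h1, h2⟩ <;> constructor <;> linarith

/-- The image of Lebesgue measure under a linear isomorphism is a Haar measure, hence a positive
multiple of the volume. The value of κ, the inverse covolume, is never used. -/
theorem exists_integral_comp_basis (b : Module.Basis (Fin n) ℝ (Rn n)) :
    ∃ κ : ℝ, 0 < κ ∧ ∀ f : Rn n → ℂ,
      ∫ s : Fin n → ℝ, f (b.equivFun.symm s) = κ * ∫ t, f t := by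
  let L : (Fin n → ℝ) ≃L[ℝ] Rn n := b.equivFun.symm.toContinuousLinearEquiv
  let μ : Measure (Rn n) := Measure.map L volume
  have : μ.IsAddHaarMeasure := L.isAddHaarMeasure_map volume
  refine ⟨Measure.addHaarScalarFactor μ volume,
    Measure.addHaarScalarFactor_pos_of_isAddHaarMeasure _ _, fun f => ?_⟩
  have h1 : ∫ t, f t ∂μ = ∫ s, f (L s) :=
    integral_map_equiv L.toHomeomorph.toMeasurableEquiv f
  have h2 : μ = Measure.addHaarScalarFactor μ volume • volume :=
    Measure.isAddLeftInvariant_eq_smul μ volume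
  change ∫ s, f (L s) = _
  have h3 : ∫ t, f t ∂μ = ∫ t, f t ∂(Measure.addHaarScalarFactor μ volume • volume) :=
    congrArg (fun ν => ∫ t, f t ∂ν) h2
  rw [← h1, h3, integral_smul_nnreal_measure]
  simp [NNReal.smul_def]

/-- The two bases are dual to each other. -/
def IsDualBasis (b b' : Module.Basis (Fin n) ℝ (Rn n)) : Prop :=
  ∀ i j, inner ℝ (b' i) (b j) = if i = j then (1 : ℝ) else 0

theorem IsDualBasis.inner_latticePt {b b' : Module.Basis (Fin n) ℝ (Rn n)} (h : IsDualBasis b b')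
    (s : Fin n → ℝ) (k : Fin n → ℤ) :
    inner ℝ (b.equivFun.symm s) (latticePt b' k) = ∑ i, (k i : ℝ) * s i := by
  rw [real_inner_comm, latticePt, Module.Basis.equivFun_symm_apply, sum_inner]
  refine Finset.sum_congr rfl fun i _ => ?_
  rw [inner_smul_left, inner_sum]
  simp only [inner_smul_right, h i, mul_ite, mul_one, mul_zero, Finset.sum_ite_eq,
    Finset.mem_univ, if_true]
  rfl

theorem IsDualBasis.phase_latticePt {b b' : Module.Basis (Fin n) ℝ (Rn n)}
    (h : IsDualBasis b b') (m k : Fin n → ℤ) :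
    phase (inner ℝ (latticePt b m) (latticePt b' k)) = 1 := by
  rw [latticePt_eq b, h.inner_latticePt]
  have := phase_int (∑ i, k i * m i)
  push_cast at this
  exact this

theorem exists_isDualBasis (b : Module.Basis (Fin n) ℝ (Rn n)) :
    ∃ b' : Module.Basis (Fin n) ℝ (Rn n), IsDualBasis b b' := by
  let e : Module.Dual ℝ (Rn n) ≃ₗ[ℝ] Rn n :=
    LinearMap.toContinuousLinearMap.trans
      (InnerProductSpace.toDual ℝ (Rn n)).symm.toLinearEquiv
  refine ⟨b.dualBasis.map e, fun i j => ?_⟩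
  have : inner ℝ (e (b.dualBasis i)) (b j) = b.dualBasis i (b j) := by
    change inner ℝ ((InnerProductSpace.toDual ℝ (Rn n)).symm
      (LinearMap.toContinuousLinearMap (b.dualBasis i))) (b j) = _
    rw [InnerProductSpace.toDual_symm_apply]
    rfl
  rw [Module.Basis.map_apply, this, Module.Basis.dualBasis_apply_self]
  simp only [eq_comm]

theorem mFourier_coe (k : Fin n → ℤ) (s : Fin n → ℝ) :
    UnitAddTorus.mFourier k (fun i => (s i : UnitAddCircle)) = phase (∑ i, (k i : ℝ) * s i) := by
  simp only [UnitAddTorus.mFourier, ContinuousMap.coe_mk, fourier_coe_apply, phase]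
  rw [← Complex.exp_sum]
  congr 1
  push_cast
  rw [Finset.mul_sum]
  refine Finset.sum_congr rfl fun i _ => ?_
  simp
  ring

/-- Fourier expansion of a periodization (Poisson's summation formula). -/
theorem exists_hasSum_periodize {b b' : Module.Basis (Fin n) ℝ (Rn n)} (h : IsDualBasis b b') :
    ∃ κ : ℝ, 0 < κ ∧ ∀ ρ : Rn n → ℂ, Continuous ρ → HasCompactSupport ρ →
      (Summable fun k => 𝓕⁻ ρ (latticePt b' k)) → ∀ t,
        HasSum (fun k => κ * 𝓕⁻ ρ (latticePt b' k) * phase (-inner ℝ t (latticePt b' k)))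
          (periodize b ρ t) := by
  obtain ⟨κ, hκ, hκ'⟩ := exists_integral_comp_basis b
  refine ⟨κ, hκ, fun ρ hρ hρc hs t => ?_⟩
  let L : (Fin n → ℝ) ≃L[ℝ] Rn n := b.equivFun.symm.toContinuousLinearEquiv
  have hL : ∀ s, L s = b.equivFun.symm s := fun s => rfl
  have hLk : ∀ k : Fin n → ℤ, L (fun i => (k i : ℝ)) = latticePt b k := fun k =>
    (latticePt_eq b k).symm
  -- Representatives in the box (0,1]ⁿ. They let the periodization descend to the torus; continuity
  -- of the descended function is checked after composition with the open quotient map ℝⁿ → torus,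
  -- since r itself is discontinuous.
  let r : UnitAddTorus (Fin n) → (Fin n → ℝ) := fun θ i => (AddCircle.equivIoc (1 : ℝ) 0 (θ i)).1
  have hr : ∀ s : Fin n → ℝ, ∃ k : Fin n → ℤ,
      s = r (fun i => (s i : UnitAddCircle)) + fun i => (k i : ℝ) := by
    intro s
    have h1 : ∀ i, ∃ k : ℤ, s i = r (fun i => (s i : UnitAddCircle)) i + k := by
      intro i
      have h2 : ((r (fun i => (s i : UnitAddCircle)) i : ℝ) : UnitAddCircle) = (s i : ℝ) :=
        AddCircle.coe_equivIoc
      rw [eq_comm, ← sub_eq_zero, ← AddCircle.coe_sub, AddCircle.coe_eq_zero_iff] at h2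
      obtain ⟨k, hk⟩ := h2
      refine ⟨k, ?_⟩
      rw [zsmul_eq_mul, mul_one] at hk
      rw [hk]
      ring
    choose k hk using h1
    exact ⟨k, funext hk⟩
  let G₀ : UnitAddTorus (Fin n) → ℂ := fun θ => periodize b ρ (L (r θ))
  have hG₀ : ∀ s : Fin n → ℝ, G₀ (fun i => (s i : UnitAddCircle)) = periodize b ρ (L s) := by
    intro s
    obtain ⟨k, hk⟩ := hr s
    change periodize b ρ (L (r _)) = _
    conv_rhs => rw [hk, map_add, hLk, periodize_add]
  have hGc : Continuous G₀ := by
    have hq : IsOpenQuotientMap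
        (Pi.map fun (_ : Fin n) (x : ℝ) => (x : UnitAddCircle)) :=
      IsOpenQuotientMap.piMap fun _ => QuotientAddGroup.isOpenQuotientMap_mk
    rw [hq.isQuotientMap.continuous_iff]
    have : (G₀ ∘ Pi.map fun (_ : Fin n) (x : ℝ) => (x : UnitAddCircle)) =
        fun s => periodize b ρ (L s) := funext hG₀
    rw [this]
    exact (continuous_periodize b hρ hρc).comp L.continuous
  let G : C(UnitAddTorus (Fin n), ℂ) := ⟨G₀, hGc⟩
  have hcoeff : ∀ k, UnitAddTorus.mFourierCoeff G k = κ * 𝓕⁻ ρ (latticePt b' (-k)) := by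
    intro k
    let u : (Fin n → ℝ) → ℂ := fun s => phase (inner ℝ (L s) (latticePt b' (-k))) * ρ (L s)
    have hu : Continuous u := by fun_prop
    have huc : HasCompactSupport u := (hρc.comp_homeomorph L.toHomeomorph).mul_left
    have h1 := hasSum_integral_unitBox (hu.integrable_of_hasCompactSupport huc)
    have h0 : ∫ s, u s = κ * 𝓕⁻ ρ (latticePt b' (-k)) := by
      rw [fourierInv_eq_phase]
      exact hκ' (fun t => phase (inner ℝ t (latticePt b' (-k))) * ρ t)
    rw [h0] at h1
    -- Unfolding: the integral over space is the sum of the integrals over the integer translates of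
    -- the box. Only finitely many translates meet the support of ρ, so sum and integral can be
    -- exchanged, and the character has the same value on all of them.
    rw [← h1.tsum_eq, UnitAddTorus.mFourierCoeff_eq_integral _ _ 0]
    have hbd : Bornology.IsBounded (L '' unitBox n) := by
      obtain ⟨R, hR⟩ := (isBounded_unitBox (n := n)).exists_norm_le
      refine (Metric.isBounded_closedBall (x := (0 : Rn n)) (r := ‖(L : (Fin n → ℝ) →L[ℝ] Rn n)‖ * R)).subset ?_
      rintro _ ⟨s, hs, rfl⟩
      rw [mem_closedBall_zero_iff]
      exact ((L : (Fin n → ℝ) →L[ℝ] Rn n).le_opNorm s).trans (by gcongr; exact hR s hs)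
    let S := (finite_overlap b hρc.isCompact.isBounded hbd).toFinset
    have hS : ∀ m ∉ S, ∀ s ∈ unitBox n, ρ (L s + latticePt b m) = 0 := by
      intro m hm s hs
      by_contra h0
      exact hm ((Set.Finite.mem_toFinset _).2 ⟨L s, ⟨s, hs, rfl⟩, subset_tsupport _ h0⟩)
    have hum : ∀ (m : Fin n → ℤ) s, u (s + fun i => (m i : ℝ)) =
        phase (inner ℝ (L s) (latticePt b' (-k))) * ρ (L s + latticePt b m) := by
      intro m s
      simp only [u, map_add, hLk]
      rw [inner_add_left, phase_add, h.phase_latticePt, mul_one]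
    have h2 : ∑' m : Fin n → ℤ, ∫ s in unitBox n, u (s + fun i => (m i : ℝ)) =
        ∑ m ∈ S, ∫ s in unitBox n, u (s + fun i => (m i : ℝ)) := by
      refine tsum_eq_sum fun m hm => ?_
      refine setIntegral_eq_zero_of_forall_eq_zero fun s hs => ?_
      rw [hum, hS m hm s hs, mul_zero]
    rw [h2, ← integral_finsetSum]
    · refine setIntegral_congr_fun measurableSet_unitBox fun s hs => ?_
      change UnitAddTorus.mFourier (-k) (fun i => (s i : UnitAddCircle)) •
        G₀ (fun i => (s i : UnitAddCircle)) = _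
      rw [hG₀, mFourier_coe]
      simp only [hum]
      rw [← Finset.mul_sum, hL, h.inner_latticePt, smul_eq_mul, periodize,
        finsum_eq_sum_of_support_subset]
      intro m hm
      by_contra hm'
      exact hm (hS m hm' s hs)
    · intro m _
      refine Integrable.integrableOn ?_
      exact (hu.integrable_of_hasCompactSupport huc).comp_add_right _
  have hsum : Summable (UnitAddTorus.mFourierCoeff G) := by
    have e : UnitAddTorus.mFourierCoeff G = fun k => (κ : ℂ) * 𝓕⁻ ρ (latticePt b' (-k)) :=
      funext hcoeff
    rw [e]
    exact ((Equiv.neg (Fin n → ℤ)).summable_iff.2 hs).mul_left _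
  have hfin := UnitAddTorus.hasSum_mFourier_series_apply_of_summable hsum
    (fun i => (L.symm t i : UnitAddCircle))
  have e1 : G (fun i => (L.symm t i : UnitAddCircle)) = periodize b ρ t := by
    change G₀ _ = _
    rw [hG₀, L.apply_symm_apply]
  rw [e1] at hfin
  rw [← (Equiv.neg (Fin n → ℤ)).hasSum_iff] at hfin
  refine hfin.congr_fun fun k => ?_
  simp only [Function.comp_apply, Equiv.neg_apply, hcoeff, neg_neg, mFourier_coe, smul_eq_mul]
  congr 2
  have := h.inner_latticePt (L.symm t) k
  rw [← hL, L.apply_symm_apply] at this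
  rw [this, ← Finset.sum_neg_distrib]
  refine Finset.sum_congr rfl fun i _ => ?_
  simp

/-! ### Smooth partitions of unity by lattice translates -/

theorem exists_bump_integral_one (n : ℕ) : ∃ g : (Fin n → ℝ) → ℝ, ContDiff ℝ (⊤ : ℕ∞) g ∧
    HasCompactSupport g ∧ ∫ s, g s = 1 := by
  let g : ContDiffBump (0 : Fin n → ℝ) := ⟨1, 2, one_pos, one_lt_two⟩
  exact ⟨g.normed volume, g.contDiff_normed, g.hasCompactSupport_normed, g.integral_normed⟩

/-- The average of `g` over the translates of the unit box. -/
noncomputable def boxAverage (g : (Fin n → ℝ) → ℝ) (y : Fin n → ℝ) : ℝ :=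
  ∫ s in unitBox n, g (y - s)

theorem boxAverage_eq (g : (Fin n → ℝ) → ℝ) :
    boxAverage g = convolution ((unitBox n).indicator fun _ => (1 : ℝ)) g
      (ContinuousLinearMap.lsmul ℝ ℝ) volume := by
  ext y
  rw [boxAverage, convolution_def, ← integral_indicator measurableSet_unitBox]
  refine integral_congr_ae (Eventually.of_forall fun s => ?_)
  by_cases hs : s ∈ unitBox n <;> simp [hs]

theorem contDiff_boxAverage {g : (Fin n → ℝ) → ℝ} (hg : ContDiff ℝ (⊤ : ℕ∞) g)
    (hgc : HasCompactSupport g) : ContDiff ℝ (⊤ : ℕ∞) (boxAverage g) := by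
  have hind : LocallyIntegrable ((unitBox n).indicator fun _ => (1 : ℝ)) volume :=
    (locallyIntegrable_const 1).indicator measurableSet_unitBox
  rw [boxAverage_eq]
  exact hgc.contDiff_convolution_right _ hind hg

theorem hasCompactSupport_boxAverage {g : (Fin n → ℝ) → ℝ} (hgc : HasCompactSupport g) :
    HasCompactSupport (boxAverage g) := by
  obtain ⟨R, hR⟩ := hgc.isCompact.isBounded.exists_norm_le
  obtain ⟨S, hS⟩ := (isBounded_unitBox (n := n)).exists_norm_le
  refine HasCompactSupport.intro (isCompact_closedBall (0 : Fin n → ℝ) (R + S)) fun y hy => ?_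
  refine setIntegral_eq_zero_of_forall_eq_zero fun s hs => ?_
  by_contra h0
  refine hy (mem_closedBall_zero_iff.2 ?_)
  have h1 := hR _ (subset_tsupport _ h0)
  have h2 := hS _ hs
  have h3 := norm_add_le (y - s) s
  rw [sub_add_cancel] at h3
  linarith

/-- The integer translates of the unit box tile space, so the averages of g over them add up to the
full integral of g. -/
theorem hasSum_boxAverage {g : (Fin n → ℝ) → ℝ} (hg : Continuous g) (hgc : HasCompactSupport g)
    (hgi : ∫ s, g s = 1) (y : Fin n → ℝ) :
    HasSum (fun k : Fin n → ℤ => boxAverage g (y + fun i => (k i : ℝ))) 1 := by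
  have h1 := hasSum_integral_unitBox (u := fun s => g (y - s))
    ((hg.integrable_of_hasCompactSupport hgc).comp_sub_left y)
  have h2 : ∫ s, g (y - s) = 1 := by rw [integral_sub_left_eq_self g volume y, hgi]
  rw [h2, ← (Equiv.neg (Fin n → ℤ)).hasSum_iff] at h1
  refine h1.congr_fun fun k => ?_
  refine integral_congr_ae (Eventually.of_forall fun s => ?_)
  simp only [Equiv.neg_apply]
  congr 1
  ext i
  simp
  ring

/-- Smooth partitions of unity by lattice translates. -/
theorem exists_partition (b : Module.Basis (Fin n) ℝ (Rn n)) :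
    ∃ β : Rn n → ℝ, ContDiff ℝ (⊤ : ℕ∞) β ∧ HasCompactSupport β ∧
      ∀ t, HasSum (fun k => β (t + latticePt b k)) 1 := by
  obtain ⟨g, hg, hgc, hgi⟩ := exists_bump_integral_one n
  have hβ := contDiff_boxAverage hg hgc
  have hβc := hasCompactSupport_boxAverage hgc
  have hβ1 := hasSum_boxAverage hg.continuous hgc hgi
  generalize boxAverage g = β at hβ hβc hβ1
  let L : (Fin n → ℝ) ≃L[ℝ] Rn n := b.equivFun.symm.toContinuousLinearEquiv
  have hLk : ∀ k : Fin n → ℤ, L (fun i => (k i : ℝ)) = latticePt b k := fun k =>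
    (latticePt_eq b k).symm
  have hc : HasCompactSupport (β ∘ L.symm.toHomeomorph) := hβc.comp_homeomorph _
  refine ⟨β ∘ L.symm.toHomeomorph, hβ.comp L.symm.contDiff, hc, fun t => ?_⟩
  refine (hβ1 (L.symm t)).congr_fun fun k => ?_
  change β (L.symm (t + latticePt b k)) = _
  rw [map_add, ← hLk k, L.symm_apply_apply]

/-! ### Integrals against weights -/

/-- The weight w need not be measurable, so the density cannot be unfolded. The inequality is
obtained by comparing the measures with densities h and C·w. -/
theorem lintegral_mul_le_weighted {w : Rn n → ℝ} {C : ℝ} {g h : Rn n → ℝ≥0∞}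
    (hg : Measurable g) (hh : Measurable h)
    (hle : ∀ x, h x ≤ ENNReal.ofReal C * ENNReal.ofReal (w x)) :
    ∫⁻ x, h x * g x ≤ ENNReal.ofReal C * ∫⁻ x, g x ∂(weighted w) := by
  have h1 := lintegral_withDensity_eq_lintegral_mul volume hh hg
  have h2 : (volume : Measure (Rn n)).withDensity h ≤ ENNReal.ofReal C • weighted w := by
    rw [weighted, ← withDensity_smul' _ _ ENNReal.ofReal_ne_top]
    exact withDensity_mono (Eventually.of_forall hle)
  calc _ = ∫⁻ x, g x ∂(volume.withDensity h) := h1.symm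
    _ ≤ ∫⁻ x, g x ∂(ENNReal.ofReal C • weighted w) := lintegral_mono' h2 le_rfl
    _ = _ := by rw [lintegral_smul_measure, smul_eq_mul]

theorem lintegral_le_weighted {ν : Rn n → ℝ} (hν : ∀ x, 1 ≤ ν x) (g : Rn n → ℝ≥0∞) :
    ∫⁻ x, g x ≤ ∫⁻ x, g x ∂(weighted ν) := by
  refine lintegral_mono' ?_ le_rfl
  rw [weighted]
  conv_lhs => rw [← withDensity_one (μ := (volume : Measure (Rn n)))]
  exact withDensity_mono (Eventually.of_forall fun x => by simpa using hν x)

theorem Moderate.lintegral_bracket_le {w : Rn n → ℝ} (hw : Moderate w) :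
    ∃ (N : ℕ) (C : ℝ), 0 ≤ C ∧ ∀ M ≥ N, ∀ q : Rn n,
      ∫⁻ x, ENNReal.ofReal (bracket M (x - q)) ∂(weighted w) ≤
        ENNReal.ofReal (C * w q) := by
  obtain ⟨C, τ, hC, h⟩ := hw.bound
  let I : ℝ := ∫ x : Rn n, bracket (n + 1) x
  have hI : 0 ≤ I := integral_nonneg fun t => bracket_nonneg _ _
  refine ⟨n + 1 + τ, I * C, by positivity, fun M hM q => ?_⟩
  have hq := hw.pos q
  have h1 : weighted w ≤ (volume : Measure (Rn n)).withDensity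
      fun x => ENNReal.ofReal (C * (1 + ‖x - q‖) ^ τ * w q) := by
    refine withDensity_mono (Eventually.of_forall fun x => ENNReal.ofReal_le_ofReal ?_)
    simpa using h q (x - q)
  refine (lintegral_mono' h1 le_rfl).trans ?_
  have hm : Measurable fun x => ENNReal.ofReal (bracket M (x - q)) :=
    ((continuous_bracket M).measurable.comp (measurable_id.sub_const q)).ennreal_ofReal
  rw [lintegral_withDensity_eq_lintegral_mul _ (by fun_prop) hm]
  calc _ ≤ ∫⁻ x, ENNReal.ofReal (bracket (n + 1) (x - q) * (C * w q)) := by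
        refine lintegral_mono fun x => ?_
        simp only [Pi.mul_apply]
        rw [← ENNReal.ofReal_mul (by positivity)]
        refine ENNReal.ofReal_le_ofReal ?_
        have h2 := bracket_anti hM (x - q)
        have h3 := pow_mul_bracket τ (x - q)
        rw [bracket_add] at h2
        calc _ ≤ C * (1 + ‖x - q‖) ^ τ * w q * (bracket (n + 1) (x - q) * bracket τ (x - q)) := by
              gcongr
          _ = bracket (n + 1) (x - q) * (C * w q) * ((1 + ‖x - q‖) ^ τ * bracket τ (x - q)) := by
              ring
          _ = _ := by rw [h3, mul_one]
    _ = ENNReal.ofReal (∫ x, bracket (n + 1) (x - q) * (C * w q)) := by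
        rw [ofReal_integral_eq_lintegral_ofReal ((integrable_bracket.comp_sub_right q).mul_const _)]
        exact Eventually.of_forall fun x => mul_nonneg (bracket_nonneg _ _) (by positivity)
    _ = _ := by
        rw [integral_mul_const, integral_sub_right_eq_self (bracket (n + 1)) q, mul_assoc]

theorem Moderate.exists_tsum_le' {w : Rn n → ℝ} (hw : Moderate w)
    (b : Module.Basis (Fin n) ℝ (Rn n)) :
    ∃ (N : ℕ) (C : ℝ), 0 ≤ C ∧ ∀ M ≥ N, ∀ s y : Rn n,
      ∑' k, ENNReal.ofReal (w (latticePt b k + s)) *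
        ENNReal.ofReal (bracket M (latticePt b k + s - y)) ≤
      ENNReal.ofReal C * ENNReal.ofReal (w y) := by
  obtain ⟨N, C, hC, h⟩ := hw.exists_tsum_le b
  refine ⟨N, C, hC, fun M hM s y => (ENNReal.tsum_le_tsum fun k => ?_).trans (h s y)⟩
  gcongr
  exact bracket_anti hM _

/-! ### Time-frequency shifts of Schwartz functions in the amalgam space -/

/-- The time-frequency shift `T_p M_q φ`. -/
noncomputable def tfS (p q : Rn n) : 𝓢(Rn n, ℂ) →L[ℂ] 𝓢(Rn n, ℂ) := transS p ∘L modS q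

@[simp]
theorem tfS_apply (p q : Rn n) (φ : 𝓢(Rn n, ℂ)) (t : Rn n) :
    tfS p q φ t = phase (inner ℝ (t - p) q) * φ (t - p) := by
  simp [tfS]

theorem norm_tfS_apply (p q : Rn n) (φ : 𝓢(Rn n, ℂ)) (t : Rn n) :
    ‖tfS p q φ t‖ = ‖φ (t - p)‖ := by
  rw [tfS_apply, norm_mul, norm_phase, one_mul]

theorem hasCompactSupport_tfS (p q : Rn n) {φ : 𝓢(Rn n, ℂ)} (h : HasCompactSupport φ) :
    HasCompactSupport (tfS p q φ) := hasCompactSupport_transS p (hasCompactSupport_modS q h)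

theorem fourierNorm_schwartz_lt_top {ν : Rn n → ℝ} (hν : Moderate ν) (φ : 𝓢(Rn n, ℂ)) :
    fourierNorm ν φ < ∞ := by
  obtain ⟨N, C, hC, h⟩ := hν.lintegral_bracket_le
  obtain ⟨m, D, hD, h'⟩ := exists_norm_fourierInv_le (n := n) N
  have hm : Measurable fun ξ : Rn n => ENNReal.ofReal (bracket N ξ) :=
    (continuous_bracket N).measurable.ennreal_ofReal
  calc fourierNorm ν φ ≤ ∫⁻ ξ, ENNReal.ofReal (D * schwartzNorm m φ) *
        ENNReal.ofReal (bracket N ξ) ∂(weighted ν) := by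
        refine lintegral_mono fun ξ => ?_
        rw [← ENNReal.ofReal_mul (by positivity), ← ofReal_norm]
        exact ENNReal.ofReal_le_ofReal (h' φ ξ)
    _ < ∞ := by
        rw [lintegral_const_mul _ hm]
        have := h N le_rfl 0
        simp only [sub_zero] at this
        exact ENNReal.mul_lt_top ENNReal.ofReal_lt_top (this.trans_lt ENNReal.ofReal_lt_top)

/-- The windowed transform of T_pM_qφ is, up to a phase, that of φ moved by p in time and by -q in
frequency. Rapid decay around the point (p, -q) then gives the factor w(p)ν(-q). -/
theorem exists_amalgamNorm_tfS_le {ν w : Rn n → ℝ} (hν : Moderate ν) (hw : Moderate w)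
    (η : 𝓢(Rn n, ℂ)) : ∃ (m : ℕ × ℕ) (C : ℝ), 0 ≤ C ∧ ∀ (φ : 𝓢(Rn n, ℂ)) (p q : Rn n),
      amalgamNorm ν w η (tfS p q φ) ≤
        ENNReal.ofReal (C * schwartzNorm m φ * (w p * ν (-q))) := by
  obtain ⟨N₁, C₁, hC₁, h₁⟩ := hν.lintegral_bracket_le
  obtain ⟨N₂, C₂, hC₂, h₂⟩ := hw.lintegral_bracket_le
  let N := max N₁ N₂
  obtain ⟨m, D, hD, h'⟩ := exists_norm_fourierInv_mul_le η N
  refine ⟨m, D * C₁ * C₂, by positivity, fun φ p q => ?_⟩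
  have hp := hw.pos p
  have hq := hν.pos (-q)
  have hm : ∀ a : Rn n, Measurable fun ξ : Rn n => ENNReal.ofReal (bracket N (ξ - a)) := fun a =>
    ((continuous_bracket N).measurable.comp (measurable_id.sub_const a)).ennreal_ofReal
  have e : ∀ x ξ, ‖𝓕⁻ (fun t => tfS p q φ t * η (t - x)) ξ‖ =
      ‖𝓕⁻ (fun t => φ t * η (t - (x - p))) (ξ + q)‖ := by
    intro x ξ
    have h := fourierInv_comp_sub (fun t => phase (inner ℝ t q) * (φ t * η (t - (x - p)))) p ξ
    have h' : (fun t => tfS p q φ t * η (t - x)) =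
        fun t => phase (inner ℝ (t - p) q) * (φ (t - p) * η (t - p - (x - p))) := by
      ext t
      rw [tfS_apply, sub_sub_sub_cancel_right]
      ring
    rw [h', h, norm_mul, norm_phase, one_mul, fourierInv_phase_mul]
  have hf : ∀ x, fourierNorm ν (fun t => tfS p q φ t * η (t - x)) ≤
      ENNReal.ofReal (D * schwartzNorm m φ * C₁ * ν (-q)) *
        ENNReal.ofReal (bracket N (x - p)) := by
    intro x
    have hb := bracket_nonneg N (x - p)
    calc _ ≤ ∫⁻ ξ, ENNReal.ofReal (D * schwartzNorm m φ * bracket N (x - p)) *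
          ENNReal.ofReal (bracket N (ξ - -q)) ∂(weighted ν) := by
          refine lintegral_mono fun ξ => ?_
          rw [← ENNReal.ofReal_mul (by positivity), ← ofReal_norm, e, sub_neg_eq_add]
          exact ENNReal.ofReal_le_ofReal (h' φ (x - p) (ξ + q))
      _ ≤ ENNReal.ofReal (D * schwartzNorm m φ * bracket N (x - p)) *
          ENNReal.ofReal (C₁ * ν (-q)) := by
          rw [lintegral_const_mul _ (hm _)]
          gcongr
          exact h₁ N (le_max_left _ _) (-q)
      _ = _ := by
          rw [← ENNReal.ofReal_mul (by positivity), ← ENNReal.ofReal_mul (by positivity)]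
          congr 1
          ring
  calc amalgamNorm ν w η (tfS p q φ) ≤ ∫⁻ x, ENNReal.ofReal (D * schwartzNorm m φ * C₁ * ν (-q)) *
        ENNReal.ofReal (bracket N (x - p)) ∂(weighted w) := lintegral_mono hf
    _ ≤ ENNReal.ofReal (D * schwartzNorm m φ * C₁ * ν (-q)) * ENNReal.ofReal (C₂ * w p) := by
        rw [lintegral_const_mul _ (hm _)]
        gcongr
        exact h₂ N (le_max_right _ _) p
    _ = _ := by
        rw [← ENNReal.ofReal_mul (by positivity)]
        congr 1
        ring

theorem tfS_zero (φ : 𝓢(Rn n, ℂ)) : tfS 0 0 φ = φ := by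
  ext t
  simp [phase_zero]

theorem exists_amalgamNorm_schwartz_le {ν w : Rn n → ℝ} (hν : Moderate ν) (hw : Moderate w)
    (η : 𝓢(Rn n, ℂ)) : ∃ (m : ℕ × ℕ) (C : ℝ), 0 ≤ C ∧ ∀ φ : 𝓢(Rn n, ℂ),
      amalgamNorm ν w η φ ≤ ENNReal.ofReal (C * schwartzNorm m φ) := by
  obtain ⟨m, C, hC, h⟩ := exists_amalgamNorm_tfS_le hν hw η
  have h0 := hw.pos 0
  have h1 := hν.pos (-0)
  refine ⟨m, C * (w 0 * ν (-0)), by positivity, fun φ => ?_⟩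
  have := h φ 0 0
  rw [tfS_zero] at this
  refine this.trans (le_of_eq ?_)
  congr 1
  ring

theorem schwartz_mem_amalgam {ν w : Rn n → ℝ} (hν : Moderate ν) (hw : Moderate w)
    {η : 𝓢(Rn n, ℂ)} (hη : HasCompactSupport η) (φ : 𝓢(Rn n, ℂ)) :
    (φ : Rn n → ℂ) ∈ amalgam ν w η hη := by
  obtain ⟨m, C, -, h⟩ := exists_amalgamNorm_schwartz_le hν hw η
  exact ⟨φ.continuous, fun χ _ => fourierNorm_schwartz_lt_top hν (mulSchwartz φ χ),
    (h φ).trans_lt ENNReal.ofReal_lt_top⟩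

/-- The inclusion of the Schwartz space in the amalgam space, as a linear map. -/
noncomputable def schwartzToAmalgamₗ {ν w : Rn n → ℝ} (hν : Moderate ν) (hw : Moderate w)
    {η : 𝓢(Rn n, ℂ)} (hη : HasCompactSupport η) : 𝓢(Rn n, ℂ) →ₗ[ℂ] Amalgam ν w η hη where
  toFun φ := ⟨φ, schwartz_mem_amalgam hν hw hη φ⟩
  map_add' _ _ := rfl
  map_smul' _ _ := rfl

/-- The inclusion of the Schwartz space in the amalgam space. -/
noncomputable def schwartzToAmalgam {ν w : Rn n → ℝ} (hν : Moderate ν) (hw : Moderate w)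
    {η : 𝓢(Rn n, ℂ)} (hη : HasCompactSupport η) : 𝓢(Rn n, ℂ) →L[ℂ] Amalgam ν w η hη where
  toLinearMap := schwartzToAmalgamₗ hν hw hη
  cont := by
    obtain ⟨m, C, hC, h⟩ := exists_amalgamNorm_schwartz_le hν hw η
    refine WithSeminorms.continuous_normedSpace_rng _ (schwartz_withSeminorms ℂ (Rn n) ℂ) _
      ⟨Finset.Iic m, ⟨C, hC⟩, fun φ => ?_⟩
    change ‖schwartzToAmalgamₗ hν hw hη φ‖ ≤ C * schwartzNorm m φ
    rw [Amalgam.norm_def]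
    exact ENNReal.toReal_le_of_le_ofReal (by positivity) (h φ)

theorem schwartzToAmalgam_apply {ν w : Rn n → ℝ} (hν : Moderate ν) (hw : Moderate w)
    {η : 𝓢(Rn n, ℂ)} (hη : HasCompactSupport η) (φ : 𝓢(Rn n, ℂ)) (t : Rn n) :
    schwartzToAmalgam hν hw hη φ t = φ t := rfl

/-! ### Local Fourier coefficients of functions in the amalgam space -/

/-- The complex conjugate of a Schwartz function. -/
noncomputable def conjS (η : 𝓢(Rn n, ℂ)) : 𝓢(Rn n, ℂ) :=
  SchwartzMap.postcompCLM (𝕜 := ℝ) (Complex.conjCLE : ℂ →L[ℝ] ℂ) η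

@[simp]
theorem conjS_apply (η : 𝓢(Rn n, ℂ)) (t : Rn n) : conjS η t = starRingEnd ℂ (η t) := rfl

theorem stronglyMeasurable_fourierInv_window {f : Rn n → ℂ} (hf : Continuous f)
    (η : 𝓢(Rn n, ℂ)) : StronglyMeasurable (fun p : Rn n × Rn n =>
      𝓕⁻ (fun t => f t * η (t - p.1)) p.2) := by
  simp only [Real.fourierInv_eq]
  refine StronglyMeasurable.integral_prod_right (ν := volume)
    (f := fun (p : Rn n × Rn n) (t : Rn n) =>
      Real.fourierChar (inner ℝ t p.2) • (f t * η (t - p.1))) ?_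
  refine Continuous.stronglyMeasurable ?_
  have := η.continuous
  have := Real.continuous_fourierChar
  simp only [Circle.smul_def, Function.uncurry_def]
  fun_prop

theorem integral_norm_sq_pos {η : 𝓢(Rn n, ℂ)} (hη : HasCompactSupport η) (hη0 : η ≠ 0) :
    0 < ∫ t, ‖η t‖ ^ 2 := by
  have hc : Continuous fun t => ‖η t‖ ^ 2 := by
    have := η.continuous
    fun_prop
  obtain ⟨x, hx⟩ : ∃ x, η x ≠ 0 := by
    by_contra! h
    exact hη0 (SchwartzMap.ext h)
  exact hc.integral_pos_of_hasCompactSupport_nonneg_nonzero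
    (hη.norm.comp_left (g := fun r : ℝ => r ^ 2) (by simp)) (fun t => by positivity)
    (x := x) (by simpa using hx)

theorem integrable_fourierInv_of_fourierNorm {ν : Rn n → ℝ} (hν : ∀ x, 1 ≤ ν x) {g : Rn n → ℂ}
    (hg : Integrable g) (h : fourierNorm ν g < ∞) : Integrable (𝓕⁻ g) :=
  ⟨(continuous_fourierInv hg).aestronglyMeasurable, (lintegral_le_weighted hν _).trans_lt h⟩

/-- Change of window: ∫ |η(t - y)|² dy does not depend on t, so ‖η‖²·f·T_pσ is the integral over y
of (f·T_yη)·(conj(T_yη)·T_pσ), and the transform is taken under the integral by Fubini. -/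
theorem enorm_fourierInv_window_le {f : Rn n → ℂ} (hf : Continuous f) {η σ : 𝓢(Rn n, ℂ)}
    (hη : HasCompactSupport η) (hσ : HasCompactSupport σ) (p ζ : Rn n) :
    ENNReal.ofReal (∫ t, ‖η t‖ ^ 2) * ‖𝓕⁻ (fun t => f t * σ (t - p)) ζ‖ₑ ≤
      ∫⁻ y, ‖𝓕⁻ (fun t => f t * η (t - y) * (conjS η (t - y) * σ (t - p))) ζ‖ₑ := by
  let Φ : Rn n → Rn n → ℂ := fun t y =>
    phase (inner ℝ t ζ) * (f t * η (t - y) * (conjS η (t - y) * σ (t - p)))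
  have hΦc : Continuous (Function.uncurry Φ) := by
    have := η.continuous
    have := (conjS η).continuous
    have := σ.continuous
    simp only [Φ, Function.uncurry_def]
    fun_prop
  have hΦs : HasCompactSupport (Function.uncurry Φ) := by
    have hσ' : IsCompact (tsupport fun t => σ (t - p)) := hσ.comp_homeomorph (Homeomorph.subRight p)
    refine HasCompactSupport.intro (hσ'.prod
      ((IsCompact.prod hσ' hη).image continuous_sub)) ?_
    rintro ⟨t, y⟩ hty
    simp only [Function.uncurry_apply_pair, Φ]
    by_contra h0
    refine hty ⟨subset_tsupport _ fun h => h0 ?_, ?_⟩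
    · simp only at h
      rw [h]; ring
    · refine ⟨(t, t - y), ⟨subset_tsupport _ fun h => h0 ?_, subset_tsupport _ fun h => h0 ?_⟩,
        sub_sub_cancel t y⟩
      · simp only at h
        rw [h]; ring
      · simp only at h
        rw [h]; ring
  have hΦi : Integrable (Function.uncurry Φ) (volume.prod volume) :=
    hΦc.integrable_of_hasCompactSupport hΦs
  have e1 : ∀ t, ∫ y, Φ t y =
      ((∫ t, ‖η t‖ ^ 2 : ℝ) : ℂ) * (phase (inner ℝ t ζ) * (f t * σ (t - p))) := by
    intro t
    have : ∀ y, Φ t y = ((‖η (t - y)‖ ^ 2 : ℝ) : ℂ) * (phase (inner ℝ t ζ) * (f t * σ (t - p))) := by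
      intro y
      simp only [Φ, conjS_apply]
      rw [show ((‖η (t - y)‖ ^ 2 : ℝ) : ℂ) = η (t - y) * starRingEnd ℂ (η (t - y)) by
        rw [Complex.mul_conj, Complex.normSq_eq_norm_sq]]
      ring
    simp only [this]
    have h3 : ∫ y, ((‖η (t - y)‖ ^ 2 : ℝ) : ℂ) = ((∫ t, ‖η t‖ ^ 2 : ℝ) : ℂ) := by
      rw [← integral_sub_left_eq_self (fun y => ‖η y‖ ^ 2) volume t]
      exact integral_ofReal
    rw [integral_mul_const, h3]
  have e2 : ((∫ t, ‖η t‖ ^ 2 : ℝ) : ℂ) * 𝓕⁻ (fun t => f t * σ (t - p)) ζ =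
      ∫ y, 𝓕⁻ (fun t => f t * η (t - y) * (conjS η (t - y) * σ (t - p))) ζ := by
    rw [fourierInv_eq_phase, ← integral_const_mul]
    simp only [← e1]
    rw [integral_integral_swap hΦi]
    refine integral_congr_ae (Eventually.of_forall fun y => ?_)
    simp only [Φ]
    rw [fourierInv_eq_phase]
  have e3 : ENNReal.ofReal (∫ t, ‖η t‖ ^ 2) = ‖((∫ t, ‖η t‖ ^ 2 : ℝ) : ℂ)‖ₑ := by
    rw [← ofReal_norm, Complex.norm_of_nonneg (integral_nonneg fun t => by positivity)]
  rw [e3, ← enorm_mul, e2]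
  exact enorm_integral_le_lintegral_enorm _

/-- In the change of window, the transform of each product is a convolution, and the transform of
the Schwartz factor conj(T_yη)·T_pσ is small unless p is near y and the frequency is small. Local
membership in 𝓕L¹_ν with ν ≥ 1 is what makes 𝓕⁻(f·T_yη) integrable, as the product formula requires.
-/
theorem exists_enorm_fourierInv_window_le {ν : Rn n → ℝ} (hν : ∀ x, 1 ≤ ν x)
    {η σ : 𝓢(Rn n, ℂ)} (hη : HasCompactSupport η) (hη0 : η ≠ 0)
    (hσ : HasCompactSupport σ) (N : ℕ) : ∃ C : ℝ, 0 ≤ C ∧ ∀ f : Rn n → ℂ, Continuous f →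
      (∀ χ : 𝓢(Rn n, ℂ), HasCompactSupport χ → fourierNorm ν (fun t => f t * χ t) < ∞) →
      ∀ p ζ, ‖𝓕⁻ (fun t => f t * σ (t - p)) ζ‖ₑ ≤ ENNReal.ofReal C *
        ∫⁻ y, ENNReal.ofReal (bracket N (p - y)) *
          ∫⁻ ξ, ENNReal.ofReal (bracket N (ζ - ξ)) * ‖𝓕⁻ (fun t => f t * η (t - y)) ξ‖ₑ := by
  obtain ⟨m, D, hD, h⟩ := exists_norm_fourierInv_mul_le σ N
  have hκ := integral_norm_sq_pos hη hη0
  set κ : ℝ := ∫ t, ‖η t‖ ^ 2 with hκdef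
  refine ⟨D * schwartzNorm m (conjS η) / κ, by positivity, fun f hf hf' p ζ => ?_⟩
  have h1 := enorm_fourierInv_window_le hf hη hσ p ζ
  rw [← hκdef] at h1
  have hm : ∀ y, Measurable fun ξ => ENNReal.ofReal (bracket N (ζ - ξ)) *
      ‖𝓕⁻ (fun t => f t * η (t - y)) ξ‖ₑ := fun y =>
    ((continuous_bracket N).measurable.comp (measurable_const.sub measurable_id)).ennreal_ofReal.mul
      (continuous_fourierInv (integrable_window hf η hη y)).measurable.enorm
  have h2 : ∀ y, ‖𝓕⁻ (fun t => f t * η (t - y) * (conjS η (t - y) * σ (t - p))) ζ‖ₑ ≤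
      ENNReal.ofReal (D * schwartzNorm m (conjS η)) * (ENNReal.ofReal (bracket N (p - y)) *
        ∫⁻ ξ, ENNReal.ofReal (bracket N (ζ - ξ)) * ‖𝓕⁻ (fun t => f t * η (t - y)) ξ‖ₑ) := by
    intro y
    have hi := integrable_window hf η hη y
    have hθ : Integrable fun t => conjS η (t - y) * σ (t - p) := by
      have : Integrable fun t => mulSchwartz (transS y (conjS η)) (transS p σ) t :=
        SchwartzMap.integrable _
      exact this
    have hc : Continuous fun t => f t * η (t - y) := by
      have := η.continuous
      fun_prop
    have hb := bracket_nonneg N (p - y)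
    refine (enorm_fourierInv_mul_le hc hi (integrable_fourierInv_of_fourierNorm hν hi
      (hf' (transS y η) (hasCompactSupport_transS y hη))) hθ ζ).trans ?_
    rw [← mul_assoc, ← ENNReal.ofReal_mul (by positivity), ← lintegral_const_mul _ (hm y)]
    refine lintegral_mono fun ξ => ?_
    rw [← mul_assoc, ← ENNReal.ofReal_mul (by positivity), mul_comm]
    gcongr
    have h3 := h (conjS η) (p - y) (ζ - ξ)
    have h4 := fourierInv_comp_sub (fun t => conjS η t * σ (t - (p - y))) y (ζ - ξ)
    simp only [sub_sub_sub_cancel_right] at h4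
    rw [← ofReal_norm, h4, norm_mul, norm_phase, one_mul]
    exact ENNReal.ofReal_le_ofReal h3
  have h3 := h1.trans (lintegral_mono h2)
  rw [lintegral_const_mul' _ _ ENNReal.ofReal_ne_top] at h3
  rw [div_eq_inv_mul, ENNReal.ofReal_mul (by positivity), mul_assoc, ENNReal.ofReal_inv_of_pos hκ,
    ← ENNReal.mul_le_iff_le_inv (by simpa using hκ) ENNReal.ofReal_ne_top]
  exact h3

/-- The weighted sum of the local Fourier coefficients of `f` is controlled by its amalgam norm. -/
theorem exists_tsum_fourierInv_window_le {ν w : Rn n → ℝ} (hν : Moderate ν) (hν1 : ∀ x, 1 ≤ ν x)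
    (hw : Moderate w) {η σ : 𝓢(Rn n, ℂ)} (hη : HasCompactSupport η) (hη0 : η ≠ 0)
    (hσ : HasCompactSupport σ) (c b' : Module.Basis (Fin n) ℝ (Rn n)) :
    ∃ C : ℝ, 0 ≤ C ∧ ∀ (s : (Fin n → ℤ) → Rn n) (f : Rn n → ℂ), Continuous f →
      (∀ χ : 𝓢(Rn n, ℂ), HasCompactSupport χ → fourierNorm ν (fun t => f t * χ t) < ∞) →
      ∑' l, ∑' k, ENNReal.ofReal (w (latticePt c l)) *
        (ENNReal.ofReal (ν (latticePt b' k + s l)) *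
          ‖𝓕⁻ (fun t => f t * σ (t - latticePt c l)) (latticePt b' k + s l)‖ₑ) ≤
        ENNReal.ofReal C * amalgamNorm ν w η f := by
  obtain ⟨N₁, C₁, hC₁, h₁⟩ := hν.exists_tsum_le' b'
  obtain ⟨N₂, C₂, hC₂, h₂⟩ := hw.exists_tsum_le' c
  let N := max N₁ N₂
  obtain ⟨D, hD, h⟩ := exists_enorm_fourierInv_window_le hν1 hη hη0 hσ N
  refine ⟨D * C₁ * C₂, by positivity, fun s f hf hf' => ?_⟩
  have hbr : ∀ a : Rn n, Measurable fun x : Rn n => ENNReal.ofReal (bracket N (a - x)) := fun a =>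
    ((continuous_bracket N).measurable.comp (measurable_const.sub measurable_id)).ennreal_ofReal
  have hg : ∀ y, Measurable fun ξ => ‖𝓕⁻ (fun t => f t * η (t - y)) ξ‖ₑ := fun y =>
    (continuous_fourierInv (integrable_window hf η hη y)).measurable.enorm
  have hjoint : ∀ ζ : Rn n, Measurable fun y => ∫⁻ ξ, ENNReal.ofReal (bracket N (ζ - ξ)) *
      ‖𝓕⁻ (fun t => f t * η (t - y)) ξ‖ₑ := fun ζ =>
    Measurable.lintegral_prod_right' (f := fun p : Rn n × Rn n =>
      ENNReal.ofReal (bracket N (ζ - p.2)) * ‖𝓕⁻ (fun t => f t * η (t - p.1)) p.2‖ₑ)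
      (((hbr ζ).comp measurable_snd).mul
        (stronglyMeasurable_fourierInv_window hf η).measurable.enorm)
  have hG : Measurable fun y => fourierNorm ν (fun t => f t * η (t - y)) :=
    measurable_fourierNorm_window ν hf η
  -- Sum over the frequencies first: the decay in ζ - ξ is summed against ν on the shifted dual
  -- lattice and reproduces ν(ξ), uniformly in the shift s l. The sum over l treats w in the same
  -- way.
  have step1 : ∀ l, ∑' k, ENNReal.ofReal (ν (latticePt b' k + s l)) *
      ‖𝓕⁻ (fun t => f t * σ (t - latticePt c l)) (latticePt b' k + s l)‖ₑ ≤
      ENNReal.ofReal (D * C₁) * ∫⁻ y, ENNReal.ofReal (bracket N (latticePt c l - y)) *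
        fourierNorm ν (fun t => f t * η (t - y)) := by
    intro l
    have hm1 : ∀ k, Measurable fun y => ENNReal.ofReal D *
        (ENNReal.ofReal (bracket N (latticePt c l - y)) *
          (ENNReal.ofReal (ν (latticePt b' k + s l)) *
            ∫⁻ ξ, ENNReal.ofReal (bracket N (latticePt b' k + s l - ξ)) *
              ‖𝓕⁻ (fun t => f t * η (t - y)) ξ‖ₑ)) := fun k =>
      ((hbr _).mul ((hjoint _).const_mul _)).const_mul _
    have hm2 : ∀ k y, Measurable fun ξ => ENNReal.ofReal (ν (latticePt b' k + s l)) *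
        ENNReal.ofReal (bracket N (latticePt b' k + s l - ξ)) *
          ‖𝓕⁻ (fun t => f t * η (t - y)) ξ‖ₑ := fun k y => ((hbr _).const_mul _).mul (hg y)
    calc _ ≤ ∑' k, ∫⁻ y, ENNReal.ofReal D * (ENNReal.ofReal (bracket N (latticePt c l - y)) *
          (ENNReal.ofReal (ν (latticePt b' k + s l)) *
            ∫⁻ ξ, ENNReal.ofReal (bracket N (latticePt b' k + s l - ξ)) *
              ‖𝓕⁻ (fun t => f t * η (t - y)) ξ‖ₑ)) := by
          refine ENNReal.tsum_le_tsum fun k => ?_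
          rw [lintegral_const_mul' _ _ ENNReal.ofReal_ne_top]
          simp only [mul_left_comm (ENNReal.ofReal (bracket N (latticePt c l - _)))]
          rw [lintegral_const_mul' _ _ ENNReal.ofReal_ne_top,
            mul_left_comm (ENNReal.ofReal D)]
          gcongr
          exact h f hf hf' _ _
      _ = ∫⁻ y, ENNReal.ofReal D * (ENNReal.ofReal (bracket N (latticePt c l - y)) *
            ∫⁻ ξ, (∑' k, ENNReal.ofReal (ν (latticePt b' k + s l)) *
              ENNReal.ofReal (bracket N (latticePt b' k + s l - ξ))) *
              ‖𝓕⁻ (fun t => f t * η (t - y)) ξ‖ₑ) := by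
          rw [← lintegral_tsum fun k => (hm1 k).aemeasurable]
          refine lintegral_congr fun y => ?_
          rw [ENNReal.tsum_mul_left, ENNReal.tsum_mul_left]
          congr 2
          have h4 : ∀ k, ENNReal.ofReal (ν (latticePt b' k + s l)) *
              ∫⁻ ξ, ENNReal.ofReal (bracket N (latticePt b' k + s l - ξ)) *
                ‖𝓕⁻ (fun t => f t * η (t - y)) ξ‖ₑ =
              ∫⁻ ξ, ENNReal.ofReal (ν (latticePt b' k + s l)) *
                ENNReal.ofReal (bracket N (latticePt b' k + s l - ξ)) *
                  ‖𝓕⁻ (fun t => f t * η (t - y)) ξ‖ₑ := fun k => by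
            rw [← lintegral_const_mul' _ _ ENNReal.ofReal_ne_top]
            simp only [mul_assoc]
          simp only [h4]
          rw [← lintegral_tsum fun k => (hm2 k y).aemeasurable]
          simp only [ENNReal.tsum_mul_right]
      _ ≤ ∫⁻ y, ENNReal.ofReal D * (ENNReal.ofReal (bracket N (latticePt c l - y)) *
            (ENNReal.ofReal C₁ * fourierNorm ν (fun t => f t * η (t - y)))) := by
          refine lintegral_mono fun y => ?_
          gcongr
          exact lintegral_mul_le_weighted (hg y)
            (Measurable.tsum fun k => (hbr _).const_mul _)
            fun ξ => h₁ N (le_max_left _ _) (s l) ξ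
      _ = _ := by
          rw [ENNReal.ofReal_mul hD, mul_assoc, ← lintegral_const_mul' _ _ ENNReal.ofReal_ne_top,
            ← lintegral_const_mul' _ _ ENNReal.ofReal_ne_top]
          refine lintegral_congr fun y => ?_
          ring
  calc _ ≤ ∑' l, ∫⁻ y, ENNReal.ofReal (D * C₁) * (ENNReal.ofReal (w (latticePt c l)) *
        ENNReal.ofReal (bracket N (latticePt c l - y)) *
          fourierNorm ν (fun t => f t * η (t - y))) := by
        refine ENNReal.tsum_le_tsum fun l => ?_
        rw [ENNReal.tsum_mul_left, lintegral_const_mul' _ _ ENNReal.ofReal_ne_top]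
        simp only [mul_assoc]
        rw [lintegral_const_mul' _ _ ENNReal.ofReal_ne_top, mul_left_comm]
        gcongr
        exact step1 l
    _ = ENNReal.ofReal (D * C₁) * ∫⁻ y, (∑' l, ENNReal.ofReal (w (latticePt c l)) *
        ENNReal.ofReal (bracket N (latticePt c l - y))) *
          fourierNorm ν (fun t => f t * η (t - y)) := by
        have hm3 : ∀ l, Measurable fun y => ENNReal.ofReal (D * C₁) *
            (ENNReal.ofReal (w (latticePt c l)) * ENNReal.ofReal (bracket N (latticePt c l - y)) *
              fourierNorm ν (fun t => f t * η (t - y))) := fun l =>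
          (((hbr _).const_mul _).mul hG).const_mul _
        rw [← lintegral_tsum fun l => (hm3 l).aemeasurable,
          ← lintegral_const_mul' _ _ ENNReal.ofReal_ne_top]
        refine lintegral_congr fun y => ?_
        rw [ENNReal.tsum_mul_left, ENNReal.tsum_mul_right]
    _ ≤ ENNReal.ofReal (D * C₁) * (ENNReal.ofReal C₂ * amalgamNorm ν w η f) := by
        gcongr
        refine lintegral_mul_le_weighted hG (Measurable.tsum fun l => (hbr _).const_mul _)
          fun y => ?_
        simpa using h₂ N (le_max_right _ _) 0 y
    _ = _ := by rw [← mul_assoc, ← ENNReal.ofReal_mul (by positivity)]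

/-! ### Atomic decomposition of the amalgam space -/

theorem Moderate.exists_bracket_sub_le {w : Rn n → ℝ} (hw : Moderate w) :
    ∃ (N : ℕ) (C : ℝ), 0 < C ∧ ∀ x p, w x * bracket N (x - p) ≤ C * w p := by
  obtain ⟨C, τ, hC, h⟩ := hw.bound
  refine ⟨τ, C, hC, fun x p => ?_⟩
  have h1 := h p (x - p)
  rw [add_sub_cancel] at h1
  have h2 := pow_mul_bracket τ (x - p)
  have h3 := bracket_nonneg τ (x - p)
  calc _ ≤ C * (1 + ‖x - p‖) ^ τ * w p * bracket τ (x - p) := by gcongr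
    _ = C * w p * ((1 + ‖x - p‖) ^ τ * bracket τ (x - p)) := by ring
    _ = _ := by rw [h2, mul_one]

theorem Moderate.exists_mul_norm_sub_le {w : Rn n → ℝ} (hw : Moderate w) (φ : 𝓢(Rn n, ℂ)) :
    ∃ C : ℝ, 0 ≤ C ∧ ∀ x p, w x * ‖φ (x - p)‖ ≤ C * w p := by
  obtain ⟨N, C, hC, h⟩ := hw.exists_bracket_sub_le
  refine ⟨2 ^ N * schwartzNorm (N, 0) φ * C, by positivity, fun x p => ?_⟩
  have h1 := norm_le_schwartzNorm N φ (x - p)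
  have h2 := hw.pos x
  calc _ ≤ w x * (2 ^ N * schwartzNorm (N, 0) φ * bracket N (x - p)) := by gcongr
    _ = 2 ^ N * schwartzNorm (N, 0) φ * (w x * bracket N (x - p)) := by ring
    _ ≤ 2 ^ N * schwartzNorm (N, 0) φ * (C * w p) :=
        mul_le_mul_of_nonneg_left (h x p) (by positivity)
    _ = _ := by ring

/-- Zeros of χ are harmless: near any point outside the closed support of φ the quotient vanishes
identically. -/
theorem contDiff_mul_inv {φ χ : Rn n → ℂ} (hφ : ContDiff ℝ (⊤ : ℕ∞) φ)
    (hχ : ContDiff ℝ (⊤ : ℕ∞) χ) (h : ∀ t ∈ tsupport φ, χ t ≠ 0) :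
    ContDiff ℝ (⊤ : ℕ∞) fun t => φ t * (χ t)⁻¹ := by
  rw [contDiff_iff_contDiffAt]
  intro t
  by_cases ht : t ∈ tsupport φ
  · exact hφ.contDiffAt.mul (hχ.contDiffAt.inv (h t ht))
  · refine (contDiffAt_const (c := (0 : ℂ))).congr_of_eventuallyEq ?_
    filter_upwards [notMem_tsupport_iff_eventuallyEq.1 ht] with s hs
    rw [hs]
    simp

/-- The basis `ε • b`. -/
noncomputable def scaledBasis (b : Module.Basis (Fin n) ℝ (Rn n)) {ε : ℝ} (hε : ε ≠ 0) :
    Module.Basis (Fin n) ℝ (Rn n) := b.unitsSMul fun _ => Units.mk0 ε hε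

theorem latticePt_scaledBasis (b : Module.Basis (Fin n) ℝ (Rn n)) {ε : ℝ} (hε : ε ≠ 0)
    (k : Fin n → ℤ) : latticePt (scaledBasis b hε) k = ε • latticePt b k := by
  simp only [latticePt, scaledBasis, Module.Basis.unitsSMul_apply, Finset.smul_sum]
  refine Finset.sum_congr rfl fun i _ => ?_
  rw [smul_comm]
  rfl

/-- χ has no zero on some ball. A partition of unity along b, shrunk by ε and moved into this ball,
can be divided by χ there; the quotient is σ, and c = ε·b. Having σ live where χ ≠ 0 keeps its
support inside U. -/
theorem exists_window (b : Module.Basis (Fin n) ℝ (Rn n)) {χ : 𝓢(Rn n, ℂ)} (hχ0 : χ ≠ 0) :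
    ∃ (c : Module.Basis (Fin n) ℝ (Rn n)) (σ : 𝓢(Rn n, ℂ)), HasCompactSupport σ ∧
      (∀ t, σ t ≠ 0 → χ t ≠ 0) ∧
      ∀ t, HasSum (fun l => σ (t - latticePt c l) * χ (t - latticePt c l)) 1 := by
  obtain ⟨t₀, ht₀⟩ : ∃ t, χ t ≠ 0 := by
    by_contra! h
    exact hχ0 (SchwartzMap.ext h)
  obtain ⟨δ, hδ, hball⟩ := Metric.isOpen_iff.1
    (χ.continuous.isOpen_preimage _ isOpen_compl_singleton) t₀ ht₀
  obtain ⟨β, hβ, hβc, hβ1⟩ := exists_partition b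
  obtain ⟨R, hR⟩ := hβc.isCompact.isBounded.exists_norm_le
  -- The maximum with 0 makes R' positive and the added 1 makes the inequality R < R' strict, so the
  -- shrunk support lies in the open ball.
  let R' := max R 0 + 1
  have hR' : 0 < R' := by positivity
  let ε := δ / R'
  have hε : 0 < ε := by positivity
  let φ : Rn n → ℂ := fun t => (β (ε⁻¹ • (t - t₀)) : ℂ)
  have hφs : ContDiff ℝ (⊤ : ℕ∞) φ := Complex.ofRealCLM.contDiff.comp
    (hβ.comp ((contDiff_const_smul ε⁻¹).comp (contDiff_id.sub contDiff_const)))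
  have hsub : tsupport φ ⊆ (fun t => ε⁻¹ • (t - t₀)) ⁻¹' tsupport β := by
    refine closure_minimal ?_ ((isClosed_tsupport β).preimage (by fun_prop))
    intro t ht
    refine subset_tsupport _ fun h => ht ?_
    simp only [φ]
    rw [h, Complex.ofReal_zero]
  have hφb : ∀ t ∈ tsupport φ, t ∈ Metric.ball t₀ δ := by
    intro t ht
    have h1 := hR _ (hsub ht)
    rw [norm_smul, norm_inv, Real.norm_of_nonneg hε.le, inv_mul_le_iff₀ hε] at h1
    rw [Metric.mem_ball, dist_eq_norm]
    have h2 : R < R' := by simp only [R']; linarith [le_max_left R 0]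
    have h3 : ε * R' = δ := div_mul_cancel₀ _ hR'.ne'
    nlinarith
  have hφχ : ∀ t ∈ tsupport φ, χ t ≠ 0 := fun t ht => hball (hφb t ht)
  have hφc : HasCompactSupport φ := HasCompactSupport.of_support_subset_isCompact
    (isCompact_closedBall t₀ δ) fun t ht =>
      Metric.ball_subset_closedBall (hφb t (subset_tsupport _ ht))
  have hσs := contDiff_mul_inv hφs (χ.smooth ⊤) hφχ
  have hσc : HasCompactSupport fun t => φ t * (χ t)⁻¹ := hφc.mul_right
  let σ : 𝓢(Rn n, ℂ) := hσc.toSchwartzMap hσs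
  have hσ : ∀ t, σ t = φ t * (χ t)⁻¹ := fun t => rfl
  have hσχ : ∀ t, σ t * χ t = φ t := by
    intro t
    rw [hσ]
    by_cases h : φ t = 0
    · simp [h]
    · exact inv_mul_cancel_right₀ (hφχ t (subset_tsupport _ h)) _
  refine ⟨scaledBasis b hε.ne', σ, hσc, fun t ht h => ht ?_, fun t => ?_⟩
  · rw [hσ, h]; simp
  · simp only [hσχ, φ, latticePt_scaledBasis]
    have h1 := (Equiv.neg (Fin n → ℤ)).hasSum_iff.2 (hβ1 (ε⁻¹ • (t - t₀)))
    have h2 := Complex.hasSum_ofReal.2 h1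
    rw [Complex.ofReal_one] at h2
    refine h2.congr_fun ?_
    intro k
    simp only [Function.comp_apply, Equiv.neg_apply, latticePt_neg]
    congr 2
    rw [sub_right_comm, smul_sub, smul_smul, inv_mul_cancel₀ hε.ne', one_smul, sub_eq_add_neg]

/-- The transpose of `x ↦ Bx`. -/
noncomputable def mulVecT (B : Matrix (Fin n) (Fin n) ℝ) (x : Rn n) : Rn n :=
  ContinuousLinearMap.adjoint (Matrix.toEuclideanCLM (𝕜 := ℝ) B) x

theorem inner_mulVecT (B : Matrix (Fin n) (Fin n) ℝ) (x y : Rn n) :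
    inner ℝ x (mulVecT B y) = inner ℝ (mulVec B x) y :=
  ContinuousLinearMap.adjoint_inner_right _ _ _

/-- A system of time-frequency shifts `T_p M_q χ` that commute with the twisted translations along
the lattice with basis `b`, with coefficient functionals that decompose the functions in all
amalgam spaces. -/
structure AtomicSystem (B : Matrix (Fin n) (Fin n) ℝ) (b : Module.Basis (Fin n) ℝ (Rn n))
    (χ : 𝓢(Rn n, ℂ)) where
  p : (Fin n → ℤ) × (Fin n → ℤ) → Rn n
  q : (Fin n → ℤ) × (Fin n → ℤ) → Rn n
  coeff : (Fin n → ℤ) × (Fin n → ℤ) → (Rn n → ℂ) → ℂ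
  coeff_add : ∀ j f g, Continuous f → Continuous g → coeff j (f + g) = coeff j f + coeff j g
  coeff_smul : ∀ j (a : ℂ) f, Continuous f → coeff j (a • f) = a * coeff j f
  commute : ∀ j k, phase (inner ℝ (mulVec B (latticePt b k)) (p j) +
    inner ℝ (latticePt b k) (q j)) = 1
  bound : ∀ {ν w : Rn n → ℝ}, Moderate ν → (∀ x, 1 ≤ ν x) → Moderate w →
    ∀ {η : 𝓢(Rn n, ℂ)} (hη : HasCompactSupport η), η ≠ 0 → ∃ C : ℝ, 0 ≤ C ∧
      ∀ f ∈ amalgam ν w η hη, (Summable fun j => ‖coeff j f‖ * (w (p j) * ν (-q j))) ∧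
        ∑' j, ‖coeff j f‖ * (w (p j) * ν (-q j)) ≤ C * (amalgamNorm ν w η f).toReal
  hasSum : ∀ {ν w : Rn n → ℝ}, Moderate ν → (∀ x, 1 ≤ ν x) → Moderate w →
    ∀ {η : 𝓢(Rn n, ℂ)} (hη : HasCompactSupport η), η ≠ 0 →
      ∀ f ∈ amalgam ν w η hη, ∀ t, HasSum (fun j => coeff j f * tfS (p j) (q j) χ t) (f t)

/-- This is where disjointness of the translates of U enters: on U no other lattice translate of ρ
contributes, so ρ can be read off from its Fourier series over the dual lattice. -/
theorem periodize_eq_self {b : Module.Basis (Fin n) ℝ (Rn n)} {U : Set (Rn n)}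
    (hU : ∀ k, k ≠ 0 → ∀ t ∈ U, t + latticePt b k ∉ U) {ρ : Rn n → ℂ} (hρ : ∀ t ∉ U, ρ t = 0)
    {t : Rn n} (ht : t ∈ U) : periodize b ρ t = ρ t := by
  rw [periodize, finsum_eq_single _ 0 fun k hk => hρ _ (hU k hk t ht)]
  simp [latticePt]

theorem tsum_ofReal_le {ι : Type*} {f : ι → ℝ} (hf : ∀ i, 0 ≤ f i) {C : ℝ≥0∞} (hC : C ≠ ∞)
    (h : ∑' i, ENNReal.ofReal (f i) ≤ C) : Summable f ∧ ∑' i, f i ≤ C.toReal := by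
  have h1 : ∑' i, ENNReal.ofReal (f i) ≠ ∞ := ne_top_of_le_ne_top hC h
  have h2 : Summable f := by
    have := ENNReal.summable_toReal h1
    simpa only [ENNReal.toReal_ofReal (hf _)] using this
  refine ⟨h2, ?_⟩
  rw [← ENNReal.ofReal_tsum_of_nonneg hf h2] at h
  exact (ENNReal.ofReal_le_iff_le_toReal hC).1 h

/-- Local Fourier series at the critical density. The indices are pairs (l, k): l runs over the
pieces of the partition of unity and k over the dual lattice. -/
theorem exists_atomicSystem (B : Matrix (Fin n) (Fin n) ℝ) (b : Module.Basis (Fin n) ℝ (Rn n))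
    {U : Set (Rn n)} (hU : ∀ k, k ≠ 0 → ∀ t ∈ U, t + latticePt b k ∉ U) {χ : 𝓢(Rn n, ℂ)}
    (hχ : IsTest U χ) : Nonempty (AtomicSystem B b χ) := by
  obtain ⟨b', hb'⟩ := exists_isDualBasis b
  obtain ⟨κ, hκ, hper⟩ := exists_hasSum_periodize hb'
  obtain ⟨c, σ, hσ, hσχ, hσ1⟩ := exists_window b hχ.2.2
  have hχU : ∀ t, χ t ≠ 0 → t ∈ U := fun t ht => hχ.2.1 (subset_tsupport _ ht)
  let p : (Fin n → ℤ) × (Fin n → ℤ) → Rn n := fun j => latticePt c j.1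
  -- The shift by Bᵀp is forced by commutation: with q = -r, the expression Bλ·p + λ·q equals minus
  -- the product of λ with a dual lattice point, an integer.
  let r : (Fin n → ℤ) × (Fin n → ℤ) → Rn n := fun j => latticePt b' j.2 + mulVecT B (p j)
  let coeff : (Fin n → ℤ) × (Fin n → ℤ) → (Rn n → ℂ) → ℂ := fun j f =>
    κ * 𝓕⁻ (fun t => f (t + p j) * σ t) (r j)
  have hint : ∀ j f, Continuous f → Integrable fun t => f (t + p j) * σ t := fun j f hf =>
    Continuous.integrable_of_hasCompactSupport
      (by have := σ.continuous; fun_prop) hσ.mul_left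
  have hph : ∀ (ξ : Rn n) (g : Rn n → ℂ), Integrable g →
      Integrable fun t => phase (inner ℝ t ξ) * g t := fun ξ g hg =>
    hg.bdd_mul (c := 1) (by fun_prop) (Eventually.of_forall fun t => (norm_phase _).le)
  have hnorm : ∀ j f, ‖coeff j f‖ = κ * ‖𝓕⁻ (fun t => f t * σ (t - p j)) (r j)‖ := by
    intro j f
    have := fourierInv_comp_sub (fun t => f (t + p j) * σ t) (p j) (r j)
    simp only [sub_add_cancel] at this
    rw [this, norm_mul, norm_mul, norm_phase, one_mul, Complex.norm_of_nonneg hκ.le]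
  have hbound : ∀ {ν w : Rn n → ℝ}, Moderate ν → (∀ x, 1 ≤ ν x) → Moderate w →
      ∀ {η : 𝓢(Rn n, ℂ)} (hη : HasCompactSupport η), η ≠ 0 → ∃ C : ℝ, 0 ≤ C ∧
        ∀ f ∈ amalgam ν w η hη, (Summable fun j => ‖coeff j f‖ * (w (p j) * ν (- -r j))) ∧
          ∑' j, ‖coeff j f‖ * (w (p j) * ν (- -r j)) ≤ C * (amalgamNorm ν w η f).toReal := by
    intro ν w hν hν1 hw η hη hη0
    obtain ⟨C, hC, h⟩ := exists_tsum_fourierInv_window_le hν hν1 hw hη hη0 hσ c b'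
    refine ⟨κ * C, by positivity, fun f hf => ?_⟩
    have h1 := h (fun l => mulVecT B (latticePt c l)) f hf.1 hf.2.1
    have h2 : ∑' j, ENNReal.ofReal (‖coeff j f‖ * (w (p j) * ν (- -r j))) ≤
        ENNReal.ofReal κ * (ENNReal.ofReal C * amalgamNorm ν w η f) := by
      refine le_trans (le_of_eq ?_) (mul_le_mul_right h1 (ENNReal.ofReal κ))
      rw [ENNReal.tsum_prod', ← ENNReal.tsum_mul_left]
      refine tsum_congr fun l => ?_
      rw [← ENNReal.tsum_mul_left]
      refine tsum_congr fun k => ?_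
      have hw' := hw.pos (p (l, k))
      have hν' := hν.pos (r (l, k))
      rw [hnorm, neg_neg, ← ofReal_norm, ← ENNReal.ofReal_mul hν'.le, ← ENNReal.ofReal_mul hw'.le,
        ← ENNReal.ofReal_mul hκ.le]
      congr 1
      ring
    have h3 := tsum_ofReal_le (fun j => mul_nonneg (norm_nonneg _)
      (mul_nonneg (hw.pos _).le (hν.pos _).le)) (ENNReal.mul_lt_top ENNReal.ofReal_lt_top
        (ENNReal.mul_lt_top ENNReal.ofReal_lt_top hf.2.2)).ne h2
    rw [ENNReal.toReal_mul, ENNReal.toReal_mul, ENNReal.toReal_ofReal hκ.le,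
      ENNReal.toReal_ofReal hC, ← mul_assoc] at h3
    exact h3
  refine ⟨⟨p, fun j => -r j, coeff, ?_, ?_, ?_, hbound, ?_⟩⟩
  · intro j f g hf hg
    simp only [coeff]
    rw [← mul_add]
    congr 1
    simp only [fourierInv_eq_phase]
    rw [← integral_add (hph _ _ (hint j f hf)) (hph _ _ (hint j g hg))]
    simp only [Pi.add_apply, add_mul, mul_add]
  · intro j a f hf
    simp only [coeff]
    rw [mul_left_comm]
    congr 1
    simp only [fourierInv_eq_phase]
    rw [← integral_const_mul]
    refine integral_congr_ae (Eventually.of_forall fun t => ?_)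
    simp only [Pi.smul_apply, smul_eq_mul]
    ring
  · intro j k
    simp only [r]
    rw [inner_neg_right, inner_add_right, inner_mulVecT, neg_add_rev, add_neg_cancel_left, phase_neg,
      hb'.phase_latticePt, inv_one]
  · intro ν w hν hν1 hw η hη hη0 f hf t
    obtain ⟨C, hC, hb⟩ := hbound hν hν1 hw hη hη0
    obtain ⟨hs, -⟩ := hb f hf
    have hfib : ∀ l, HasSum (fun k => coeff (l, k) f * tfS (p (l, k)) (-r (l, k)) χ t)
        (f t * (σ (t - latticePt c l) * χ (t - latticePt c l))) := by
      intro l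
      -- The Fourier series recovers the local piece only on U. Where χ(t - c_l) = 0 both sides
      -- vanish, and elsewhere t - c_l lies in U.
      by_cases hχt : χ (t - latticePt c l) = 0
      · have : ∀ k, coeff (l, k) f * tfS (p (l, k)) (-r (l, k)) χ t = 0 := fun k => by
          rw [tfS_apply]
          simp only [p]
          rw [hχt]
          simp
        simp only [this, hχt, mul_zero]
        exact hasSum_zero
      set P := latticePt c l with hP
      -- Modulating the piece by BᵀP makes the dual lattice coefficients of ρ equal to the transform
      -- at the shifted frequencies r; the phase is undone after the expansion.
      let ρ : Rn n → ℂ := fun s => phase (inner ℝ s (mulVecT B P)) * (f (s + P) * σ s)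
      have hρF : ∀ k, 𝓕⁻ ρ (latticePt b' k) = 𝓕⁻ (fun s => f (s + P) * σ s) (r (l, k)) :=
        fun k => fourierInv_phase_mul _ _ _
      have hρ : ∀ s ∉ U, ρ s = 0 := by
        intro s hs
        have : σ s = 0 := by
          by_contra h
          exact hs (hχU s (hσχ s h))
        simp [ρ, this]
      have hsum : Summable fun k => 𝓕⁻ ρ (latticePt b' k) := by
        have h1 := hs.prod_factor l
        refine Summable.of_norm_bounded (g := fun k => (κ * w P)⁻¹ *
          (‖coeff (l, k) f‖ * (w (p (l, k)) * ν (- -r (l, k))))) (h1.mul_left _) fun k => ?_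
        have hwP := hw.pos P
        rw [hρF, inv_mul_eq_div, le_div_iff₀ (by positivity)]
        have h2 : ‖coeff (l, k) f‖ = κ * ‖𝓕⁻ (fun s => f (s + P) * σ s) (r (l, k))‖ := by
          simp only [coeff]
          rw [norm_mul, Complex.norm_of_nonneg hκ.le]
        rw [h2]
        have h3 := hν1 (- -r (l, k))
        calc _ = κ * ‖𝓕⁻ (fun s => f (s + P) * σ s) (r (l, k))‖ * (w P * 1) := by ring
          _ ≤ _ := by
            gcongr
      have h1 := hper ρ (by have := σ.continuous; have := hf.1; fun_prop) hσ.mul_left.mul_left hsum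
        (t - P)
      rw [periodize_eq_self hU hρ (hχU _ hχt)] at h1
      have h2 := h1.mul_left (phase (-inner ℝ (t - P) (mulVecT B P)) * χ (t - P))
      have hval : f t * (σ (t - P) * χ (t - P)) =
          phase (-inner ℝ (t - P) (mulVecT B P)) * χ (t - P) * ρ (t - P) := by
        simp only [ρ]
        rw [sub_add_cancel, phase_neg]
        have := phase_ne_zero (inner ℝ (t - P) (mulVecT B P))
        field_simp
      rw [hval]
      refine h2.congr_fun fun k => ?_
      rw [tfS_apply, hρF]
      have : phase (inner ℝ (t - p (l, k)) (-r (l, k))) =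
          phase (-inner ℝ (t - P) (mulVecT B P)) * phase (-inner ℝ (t - P) (latticePt b' k)) := by
        rw [← phase_add, inner_neg_right]
        congr 1
        simp only [r, p]
        rw [inner_add_right, ← hP]
        ring
      rw [this]
      simp only [coeff]
      ring
    -- Fibrewise sums determine the double sum only once the whole family is known to be summable.
    -- At a fixed t this follows from the weighted bound, because w(t)|χ(t - p)| ≤ D·w(p) and ν ≥ 1.
    have hsum : Summable fun j => coeff j f * tfS (p j) (-r j) χ t := by
      obtain ⟨D, hD, hD'⟩ := hw.exists_mul_norm_sub_le χ
      have hwt := hw.pos t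
      refine Summable.of_norm_bounded (hs.mul_left (D / w t)) fun j => ?_
      rw [norm_mul, norm_tfS_apply, div_mul_eq_mul_div, le_div_iff₀ hwt]
      have h1 := hD' t (p j)
      have h2 := hν1 (- -r j)
      have h3 := hw.pos (p j)
      calc _ = ‖coeff j f‖ * (w t * ‖χ (t - p j)‖) * 1 := by ring
        _ ≤ ‖coeff j f‖ * (D * w (p j)) * ν (- -r j) := by gcongr
        _ = _ := by ring
    have h1 := hsum.hasSum.prod_fiberwise hfib
    have h2 := (hσ1 t).mul_left (f t)
    rw [mul_one] at h2
    rw [h2.unique h1]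
    exact hsum.hasSum

/-! ### Convergence of atomic series -/

/-- Countable subadditivity for a series that is only known to converge pointwise. The hypothesis
`hx` permits taking the windowed transform term by term; after that only Tonelli is used. -/
theorem amalgamNorm_le_tsum {I : Type*} [Countable I] (ν w : Rn n → ℝ) {η : 𝓢(Rn n, ℂ)}
    (hη : HasCompactSupport η) {h : Rn n → ℂ} {a : I → ℂ} {g : I → 𝓢(Rn n, ℂ)}
    (hs : ∀ t, HasSum (fun i => a i * g i t) (h t))
    (hx : ∀ x, Summable fun i => ‖a i‖ * ∫ t, ‖g i t‖ * ‖η (t - x)‖) :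
    amalgamNorm ν w η h ≤ ∑' i, ‖a i‖ₑ * amalgamNorm ν w η (g i) := by
  have hint : ∀ i x, Integrable fun t => g i t * η (t - x) := fun i x =>
    integrable_window (g i).continuous η hη x
  have hF : ∀ x ξ, ‖𝓕⁻ (fun t => h t * η (t - x)) ξ‖ₑ ≤
      ∑' i, ‖a i‖ₑ * ‖𝓕⁻ (fun t => g i t * η (t - x)) ξ‖ₑ := by
    intro x ξ
    have h1 := hasSum_integral_of_summable_integral_norm
      (μ := (volume : Measure (Rn n)))
      (F := fun i t => a i * (phase (inner ℝ t ξ) * (g i t * η (t - x)))) (fun i => by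
        refine Integrable.const_mul ?_ _
        exact (hint i x).bdd_mul (c := 1) (by fun_prop)
          (Eventually.of_forall fun t => (norm_phase _).le)) (by
        refine (hx x).congr fun i => ?_
        rw [← integral_const_mul]
        simp only [norm_mul, norm_phase, one_mul])
    have h2 : ∀ t, ∑' i, a i * (phase (inner ℝ t ξ) * (g i t * η (t - x))) =
        phase (inner ℝ t ξ) * (h t * η (t - x)) := by
      intro t
      have h3 := ((hs t).mul_left (phase (inner ℝ t ξ))).mul_right (η (t - x))
      rw [← mul_assoc, ← h3.tsum_eq]
      exact tsum_congr fun i => by ring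
    simp only [h2, integral_const_mul, ← fourierInv_eq_phase] at h1
    rw [← h1.tsum_eq]
    refine (enorm_tsum_le_tsum_enorm).trans (le_of_eq ?_)
    simp only [enorm_mul]
  have hG : ∀ x, fourierNorm ν (fun t => h t * η (t - x)) ≤
      ∑' i, ‖a i‖ₑ * fourierNorm ν (fun t => g i t * η (t - x)) := by
    intro x
    have hm : ∀ i, Measurable fun ξ => ‖a i‖ₑ * ‖𝓕⁻ (fun t => g i t * η (t - x)) ξ‖ₑ := fun i =>
      (continuous_fourierInv (hint i x)).measurable.enorm.const_mul _
    refine (lintegral_mono (hF x)).trans (le_of_eq ?_)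
    rw [lintegral_tsum fun i => (hm i).aemeasurable]
    refine tsum_congr fun i => lintegral_const_mul' _ _ enorm_ne_top
  have hm : ∀ i, Measurable fun x => ‖a i‖ₑ * fourierNorm ν (fun t => g i t * η (t - x)) :=
    fun i => (measurable_fourierNorm_window ν (g i).continuous η).const_mul _
  refine (lintegral_mono hG).trans (le_of_eq ?_)
  rw [lintegral_tsum fun i => (hm i).aemeasurable]
  refine tsum_congr fun i => lintegral_const_mul' _ _ enorm_ne_top

theorem Moderate.exists_integral_mul_window_le {w : Rn n → ℝ} (hw : Moderate w)
    (χ η : 𝓢(Rn n, ℂ)) : ∃ C : ℝ, 0 ≤ C ∧ ∀ p x,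
      w x * ∫ t, ‖χ (t - p)‖ * ‖η (t - x)‖ ≤ C * w p := by
  obtain ⟨N, C, hC, h⟩ := hw.exists_bracket_sub_le
  obtain ⟨m, D, hD, h'⟩ := exists_integral_mul_le χ N
  refine ⟨D * schwartzNorm m η * C, by positivity, fun p x => ?_⟩
  have h1 : ∫ t, ‖χ (t - p)‖ * ‖η (t - x)‖ = ∫ t, ‖χ (t - (p - x))‖ * ‖η t‖ := by
    rw [← integral_sub_right_eq_self (fun t => ‖χ (t - (p - x))‖ * ‖η t‖) x]
    simp only [sub_sub_sub_cancel_right]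
  have h2 := h' η (p - x)
  rw [← bracket_neg, neg_sub] at h2
  have h3 := hw.pos x
  rw [h1]
  calc _ ≤ w x * (D * schwartzNorm m η * bracket N (x - p)) := by gcongr
    _ = D * schwartzNorm m η * (w x * bracket N (x - p)) := by ring
    _ ≤ D * schwartzNorm m η * (C * w p) := mul_le_mul_of_nonneg_left (h x p) (by positivity)
    _ = _ := by ring

namespace AtomicSystem

variable {B : Matrix (Fin n) (Fin n) ℝ} {b : Module.Basis (Fin n) ℝ (Rn n)} {χ : 𝓢(Rn n, ℂ)}
  {ν w : Rn n → ℝ} {η : 𝓢(Rn n, ℂ)} {hη : HasCompactSupport η}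

/-- The universal way to define maps on the amalgam space: the weighted summability of the
coefficients turns any targets v_j of size w(p_j)ν(-q_j) into an absolutely convergent series. It is
applied below with operators on E, operators on the dual partner, and elements of that partner as
targets. -/
theorem exists_clm {V : Type*} [NormedAddCommGroup V] [NormedSpace ℂ V] [CompleteSpace V]
    (A : AtomicSystem B b χ) (hν : Moderate ν) (hν1 : ∀ x, 1 ≤ ν x) (hw : Moderate w)
    (hη0 : η ≠ 0) {v : (Fin n → ℤ) × (Fin n → ℤ) → V}
    (hv : ∃ D, ∀ j, ‖v j‖ ≤ D * (w (A.p j) * ν (-A.q j))) :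
    ∃ L : Amalgam ν w η hη →L[ℂ] V, ∀ f : Amalgam ν w η hη,
      HasSum (fun j => A.coeff j f • v j) (L f) := by
  obtain ⟨C, hC, h⟩ := A.bound hν hν1 hw hη hη0
  obtain ⟨D, hv⟩ := hv
  have hle : ∀ (f : Amalgam ν w η hη) j, ‖A.coeff j f • v j‖ ≤
      D * (‖A.coeff j f‖ * (w (A.p j) * ν (-A.q j))) := fun f j => by
    rw [norm_smul, mul_left_comm]
    exact mul_le_mul_of_nonneg_left (hv j) (norm_nonneg _)
  have hsn : ∀ f : Amalgam ν w η hη, Summable fun j => ‖A.coeff j f • v j‖ := fun f =>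
    Summable.of_nonneg_of_le (fun _ => norm_nonneg _) (hle f) ((h f f.2).1.mul_left D)
  have hs : ∀ f : Amalgam ν w η hη, Summable fun j => A.coeff j f • v j := fun f => (hsn f).of_norm
  let L₀ : Amalgam ν w η hη →ₗ[ℂ] V :=
    { toFun := fun f => ∑' j, A.coeff j f • v j
      map_add' := fun f g => by
        rw [← (hs f).tsum_add (hs g)]
        refine tsum_congr fun j => ?_
        rw [map_add, A.coeff_add j (Amalgam.toFun f) (Amalgam.toFun g) f.2.1 g.2.1, add_smul]
      map_smul' := fun a f => by
        rw [RingHom.id_apply, ← (hs f).tsum_const_smul]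
        refine tsum_congr fun j => ?_
        rw [map_smul, A.coeff_smul j a (Amalgam.toFun f) f.2.1, mul_smul] }
  have hD : 0 ≤ D := by
    have h1 := (norm_nonneg _).trans (hv 0)
    exact nonneg_of_mul_nonneg_left h1 (mul_pos (hw.pos _) (hν.pos _))
  refine ⟨L₀.mkContinuous (D * C) fun f => ?_, fun f => (hs f).hasSum⟩
  have h1 : ∑' j, ‖A.coeff j f • v j‖ ≤ D * (C * ‖f‖) := by
    refine ((hsn f).tsum_le_tsum (hle f) ((h f f.2).1.mul_left D)).trans ?_
    rw [tsum_mul_left]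
    exact mul_le_mul_of_nonneg_left (h f f.2).2 hD
  rw [mul_assoc]
  exact (norm_tsum_le_tsum_norm (hsn f)).trans h1

/-- The finite partial sums of the atomic decomposition are Schwartz functions, and the amalgam norm
of the remainder is bounded by the tail of the weighted coefficient sum. -/
theorem denseRange_schwartzToAmalgam (A : AtomicSystem B b χ) (hν : Moderate ν)
    (hν1 : ∀ x, 1 ≤ ν x) (hw : Moderate w) (hη0 : η ≠ 0) :
    DenseRange (schwartzToAmalgam hν hw hη) := by
  obtain ⟨C, hC, h⟩ := A.bound hν hν1 hw hη hη0
  obtain ⟨m, D, hD, h'⟩ := exists_amalgamNorm_tfS_le hν hw η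
  obtain ⟨M, hM, hM'⟩ := hw.exists_integral_mul_window_le χ η
  intro f
  obtain ⟨hs, -⟩ := h f f.2
  set a : (Fin n → ℤ) × (Fin n → ℤ) → ℝ := fun j =>
    ‖A.coeff j f‖ * (w (A.p j) * ν (-A.q j)) with ha
  have ha0 : ∀ j, 0 ≤ a j := fun j =>
    mul_nonneg (norm_nonneg _) (mul_nonneg (hw.pos _).le (hν.pos _).le)
  let K := D * schwartzNorm m χ
  have hK : 0 ≤ K := by positivity
  let F : Finset ((Fin n → ℤ) × (Fin n → ℤ)) → 𝓢(Rn n, ℂ) := fun s =>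
    ∑ j ∈ s, A.coeff j f • tfS (A.p j) (A.q j) χ
  have hnorm : ∀ s, ‖f - schwartzToAmalgam hν hw hη (F s)‖ ≤
      K * ∑' j : {j // j ∉ s}, a j := by
    intro s
    have h1 : ∀ t, HasSum (fun j : {j // j ∉ s} => A.coeff j f * tfS (A.p j) (A.q j) χ t)
        ((f - schwartzToAmalgam hν hw hη (F s) : Amalgam ν w η hη) t) := by
      intro t
      have h2 := A.hasSum hν hν1 hw hη hη0 f f.2 t
      have h3 := (s.hasSum_compl_iff (f := fun j => A.coeff j f * tfS (A.p j) (A.q j) χ t)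
        (a := (f - schwartzToAmalgam hν hw hη (F s) : Amalgam ν w η hη) t)).2
      refine h3 ?_
      have h4 : (f - schwartzToAmalgam hν hw hη (F s) : Amalgam ν w η hη) t +
          ∑ j ∈ s, A.coeff j f * tfS (A.p j) (A.q j) χ t = f t := by
        rw [map_sub, Pi.sub_apply, schwartzToAmalgam_apply]
        simp [F]
      rw [h4]
      exact h2
    have h2 := amalgamNorm_le_tsum ν w hη h1 (fun x => by
      have hwx := hw.pos x
      refine Summable.of_nonneg_of_le (fun j => mul_nonneg (norm_nonneg _)
        (integral_nonneg fun t => by positivity)) (fun j => ?_)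
        ((hs.subtype _).mul_left (M / w x))
      rw [div_mul_eq_mul_div, le_div_iff₀ hwx]
      simp only [norm_tfS_apply, Function.comp_apply]
      have h4 := hM' (A.p j) x
      have h5 := hν1 (-A.q j)
      have h6 := hw.pos (A.p j)
      calc _ = ‖A.coeff j f‖ * (w x * ∫ t, ‖χ (t - A.p j)‖ * ‖η (t - x)‖) * 1 := by ring
        _ ≤ ‖A.coeff j f‖ * (M * w (A.p j)) * ν (-A.q j) := by gcongr
        _ = _ := by rw [ha]; ring)
    rw [Amalgam.norm_def]
    refine ENNReal.toReal_le_of_le_ofReal (mul_nonneg hK (tsum_nonneg fun j => ha0 _)) (h2.trans ?_)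
    have hsum : Summable fun j : {j // j ∉ s} => K * a j := (hs.subtype _).mul_left _
    rw [← tsum_mul_left, ENNReal.ofReal_tsum_of_nonneg (fun j => mul_nonneg hK (ha0 _)) hsum]
    refine ENNReal.tsum_le_tsum fun j => ?_
    rw [← ofReal_norm]
    refine (mul_le_mul_right (h' χ _ _) _).trans (le_of_eq ?_)
    rw [← ENNReal.ofReal_mul (norm_nonneg _)]
    congr 1
    simp only [ha, K]
    ring
  have hlim : Tendsto (fun s => schwartzToAmalgam hν hw hη (F s)) atTop (𝓝 f) := by
    rw [tendsto_iff_norm_sub_tendsto_zero]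
    have h1 := (tendsto_tsum_compl_atTop_zero a).const_mul K
    rw [mul_zero] at h1
    refine squeeze_zero (fun s => norm_nonneg _) (fun s => ?_) h1
    rw [norm_sub_rev]
    exact hnorm s
  exact mem_closure_of_tendsto hlim (Eventually.of_forall fun s => ⟨F s, rfl⟩)

end AtomicSystem

variable {E F : Type*} [NormedAddCommGroup E] [NormedSpace ℂ E]
  [NormedAddCommGroup F] [NormedSpace ℂ F]

/-! ### Translations and modulations on dual pairs of spaces of distributions -/

theorem schwartz_apply (φ ψ : 𝓢(Rn n, ℂ)) : (φ : 𝓢'(Rn n, ℂ)) ψ = ∫ t, φ t * ψ t := by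
  rw [SchwartzMap.coe_apply]
  simp only [smul_eq_mul, mul_comm]

theorem translate_apply (x : Rn n) (u : 𝓢'(Rn n, ℂ)) (φ : 𝓢(Rn n, ℂ)) :
    translate x u φ = u (transS (-x) φ) := rfl

theorem modulate_apply (ξ : Rn n) (u : 𝓢'(Rn n, ℂ)) (φ : 𝓢(Rn n, ℂ)) :
    modulate ξ u φ = u (modS ξ φ) := rfl

theorem translate_schwartz (x : Rn n) (φ : 𝓢(Rn n, ℂ)) :
    translate x (φ : 𝓢'(Rn n, ℂ)) = (transS x φ : 𝓢(Rn n, ℂ)) := by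
  ext ψ
  rw [translate_apply, schwartz_apply, schwartz_apply,
    ← integral_sub_right_eq_self (fun t => φ t * (transS (-x) ψ) t) x]
  simp

theorem modulate_schwartz (ξ : Rn n) (φ : 𝓢(Rn n, ℂ)) :
    modulate ξ (φ : 𝓢'(Rn n, ℂ)) = (modS ξ φ : 𝓢(Rn n, ℂ)) := by
  ext ψ
  rw [modulate_apply, schwartz_apply, schwartz_apply]
  refine integral_congr_ae (Eventually.of_forall fun t => ?_)
  simp only [modS_apply]
  ring

theorem integral_mul_conjS_ne_zero {χ : 𝓢(Rn n, ℂ)} (hχ : HasCompactSupport χ) (hχ0 : χ ≠ 0) :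
    ∫ t, χ t * conjS χ t ≠ 0 := by
  have h3 : (∫ t, χ t * conjS χ t) = ((∫ t, ‖χ t‖ ^ 2 : ℝ) : ℂ) := by
    rw [← integral_complex_ofReal]
    refine integral_congr_ae (Eventually.of_forall fun t => ?_)
    simp only [conjS_apply]
    rw [Complex.mul_conj, Complex.normSq_eq_norm_sq]
  rw [h3, Ne, Complex.ofReal_eq_zero]
  exact (integral_norm_sq_pos hχ hχ0).ne'

theorem tsupport_conjS (χ : 𝓢(Rn n, ℂ)) : tsupport (conjS χ) = tsupport χ := by
  unfold tsupport
  congr 1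
  ext t
  simp

theorem hasCompactSupport_conjS {χ : 𝓢(Rn n, ℂ)} (hχ : HasCompactSupport χ) :
    HasCompactSupport (conjS χ) := by
  rwa [HasCompactSupport, tsupport_conjS]

/-- The translations and modulations as operators on the space `E` of distributions, together with
the inclusion of the Schwartz space. -/
structure Shifts (ι : Inclusion n E) where
  complete : CompleteSpace E
  j : 𝓢(Rn n, ℂ) →ₗ[ℂ] E
  T : Rn n → E →L[ℂ] E
  M : Rn n → E →L[ℂ] E
  j_dist : ∀ φ, ι.toDist (j φ) = (φ : 𝓢'(Rn n, ℂ))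
  T_dist : ∀ x e, ι.toDist (T x e) = translate x (ι.toDist e)
  M_dist : ∀ ξ e, ι.toDist (M ξ e) = modulate ξ (ι.toDist e)
  T_bound : ∃ (C : ℝ) (τ : ℕ), 0 < C ∧ ∀ x, ‖T x‖ ≤ C * (1 + ‖x‖) ^ τ
  M_bound : ∃ (C : ℝ) (τ : ℕ), 0 < C ∧ ∀ ξ, ‖M ξ‖ ≤ C * (1 + ‖ξ‖) ^ τ

/-- By injectivity of the inclusion, the only e' representing the transformed distribution is S e,
so both infima are over the same set of constants. -/
theorem opNormOn_eq {ι : Inclusion n E} {S : E →L[ℂ] E} {D : 𝓢'(Rn n, ℂ) → 𝓢'(Rn n, ℂ)}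
    (h : ∀ e, ι.toDist (S e) = D (ι.toDist e)) : opNormOn ι D = ‖S‖ := by
  rw [opNormOn, ContinuousLinearMap.norm_def]
  congr 1
  ext C
  simp only [Set.mem_ofPred_eq]
  refine and_congr_right fun _ => ⟨fun H e => H e _ (h e), fun H e e' he => ?_⟩
  have : e' = S e := ι.injective (by rw [he, h])
  rw [this]
  exact H e

namespace Shifts

variable {ι : Inclusion n E} (A : Shifts ι)
include A

theorem T_j (x : Rn n) (φ : 𝓢(Rn n, ℂ)) : A.T x (A.j φ) = A.j (transS x φ) := by
  apply ι.injective
  rw [A.T_dist, A.j_dist, A.j_dist, translate_schwartz]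

theorem M_j (ξ : Rn n) (φ : 𝓢(Rn n, ℂ)) : A.M ξ (A.j φ) = A.j (modS ξ φ) := by
  apply ι.injective
  rw [A.M_dist, A.j_dist, A.j_dist, modulate_schwartz]

theorem T_M_j (x ξ : Rn n) (φ : 𝓢(Rn n, ℂ)) : A.T x (A.M ξ (A.j φ)) = A.j (tfS x ξ φ) := by
  rw [A.M_j, A.T_j]
  rfl

theorem dist_T_M (x ξ : Rn n) (e : E) (ψ : 𝓢(Rn n, ℂ)) :
    ι.toDist (A.T x (A.M ξ e)) ψ = ι.toDist e (modS ξ (transS (-x) ψ)) := by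
  rw [A.T_dist, A.M_dist, translate_apply, modulate_apply]

theorem T_add (x y : Rn n) : A.T (x + y) = A.T y ∘L A.T x := by
  ext e
  apply ι.injective
  rw [ContinuousLinearMap.comp_apply, A.T_dist, A.T_dist, A.T_dist]
  ext ψ
  simp only [translate_apply]
  congr 1
  ext t
  simp only [transS_apply]
  congr 1
  abel

theorem M_add (x y : Rn n) : A.M (x + y) = A.M y ∘L A.M x := by
  ext e
  apply ι.injective
  rw [ContinuousLinearMap.comp_apply, A.M_dist, A.M_dist, A.M_dist]
  ext ψ
  simp only [modulate_apply]
  congr 1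
  ext t
  simp only [modS_apply]
  rw [inner_add_right, phase_add, mul_assoc]

theorem T_zero : A.T 0 = ContinuousLinearMap.id ℂ E := by
  ext e
  apply ι.injective
  rw [A.T_dist]
  ext ψ
  simp only [translate_apply, ContinuousLinearMap.id_apply]
  congr 1
  ext t
  simp

theorem M_zero : A.M 0 = ContinuousLinearMap.id ℂ E := by
  ext e
  apply ι.injective
  rw [A.M_dist]
  ext ψ
  simp only [modulate_apply, ContinuousLinearMap.id_apply]
  congr 1
  ext t
  simp [phase_zero]

theorem transWeight_eq (x : Rn n) : transWeight ι x = ‖A.T x‖ := opNormOn_eq (A.T_dist x)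

theorem modWeight_eq (ξ : Rn n) : modWeight ι ξ = ‖A.M (-ξ)‖ := opNormOn_eq (A.M_dist (-ξ))

theorem j_ne_zero {χ : 𝓢(Rn n, ℂ)} (hχ : HasCompactSupport χ) (hχ0 : χ ≠ 0) : A.j χ ≠ 0 := by
  intro h
  have h1 := A.j_dist χ
  rw [h, map_zero] at h1
  have h2 : (∫ t, χ t * conjS χ t) = 0 := by
    rw [← schwartz_apply, ← h1]
    rfl
  exact integral_mul_conjS_ne_zero hχ hχ0 h2

/-- Submultiplicativity comes from the group law and polynomial growth from the assumed bound.
Positivity uses that T_x is invertible on a nonzero space. -/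
theorem moderate_T [Nontrivial E] : Moderate fun x => ‖A.T x‖ := by
  obtain ⟨C, τ, hC, h⟩ := A.T_bound
  refine ⟨fun x => norm_pos_iff.2 fun h0 => ?_, C, τ, hC, fun x y => ?_⟩
  · have h1 := A.T_add x (-x)
    rw [h0, ContinuousLinearMap.comp_zero, add_neg_cancel, A.T_zero] at h1
    obtain ⟨e, he⟩ := exists_ne (0 : E)
    exact he (DFunLike.congr_fun h1 e)
  · simp only [A.T_add]
    exact (ContinuousLinearMap.opNorm_comp_le _ _).trans
      (mul_le_mul_of_nonneg_right (h y) (norm_nonneg _))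

theorem moderate_M [Nontrivial E] : Moderate fun x => ‖A.M x‖ := by
  obtain ⟨C, τ, hC, h⟩ := A.M_bound
  refine ⟨fun x => norm_pos_iff.2 fun h0 => ?_, C, τ, hC, fun x y => ?_⟩
  · have h1 := A.M_add x (-x)
    rw [h0, ContinuousLinearMap.comp_zero, add_neg_cancel, A.M_zero] at h1
    obtain ⟨e, he⟩ := exists_ne (0 : E)
    exact he (DFunLike.congr_fun h1 e)
  · simp only [A.M_add]
    exact (ContinuousLinearMap.opNorm_comp_le _ _).trans
      (mul_le_mul_of_nonneg_right (h y) (norm_nonneg _))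

theorem moderate_transWeight [Nontrivial E] : Moderate (transWeight ι) := by
  rw [show transWeight ι = fun x => ‖A.T x‖ from funext A.transWeight_eq]
  exact A.moderate_T

theorem moderate_modWeightTilde [Nontrivial E] : Moderate (modWeightTilde ι) := by
  rw [show modWeightTilde ι = fun x => max 1 ‖A.M (-x)‖ from
    funext fun x => by rw [modWeightTilde, A.modWeight_eq]]
  exact A.moderate_M.reflect.max_one

end Shifts

/-- Two spaces of distributions in duality, with translations and modulations. -/
structure DualPair (ι : Inclusion n E) (κ : Inclusion n F) (pair : E →L[ℂ] F →L[ℂ] ℂ) where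
  left : Shifts ι
  right : Shifts κ
  pair_left : ∀ φ f, pair (left.j φ) f = κ.toDist f φ
  pair_right : ∀ e φ, pair e (right.j φ) = ι.toDist e φ
  pair_T : ∀ x e f, pair (left.T x e) f = pair e (right.T (-x) f)
  pair_M : ∀ ξ e f, pair (left.M ξ e) f = pair e (right.M ξ f)
  norm_T : ∀ x, ‖left.T x‖ = ‖right.T (-x)‖
  norm_M : ∀ ξ, ‖left.M ξ‖ = ‖right.M ξ‖

/-- Interchange of the two spaces of a dual pair. -/
def DualPair.flip {ι : Inclusion n E} {κ : Inclusion n F} {pair : E →L[ℂ] F →L[ℂ] ℂ}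
    (D : DualPair ι κ pair) : DualPair κ ι pair.flip where
  left := D.right
  right := D.left
  pair_left φ e := D.pair_right e φ
  pair_right f φ := D.pair_left φ f
  pair_T x f e := by
    have := D.pair_T (-x) e f
    rw [neg_neg] at this
    exact this.symm
  pair_M ξ f e := (D.pair_M ξ e f).symm
  norm_T x := by
    have := D.norm_T (-x)
    rw [neg_neg] at this
    exact this.symm
  norm_M ξ := (D.norm_M ξ).symm

theorem exists_clm_of_invariant {κ : Inclusion n F} {D : Rn n → 𝓢'(Rn n, ℂ) →L[ℂ] 𝓢'(Rn n, ℂ)}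
    (h : ∀ (x : Rn n) (e : F), ∃ e' : F, κ.toDist e' = D x (κ.toDist e))
    (hb : ∃ C > (0 : ℝ), ∃ τ > (0 : ℝ), ∀ (x : Rn n) (e e' : F),
      κ.toDist e' = D x (κ.toDist e) → ‖e'‖ ≤ C * (1 + ‖x‖) ^ τ * ‖e‖) :
    ∃ T : Rn n → F →L[ℂ] F, (∀ x e, κ.toDist (T x e) = D x (κ.toDist e)) ∧
      ∃ (C : ℝ) (τ : ℕ), 0 < C ∧ ∀ x, ‖T x‖ ≤ C * (1 + ‖x‖) ^ τ := by
  choose S hS using h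
  obtain ⟨C, hC, τ, -, hb⟩ := hb
  have hle : ∀ (x : Rn n) (e : F), ‖S x e‖ ≤ C * (1 + ‖x‖) ^ ⌈τ⌉₊ * ‖e‖ := fun x e => by
    refine (hb x e _ (hS x e)).trans ?_
    rw [← Real.rpow_natCast]
    gcongr
    · simp
    · exact Nat.le_ceil τ
  let T : Rn n → F →L[ℂ] F := fun x => LinearMap.mkContinuous
    { toFun := S x
      map_add' := fun e f => κ.injective (by rw [map_add, hS, hS, hS, map_add, map_add])
      map_smul' := fun a e => κ.injective (by
        rw [RingHom.id_apply, map_smul, hS, hS, map_smul, map_smul]) }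
    (C * (1 + ‖x‖) ^ ⌈τ⌉₊) (hle x)
  exact ⟨T, hS, C, ⌈τ⌉₊, hC, fun x => LinearMap.mkContinuous_norm_le _ (by positivity) _⟩

theorem IsTMIB.exists_shifts {κ : Inclusion n F} (h : IsTMIB κ) :
    ∃ A : Shifts κ, Continuous A.j ∧ DenseRange A.j := by
  obtain ⟨j, hj, hd⟩ := h.dense_schwartz
  obtain ⟨T, hT, hTb⟩ := exists_clm_of_invariant h.translate_mem h.translate_bound
  obtain ⟨M, hM, hMb⟩ := exists_clm_of_invariant h.modulate_mem h.modulate_bound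
  exact ⟨⟨h.complete, j.toLinearMap, T, M, hj, hT, hM, hTb, hMb⟩, j.continuous, hd⟩

namespace IsStrongDual

variable {ι : Inclusion n E} {κ : Inclusion n F} {pair : E →L[ℂ] F →L[ℂ] ℂ}
  (h : IsStrongDual ι κ pair)
include h

theorem injective : Function.Injective pair := by
  rw [injective_iff_map_eq_zero]
  intro e he
  rw [← norm_eq_zero, ← h.isometry, he, norm_zero]

/-- E is isometric to the dual of F, so T is the transpose of S. The inequality ‖S‖ ≤ ‖T‖ is
Hahn–Banach, every functional on F being given by some element of E. -/
theorem exists_adjoint (S : F →L[ℂ] F) : ∃ T : E →L[ℂ] E, (∀ e f, pair (T e) f = pair e (S f)) ∧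
    ‖T‖ = ‖S‖ := by
  let e : E ≃ₗᵢ[ℂ] (F →L[ℂ] ℂ) := LinearIsometryEquiv.ofSurjective
    ⟨pair.toLinearMap, h.isometry⟩ h.surjective
  let T : E →L[ℂ] E := e.symm.toContinuousLinearEquiv.toContinuousLinearMap ∘L
    ((ContinuousLinearMap.compL ℂ F F ℂ).flip S) ∘L pair
  have hT : ∀ u f, pair (T u) f = pair u (S f) := fun u f => by
    have : e (T u) = (pair u) ∘L S := e.apply_symm_apply _
    exact DFunLike.congr_fun this f
  refine ⟨T, hT, le_antisymm ?_ ?_⟩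
  · refine T.opNorm_le_bound (norm_nonneg _) fun u => ?_
    rw [← h.isometry]
    refine ContinuousLinearMap.opNorm_le_bound _ (by positivity) fun f => ?_
    rw [hT]
    refine ((pair u).le_opNorm _).trans ?_
    rw [h.isometry, mul_comm ‖S‖, mul_assoc]
    exact mul_le_mul_of_nonneg_left (S.le_opNorm f) (norm_nonneg _)
  · refine S.opNorm_le_bound (norm_nonneg _) fun f => ?_
    refine NormedSpace.norm_le_dual_bound ℂ _ (by positivity) fun g => ?_
    obtain ⟨u, rfl⟩ := h.surjective g
    rw [← hT, h.isometry]
    refine ((pair (T u)).le_opNorm _).trans ?_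
    rw [h.isometry, mul_right_comm]
    exact mul_le_mul_of_nonneg_right (T.le_opNorm u) (norm_nonneg _)

/-- The strong dual inherits all the structure by transposition: T_x is the adjoint of T_{-x}, M_ξ
that of M_ξ, completeness comes from the dual norm, and a Schwartz function φ becomes the functional
f ↦ ⟨f, φ⟩. Compatibility of the pairing on Schwartz functions identifies these with the operations
on distributions. -/
theorem dualPair (A : Shifts κ) : ∃ D : DualPair ι κ pair, D.right = A := by
  choose T hT hTn using fun x => h.exists_adjoint (A.T (-x))
  choose M hM hMn using fun x => h.exists_adjoint (A.M x)
  have hp : ∀ e φ, pair e (A.j φ) = ι.toDist e φ := fun e φ => h.compatible e _ φ (A.j_dist φ)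
  let ev : 𝓢(Rn n, ℂ) → F →L[ℂ] ℂ := fun φ => PointwiseConvergenceCLM.evalCLM _ ℂ φ ∘L κ.toDist
  have hev : ∀ φ f, ev φ f = κ.toDist f φ := fun φ f => rfl
  choose j hj using fun φ => h.surjective (ev φ)
  have hc : CompleteSpace E := by
    let e : E ≃ₗᵢ[ℂ] (F →L[ℂ] ℂ) := LinearIsometryEquiv.ofSurjective
      ⟨pair.toLinearMap, h.isometry⟩ h.surjective
    exact (completeSpace_congr (e := e.toEquiv) e.isometry.isUniformEmbedding).2 inferInstance
  let J : 𝓢(Rn n, ℂ) →ₗ[ℂ] E :=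
    { toFun := j
      map_add' := fun φ ψ => h.injective (by
        rw [map_add, hj, hj, hj]; ext f; simp [hev])
      map_smul' := fun a φ => h.injective (by
        rw [RingHom.id_apply, map_smul, hj, hj]; ext f; simp [hev]) }
  have hJ : ∀ φ f, pair (J φ) f = κ.toDist f φ := fun φ f => by
    change pair (j φ) f = _
    rw [hj, hev]
  have hJd : ∀ φ, ι.toDist (J φ) = (φ : 𝓢'(Rn n, ℂ)) := fun φ => by
    ext ψ
    rw [← hp, hJ, A.j_dist, schwartz_apply, schwartz_apply]
    simp only [mul_comm]
  have hTd : ∀ x e, ι.toDist (T x e) = translate x (ι.toDist e) := fun x e => by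
    ext ψ
    rw [← hp, hT, A.T_j, hp, translate_apply]
  have hMd : ∀ x e, ι.toDist (M x e) = modulate x (ι.toDist e) := fun x e => by
    ext ψ
    rw [← hp, hM, A.M_j, hp, modulate_apply]
  have hTb : ∃ (C : ℝ) (τ : ℕ), 0 < C ∧ ∀ x, ‖T x‖ ≤ C * (1 + ‖x‖) ^ τ := by
    obtain ⟨C, τ, hC, hb⟩ := A.T_bound
    refine ⟨C, τ, hC, fun x => ?_⟩
    rw [hTn, ← norm_neg x]
    exact hb (-x)
  have hMb : ∃ (C : ℝ) (τ : ℕ), 0 < C ∧ ∀ x, ‖M x‖ ≤ C * (1 + ‖x‖) ^ τ := by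
    obtain ⟨C, τ, hC, hb⟩ := A.M_bound
    exact ⟨C, τ, hC, fun x => (hMn x).trans_le (hb x)⟩
  exact ⟨⟨⟨hc, J, T, M, hJd, hTd, hMd, hTb, hMb⟩, A, hJ, hp, hT, hM, hTn, hMn⟩, rfl⟩

end IsStrongDual

/-! ### Strong continuity -/

/-- Mean value inequality on the unit ball around x, at the cost of one more derivative. For ‖z‖ ≤ 1
the decay at nearby points is comparable to the decay at x, which accounts for one factor 2^k. -/
theorem schwartz_seminorm_transS_sub_le (φ : 𝓢(Rn n, ℂ)) (k l : ℕ) {z : Rn n} (hz : ‖z‖ ≤ 1) :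
    SchwartzMap.seminorm ℝ k l (transS z φ - φ) ≤
      2 ^ k * (2 ^ k * schwartzNorm (k, l + 1) φ) * ‖z‖ := by
  refine SchwartzMap.seminorm_le_bound ℝ k l _ (by positivity) fun x => ?_
  have e : iteratedFDeriv ℝ l (transS z φ - φ : 𝓢(Rn n, ℂ)) x =
      iteratedFDeriv ℝ l φ (x - z) - iteratedFDeriv ℝ l φ x := by
    have h1 : ((transS z φ - φ : 𝓢(Rn n, ℂ)) : Rn n → ℂ) = (transS z φ : Rn n → ℂ) - φ := rfl
    rw [h1, iteratedFDeriv_sub_apply ((transS z φ).contDiffAt _) (φ.contDiffAt _)]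
    congr 1
    exact iteratedFDeriv_comp_sub l z x
  have hd : Differentiable ℝ (iteratedFDeriv ℝ l φ) :=
    (φ.smooth ⊤).differentiable_iteratedFDeriv (mod_cast ENat.natCast_lt_top l)
  have hb : ∀ y ∈ Metric.closedBall x 1, ‖fderiv ℝ (iteratedFDeriv ℝ l φ) y‖ ≤
      2 ^ k * (2 ^ k * schwartzNorm (k, l + 1) φ) * bracket k x := by
    intro y hy
    rw [norm_fderiv_iteratedFDeriv]
    have h1 := norm_iteratedFDeriv_le_schwartzNorm (m := (k, l + 1)) le_rfl le_rfl φ y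
    have h2 := bracket_add_le k x (y - x)
    rw [add_sub_cancel] at h2
    have h3 : ‖y - x‖ ≤ 1 := by simpa [dist_eq_norm] using hy
    have h4 : (1 + ‖y - x‖) ^ k ≤ 2 ^ k := by
      gcongr
      linarith
    have h5 := bracket_nonneg k x
    have h6 : bracket k y ≤ 2 ^ k * bracket k x := h2.trans (by gcongr)
    have h7 : ‖iteratedFDeriv ℝ (l + 1) φ y‖ ≤ 2 ^ k * schwartzNorm (k, l + 1) φ * bracket k y := by
      rw [bracket, ← div_eq_mul_inv, le_div_iff₀ (by positivity), mul_comm]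
      exact h1
    calc _ ≤ _ := h7
      _ ≤ 2 ^ k * schwartzNorm (k, l + 1) φ * (2 ^ k * bracket k x) := by gcongr
      _ = _ := by ring
  have h1 := (convex_closedBall x 1).norm_image_sub_le_of_norm_fderiv_le (𝕜 := ℝ)
    (fun y _ => hd y) hb (Metric.mem_closedBall_self zero_le_one)
    (y := x - z) (by simpa [dist_eq_norm] using hz)
  rw [sub_sub_cancel_left, norm_neg] at h1
  rw [e]
  have h2 : ‖x‖ ^ k * bracket k x ≤ 1 := by
    rw [← pow_mul_bracket k x]
    have := bracket_nonneg k x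
    gcongr
    simp
  calc _ ≤ ‖x‖ ^ k * (2 ^ k * (2 ^ k * schwartzNorm (k, l + 1) φ) * bracket k x * ‖z‖) := by gcongr
    _ = 2 ^ k * (2 ^ k * schwartzNorm (k, l + 1) φ) * ‖z‖ * (‖x‖ ^ k * bracket k x) := by ring
    _ ≤ 2 ^ k * (2 ^ k * schwartzNorm (k, l + 1) φ) * ‖z‖ * 1 := by gcongr
    _ = _ := mul_one _

theorem tendsto_transS (φ : 𝓢(Rn n, ℂ)) : Tendsto (fun z => transS z φ) (𝓝 0) (𝓝 φ) := by
  rw [(schwartz_withSeminorms ℝ (Rn n) ℂ).tendsto_nhds]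
  rintro ⟨k, l⟩ ε hε
  have h1 : Tendsto (fun z : Rn n => 2 ^ k * (2 ^ k * schwartzNorm (k, l + 1) φ) * ‖z‖) (𝓝 0)
      (𝓝 0) := by
    have : Continuous fun z : Rn n => 2 ^ k * (2 ^ k * schwartzNorm (k, l + 1) φ) * ‖z‖ := by
      fun_prop
    simpa using this.tendsto 0
  filter_upwards [h1.eventually (gt_mem_nhds hε), Metric.closedBall_mem_nhds (0 : Rn n) one_pos]
    with z hz hz1
  exact (schwartz_seminorm_transS_sub_le φ k l (by simpa using hz1)).trans_lt hz

theorem continuous_transS (φ : 𝓢(Rn n, ℂ)) : Continuous fun z => transS z φ := by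
  rw [continuous_iff_continuousAt]
  intro z₀
  have h1 : Tendsto (fun z : Rn n => z - z₀) (𝓝 z₀) (𝓝 0) := by
    have : Continuous fun z : Rn n => z - z₀ := by fun_prop
    simpa using this.tendsto z₀
  refine ((tendsto_transS (transS z₀ φ)).comp h1).congr fun z => ?_
  ext t
  simp only [Function.comp_apply, transS_apply]
  congr 1
  abel

/-- The Fourier transform conjugates modulations into translations, so this follows from the
continuity of translations. -/
theorem continuous_modS (φ : 𝓢(Rn n, ℂ)) : Continuous fun ξ => modS ξ φ := by
  have h : ∀ ξ, modS ξ φ = FourierTransform.fourierInvCLM ℂ 𝓢(Rn n, ℂ)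
      (transS ξ (FourierTransform.fourierCLM ℂ 𝓢(Rn n, ℂ) φ)) := by
    intro ξ
    have h1 : transS ξ (FourierTransform.fourierCLM ℂ 𝓢(Rn n, ℂ) φ) =
        FourierTransform.fourierCLM ℂ 𝓢(Rn n, ℂ) (modS ξ φ) := by
      ext x
      simp only [transS_apply, FourierTransform.fourierCLM_apply, SchwartzMap.fourier_coe]
      rw [← neg_neg (x - ξ), ← Real.fourierInv_eq_fourier_neg, ← neg_neg x,
        ← Real.fourierInv_eq_fourier_neg]
      have := fourierInv_phase_mul φ ξ (-x)
      have hm : (modS ξ φ : Rn n → ℂ) = fun t => phase (inner ℝ t ξ) * φ t :=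
        funext (modS_apply ξ φ)
      rw [hm, neg_sub, neg_neg, sub_eq_add_neg, add_comm, ← this]
    rw [h1]
    simp
  simp only [h]
  exact (FourierTransform.fourierInvCLM ℂ 𝓢(Rn n, ℂ)).continuous.comp (continuous_transS _)

/-- An ε/3 argument: operator norms are locally bounded, so continuity of orbits passes from a dense
set to all of E. -/
theorem continuous_of_dense {A : Rn n → E →L[ℂ] E} {s : Set E} (hs : Dense s)
    (hb : ∃ (C : ℝ) (τ : ℕ), 0 < C ∧ ∀ x, ‖A x‖ ≤ C * (1 + ‖x‖) ^ τ)
    (h : ∀ e ∈ s, Continuous fun x => A x e) (e : E) : Continuous fun x => A x e := by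
  obtain ⟨C, τ, hC, hb⟩ := hb
  rw [continuous_iff_continuousAt]
  intro x₀
  rw [Metric.continuousAt_iff']
  intro ε hε
  let K := C * (1 + (‖x₀‖ + 1)) ^ τ
  have hK : 0 < K := by positivity
  obtain ⟨e', he', hd⟩ := hs.exists_dist_lt e (ε := ε / (3 * K)) (by positivity)
  have hK' : ∀ x ∈ Metric.closedBall x₀ 1, ‖A x‖ ≤ K := fun x hx => by
    refine (hb x).trans ?_
    have : ‖x‖ ≤ ‖x₀‖ + 1 := by
      have h1 : ‖x - x₀‖ ≤ 1 := by simpa [dist_eq_norm] using hx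
      linarith [norm_sub_norm_le x x₀]
    change C * (1 + ‖x‖) ^ τ ≤ C * (1 + (‖x₀‖ + 1)) ^ τ
    gcongr
  have h1 : ∀ x ∈ Metric.closedBall x₀ 1, dist (A x e) (A x e') < ε / 3 := fun x hx => by
    rw [dist_eq_norm, ← map_sub]
    refine ((A x).le_opNorm _).trans_lt ?_
    rw [← dist_eq_norm]
    calc _ ≤ K * dist e e' := mul_le_mul_of_nonneg_right (hK' x hx) dist_nonneg
      _ < K * (ε / (3 * K)) := by gcongr
      _ = ε / 3 := by field_simp
  filter_upwards [Metric.closedBall_mem_nhds x₀ one_pos,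
    Metric.continuousAt_iff'.1 (h e' he').continuousAt (ε / 3) (by positivity)] with x hx hx'
  have h2 := h1 x hx
  have h3 := h1 x₀ (Metric.mem_closedBall_self zero_le_one)
  rw [dist_comm] at h3
  calc _ ≤ dist (A x e) (A x e') + dist (A x e') (A x₀ e') + dist (A x₀ e') (A x₀ e) :=
        dist_triangle4 _ _ _ _
    _ < ε / 3 + ε / 3 + ε / 3 := by gcongr
    _ = ε := by ring

namespace Shifts

variable {ι : Inclusion n E} (A : Shifts ι) (hj : Continuous A.j) (hd : DenseRange A.j)
include hj hd

theorem continuous_T (e : E) : Continuous fun x => A.T x e := by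
  refine continuous_of_dense hd A.T_bound ?_ e
  rintro _ ⟨φ, rfl⟩
  simp only [A.T_j]
  exact hj.comp (continuous_transS φ)

theorem continuous_M (e : E) : Continuous fun x => A.M x e := by
  refine continuous_of_dense hd A.M_bound ?_ e
  rintro _ ⟨φ, rfl⟩
  simp only [A.M_j]
  exact hj.comp (continuous_modS φ)

theorem continuous_T_M {Y : Type*} [TopologicalSpace Y] {x ξ : Y → Rn n} (hx : Continuous x)
    (hξ : Continuous ξ) (e : E) : Continuous fun y => A.T (x y) (A.M (ξ y) e) := by
  obtain ⟨C, τ, hC, hb⟩ := A.T_bound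
  rw [continuous_iff_continuousAt]
  intro y₀
  have h1 : Tendsto (fun y => A.T (x y) (A.M (ξ y₀) e)) (𝓝 y₀) (𝓝 (A.T (x y₀) (A.M (ξ y₀) e))) :=
    ((A.continuous_T hj hd _).comp hx).tendsto y₀
  have h2 : Tendsto (fun y => A.T (x y) (A.M (ξ y) e - A.M (ξ y₀) e)) (𝓝 y₀) (𝓝 0) := by
    refine squeeze_zero_norm (a := fun y => C * (1 + ‖x y‖) ^ τ * ‖A.M (ξ y) e - A.M (ξ y₀) e‖)
      (fun y => ((A.T (x y)).le_opNorm _).trans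
        (mul_le_mul_of_nonneg_right (hb _) (norm_nonneg _))) ?_
    have h3 := (A.continuous_M hj hd e).comp hξ
    have : Continuous fun y => C * (1 + ‖x y‖) ^ τ * ‖A.M (ξ y) e - A.M (ξ y₀) e‖ := by
      have : Continuous fun y => A.M (ξ y) e := h3
      fun_prop
    simpa using this.tendsto y₀
  have h4 := h2.add h1
  rw [zero_add] at h4
  refine h4.congr fun y => ?_
  rw [map_sub, sub_add_cancel]

end Shifts

/-! ### The kernel of the operator `∑_λ ⟨·, T^{-B}_λ χ⟩ T^B_λ χ` -/

theorem exists_bracket_le_bracket_clm (L : Rn n →L[ℝ] Rn n) (N : ℕ) :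
    ∃ C : ℝ, 0 ≤ C ∧ ∀ z, bracket N z ≤ C * bracket N (L z) := by
  refine ⟨(1 + ‖L‖) ^ N, by positivity, fun z => ?_⟩
  have h : 1 + ‖L z‖ ≤ (1 + ‖L‖) * (1 + ‖z‖) := by
    nlinarith [L.le_opNorm z, norm_nonneg z, norm_nonneg L]
  unfold bracket
  rw [← div_eq_mul_inv, le_div_iff₀ (by positivity), inv_mul_le_iff₀ (by positivity), ← mul_pow,
    mul_comm (1 + ‖z‖)]
  gcongr

theorem continuous_mulVecT (B : Matrix (Fin n) (Fin n) ℝ) : Continuous (mulVecT B) :=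
  ContinuousLinearMap.continuous _

/-- The twisted translate `T^{-B}_λ χ` of a Schwartz function, so that
`twistS (-B) λ χ = T^B_λ χ`. -/
noncomputable def twistS (B : Matrix (Fin n) (Fin n) ℝ) (x : Rn n) : 𝓢(Rn n, ℂ) →L[ℂ] 𝓢(Rn n, ℂ) :=
  tfS x (mulVec B x)

theorem mulVec_neg (B : Matrix (Fin n) (Fin n) ℝ) (x : Rn n) :
    mulVec (-B) x = -mulVec B x := by
  simp [mulVec]

theorem twistS_apply (B : Matrix (Fin n) (Fin n) ℝ) (x : Rn n) (φ : 𝓢(Rn n, ℂ)) :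
    (twistS B x φ : Rn n → ℂ) = twistedTranslate (-B) x φ := by
  ext t
  rw [twistS, tfS_apply, twistedTranslate_eq, mulVec_neg, inner_neg_left, neg_neg, real_inner_comm]

theorem twistS_neg_apply (B : Matrix (Fin n) (Fin n) ℝ) (x : Rn n) (φ : 𝓢(Rn n, ℂ)) :
    (twistS (-B) x φ : Rn n → ℂ) = twistedTranslate B x φ := by
  rw [twistS_apply, neg_neg]

theorem finite_twistS_ne (B : Matrix (Fin n) (Fin n) ℝ) (b : Module.Basis (Fin n) ℝ (Rn n))
    {φ : 𝓢(Rn n, ℂ)} (hφ : HasCompactSupport φ) {K : Set (Rn n)} (hK : Bornology.IsBounded K) :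
    {k | ∃ t ∈ K, twistS B (latticePt b k) φ t ≠ 0}.Finite := by
  have h := finite_overlap b hφ.isCompact.isBounded hK
  refine (h.preimage (f := fun k => -k) neg_injective.injOn).subset ?_
  rintro k ⟨t, ht, hne⟩
  refine ⟨t, ht, subset_tsupport _ fun h0 => hne ?_⟩
  rw [latticePt_neg, ← sub_eq_add_neg] at h0
  rw [twistS, tfS_apply, h0, mul_zero]

/-- In T^{-B}_λχ(s)·T^B_λχ(s + z) the two twists combine to the phase of -Bλ·z, which is a character
in λ. After multiplication by the phase of s·Bᵀz the sum over λ becomes a periodization in s, and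
Poisson summation yields the expansion with frequencies r_k(z) in the dual lattice shifted by Bᵀz.
The weighted bound on β_k, for every power τ, is what absorbs the growth of ‖T_z‖ and ‖M_{-r_k(z)}‖.
-/
theorem exists_kernel (B : Matrix (Fin n) (Fin n) ℝ) (b : Module.Basis (Fin n) ℝ (Rn n))
    {χ : 𝓢(Rn n, ℂ)} (hχ : HasCompactSupport χ) :
    ∃ (b' : Module.Basis (Fin n) ℝ (Rn n)) (β : (Fin n → ℤ) → Rn n → ℂ)
      (r : (Fin n → ℤ) → Rn n → Rn n), (∀ k, StronglyMeasurable (β k)) ∧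
      (∀ k, Continuous (r k)) ∧
      (∀ τ : ℕ, ∃ D : ℝ, 0 ≤ D ∧ ∀ k z, ‖β k z‖ * ((1 + ‖z‖) ^ τ * (1 + ‖r k z‖) ^ τ) ≤
        D * (bracket (n + 1) z * bracket (n + 1) (latticePt b' k))) ∧
      ∀ s z, HasSum (fun k => β k z * phase (-inner ℝ s (r k z)))
        (∑' k, twistS B (latticePt b k) χ s * twistS (-B) (latticePt b k) χ (s + z)) := by
  obtain ⟨b', hb'⟩ := exists_isDualBasis b
  obtain ⟨κ, hκ, hper⟩ := exists_hasSum_periodize hb'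
  let r : (Fin n → ℤ) → Rn n → Rn n := fun k z => latticePt b' k + mulVecT B z
  let β : (Fin n → ℤ) → Rn n → ℂ := fun k z => κ * 𝓕⁻ (fun t => χ t * χ (t - -z)) (r k z)
  have hr : ∀ k, Continuous (r k) := fun k => continuous_const.add (continuous_mulVecT B)
  have hbound : ∀ τ : ℕ, ∃ D : ℝ, 0 ≤ D ∧ ∀ k z, ‖β k z‖ * ((1 + ‖z‖) ^ τ * (1 + ‖r k z‖) ^ τ) ≤
      D * (bracket (n + 1) z * bracket (n + 1) (latticePt b' k)) := by
    intro τ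
    -- Powers needed: τ to absorb the growth, n + 1 in z for integrability, and another n + 1 in z
    -- which, combined with n + 1 in r_k(z), gives decay in the dual lattice point r_k(z) - Bᵀz. The
    -- last n + 1 in r_k(z) are discarded.
    obtain ⟨m, C, hC, h⟩ := exists_norm_fourierInv_mul_le χ (τ + ((n + 1) + (n + 1)))
    obtain ⟨K, hK, hK'⟩ := exists_bracket_le_bracket_clm
      (-ContinuousLinearMap.adjoint (Matrix.toEuclideanCLM (𝕜 := ℝ) B)) (n + 1)
    refine ⟨κ * (C * schwartzNorm m χ) * K, by positivity, fun k z => ?_⟩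
    have h1 := h χ (-z) (r k z)
    have hN : ∀ x : Rn n, bracket (τ + ((n + 1) + (n + 1))) x =
        bracket τ x * (bracket (n + 1) x * bracket (n + 1) x) := fun x => by
      rw [bracket_add, bracket_add (n + 1) (n + 1)]
    rw [bracket_neg, hN, hN] at h1
    have h2 : bracket (n + 1) z ≤ K * bracket (n + 1) (-mulVecT B z) := hK' z
    have h3 := bracket_mul_le (n + 1) (r k z) (-mulVecT B z)
    rw [add_neg_cancel_right] at h3
    have e1 := pow_mul_bracket τ z
    have e2 := pow_mul_bracket τ (r k z)
    have e3 := bracket_le_one (n + 1) (r k z)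
    have p1 := bracket_nonneg (n + 1) z
    have p2 := bracket_nonneg (n + 1) (r k z)
    have p3 := bracket_nonneg (n + 1) (latticePt b' k)
    have p4 := bracket_nonneg (n + 1) (-mulVecT B z)
    simp only [β]
    rw [norm_mul, Complex.norm_of_nonneg hκ.le]
    calc _ ≤ κ * (C * schwartzNorm m χ *
            (bracket τ z * (bracket (n + 1) z * bracket (n + 1) z)) *
            (bracket τ (r k z) * (bracket (n + 1) (r k z) * bracket (n + 1) (r k z)))) *
            ((1 + ‖z‖) ^ τ * (1 + ‖r k z‖) ^ τ) := by gcongr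
      _ = κ * (C * schwartzNorm m χ) * ((1 + ‖z‖) ^ τ * bracket τ z) *
            ((1 + ‖r k z‖) ^ τ * bracket τ (r k z)) * bracket (n + 1) z * bracket (n + 1) z *
            bracket (n + 1) (r k z) * bracket (n + 1) (r k z) := by ring
      _ ≤ κ * (C * schwartzNorm m χ) * 1 * 1 * bracket (n + 1) z *
            (K * bracket (n + 1) (-mulVecT B z)) * bracket (n + 1) (r k z) * 1 := by
          rw [e1, e2]
          gcongr
      _ = κ * (C * schwartzNorm m χ) * K * (bracket (n + 1) z *
            (bracket (n + 1) (r k z) * bracket (n + 1) (-mulVecT B z))) := by ring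
      _ ≤ _ := by gcongr
  refine ⟨b', β, r, fun k => ?_, hr, hbound, fun s z => ?_⟩
  · have h1 := (stronglyMeasurable_fourierInv_window χ.continuous χ).comp_measurable
      ((continuous_neg.prodMk (hr k)).measurable)
    exact h1.const_mul _
  · let ρ : Rn n → ℂ := fun u => phase (inner ℝ u (mulVecT B z)) * (χ u * χ (u - -z))
    have hρF : ∀ k, 𝓕⁻ ρ (latticePt b' k) = 𝓕⁻ (fun u => χ u * χ (u - -z)) (r k z) :=
      fun k => fourierInv_phase_mul _ _ _
    have hρc : HasCompactSupport ρ := (hχ.mul_right).mul_left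
    have hρ : Continuous ρ := by
      have := χ.continuous
      fun_prop
    have hsum : Summable fun k => 𝓕⁻ ρ (latticePt b' k) := by
      obtain ⟨D, hD, h⟩ := hbound 0
      refine Summable.of_norm_bounded (g := fun k => κ⁻¹ * (D * (bracket (n + 1) z *
        bracket (n + 1) (latticePt b' k)))) ?_ fun k => ?_
      · exact (((summable_bracket_latticePt b').mul_left _).mul_left _).mul_left _
      · have h1 := h k z
        simp only [β] at h1
        rw [norm_mul, Complex.norm_of_nonneg hκ.le, pow_zero, pow_zero, mul_one, mul_one] at h1
        rw [hρF, inv_mul_eq_div, le_div_iff₀ hκ, mul_comm]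
        exact h1
    have h1 := (hper ρ hρ hρc hsum s).mul_left (phase (-inner ℝ s (mulVecT B z)))
    have h2 : phase (-inner ℝ s (mulVecT B z)) * periodize b ρ s =
        ∑' k, twistS B (latticePt b k) χ s * twistS (-B) (latticePt b k) χ (s + z) := by
      -- The periodization adds lattice points to the argument whereas translation subtracts them,
      -- hence the reflection k ↦ -k.
      have hterm : ∀ k, phase (-inner ℝ s (mulVecT B z)) * ρ (s + latticePt b (-k)) =
          twistS B (latticePt b k) χ s * twistS (-B) (latticePt b k) χ (s + z) := by
        intro k
        simp only [ρ, twistS, tfS_apply]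
        rw [latticePt_neg, mulVec_neg, sub_neg_eq_add, ← sub_eq_add_neg]
        rw [show s - latticePt b k + z = s + z - latticePt b k by abel, ← mul_assoc,
          ← phase_add, mul_mul_mul_comm (phase (inner ℝ (s - latticePt b k) _)), ← phase_add]
        congr 2
        rw [inner_mulVecT]
        have e := inner_mulVecT B (latticePt b k) z
        rw [← inner_mulVecT, inner_sub_left, inner_neg_right, real_inner_comm _ (s - latticePt b k),
          real_inner_comm _ (s + z - latticePt b k), inner_sub_right, inner_sub_right,
          inner_add_right, e]
        ring
      have hfin : (Function.support fun k => ρ (s + latticePt b k)).Finite := by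
        refine (finite_overlap b hρc.isCompact.isBounded
          (Bornology.isBounded_singleton (x := s))).subset ?_
        intro k hk
        exact ⟨s, rfl, subset_tsupport _ hk⟩
      have hper' : periodize b ρ s = ∑' k, ρ (s + latticePt b k) := (tsum_eq_finsum hfin).symm
      rw [hper', ← (Equiv.neg (Fin n → ℤ)).tsum_eq, ← tsum_mul_left]
      exact tsum_congr hterm
    rw [h2] at h1
    refine h1.congr_fun fun k => ?_
    simp only [β, r]
    rw [hρF, inner_add_right, neg_add, phase_add]
    ring

/-! ### The operator `e ↦ ∑_λ ⟨e, T^{-B}_λ χ⟩ T^B_λ χ` -/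

/-- Evaluation of the distributions in `E` at a Schwartz function. -/
noncomputable def Inclusion.eval (ι : Inclusion n E) (ψ : 𝓢(Rn n, ℂ)) : E →L[ℂ] ℂ :=
  PointwiseConvergenceCLM.evalCLM _ ℂ ψ ∘L ι.toDist

@[simp]
theorem Inclusion.eval_apply (ι : Inclusion n E) (ψ : 𝓢(Rn n, ℂ)) (e : E) :
    ι.eval ψ e = ι.toDist e ψ := rfl

theorem integrable_sub_mul {f g : Rn n → ℂ} (hf : Continuous f) (hfc : HasCompactSupport f)
    (hg : Continuous g) (hgc : HasCompactSupport g) :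
    Integrable (fun p : Rn n × Rn n => f (p.2 - p.1) * g p.2) (volume.prod volume) := by
  refine Continuous.integrable_of_hasCompactSupport (by fun_prop) ?_
  refine HasCompactSupport.intro (((IsCompact.prod hgc hfc).image continuous_sub).prod hgc) ?_
  rintro ⟨z, t⟩ hzt
  by_contra h0
  refine hzt ⟨⟨(t, t - z), ⟨subset_tsupport _ fun h => h0 ?_, subset_tsupport _ fun h => h0 ?_⟩,
    sub_sub_cancel t z⟩, subset_tsupport _ fun h => h0 ?_⟩
  · simp only at h
    simp [h]
  · simp only at h
    simp [h]
  · simp only at h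
    simp [h]

theorem integral_sub_mul {f g : Rn n → ℂ} (hf : Continuous f) (hfc : HasCompactSupport f)
    (hg : Continuous g) (hgc : HasCompactSupport g) :
    ∫ p : Rn n × Rn n, f (p.2 - p.1) * g p.2 ∂(volume.prod volume) = (∫ s, f s) * ∫ t, g t := by
  rw [integral_prod_symm _ (integrable_sub_mul hf hfc hg hgc)]
  simp only [integral_mul_const]
  rw [← integral_const_mul]
  refine integral_congr_ae (Eventually.of_forall fun t => ?_)
  simp only
  rw [integral_sub_left_eq_self f volume t]

/-- Makes every series of twisted translates a finite sum once it is tested against a compactly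
supported function. -/
theorem hasSum_twistS (B : Matrix (Fin n) (Fin n) ℝ) (b : Module.Basis (Fin n) ℝ (Rn n))
    {χ ψ : 𝓢(Rn n, ℂ)} (hχ : HasCompactSupport χ) (hψ : HasCompactSupport ψ) :
    ∃ S : Finset (Fin n → ℤ), ∀ k ∉ S, ∀ t, twistS B (latticePt b k) χ t * ψ t = 0 := by
  refine ⟨(finite_twistS_ne B b hχ hψ.isCompact.isBounded).toFinset, fun k hk t => ?_⟩
  by_contra h
  exact hk ((Set.Finite.mem_toFinset _).2 ⟨t, subset_tsupport _ (right_ne_zero_of_mul h),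
    left_ne_zero_of_mul h⟩)

/-- The integral is formed vector by vector, because z ↦ G z is in general only strongly, not norm,
measurable. -/
theorem exists_clm_integral {C : ℝ} (hC : 0 ≤ C) {G : Rn n → E →L[ℂ] E}
    (hi : ∀ e, Integrable fun z => G z e) (hb : ∀ z e, ‖G z e‖ ≤ C * ‖e‖ * bracket (n + 1) z) :
    ∃ Q : E →L[ℂ] E, (∀ e, Q e = ∫ z, G z e) ∧ ‖Q‖ ≤ C * ∫ z : Rn n, bracket (n + 1) z := by
  let Q : E →ₗ[ℂ] E :=
    { toFun := fun e => ∫ z, G z e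
      map_add' := fun e f => by
        simp only [map_add]
        exact integral_add (hi e) (hi f)
      map_smul' := fun a e => by
        simp only [map_smul, RingHom.id_apply]
        exact integral_smul a _ }
  have hQ : ∀ e, ‖Q e‖ ≤ C * (∫ z : Rn n, bracket (n + 1) z) * ‖e‖ := fun e => by
    refine (norm_integral_le_of_norm_le (integrable_bracket.const_mul (C * ‖e‖))
      (Eventually.of_forall fun z => hb z e)).trans (le_of_eq ?_)
    rw [integral_const_mul]
    ring
  exact ⟨Q.mkContinuous _ hQ, fun e => rfl, Q.mkContinuous_norm_le
    (mul_nonneg hC (integral_nonneg fun _ => bracket_nonneg _ _)) hQ⟩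

/-- The operator is defined as P = Σ_k ∫ β_k(z) T_zM_{-r_k(z)} dz, using the Fourier expansion of
its kernel along the diagonals. It is bounded on E because only translations and modulations occur.
The frame formula is then a continuous identity in e, checked on the dense Schwartz space, where it
is Fubini. -/
theorem Shifts.exists_frameOperator {ι : Inclusion n E} (A : Shifts ι) (hj : Continuous A.j)
    (hd : DenseRange A.j) (B : Matrix (Fin n) (Fin n) ℝ) (b : Module.Basis (Fin n) ℝ (Rn n))
    {χ : 𝓢(Rn n, ℂ)} (hχ : HasCompactSupport χ) :
    ∃ P : E →L[ℂ] E, ∀ e (ψ : 𝓢(Rn n, ℂ)), HasCompactSupport ψ →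
      HasSum (fun k => ι.toDist e (twistS B (latticePt b k) χ) *
        ∫ t, twistS (-B) (latticePt b k) χ t * ψ t) (ι.toDist (P e) ψ) := by
  have := A.complete
  obtain ⟨b', β, r, hβ, hr, hβb, hker⟩ := exists_kernel B b hχ
  obtain ⟨C₁, τ₁, hC₁, h₁⟩ := A.T_bound
  obtain ⟨C₂, τ₂, hC₂, h₂⟩ := A.M_bound
  obtain ⟨D, hD, hβb⟩ := hβb (max τ₁ τ₂)
  let K := C₁ * C₂ * D
  have hK : 0 ≤ K := by positivity
  have hFb : ∀ k z e, ‖β k z • A.T z (A.M (-r k z) e)‖ ≤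
      K * bracket (n + 1) (latticePt b' k) * ‖e‖ * bracket (n + 1) z := by
    intro k z e
    have e1 : ‖A.T z (A.M (-r k z) e)‖ ≤ C₁ * (1 + ‖z‖) ^ max τ₁ τ₂ *
        (C₂ * (1 + ‖r k z‖) ^ max τ₁ τ₂ * ‖e‖) := by
      refine ((A.T z).le_opNorm _).trans (mul_le_mul ((h₁ z).trans ?_)
        (((A.M _).le_opNorm _).trans (mul_le_mul_of_nonneg_right ((h₂ _).trans ?_)
          (norm_nonneg _))) (norm_nonneg _) (by positivity))
      · gcongr
        · simp
        · exact le_max_left _ _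
      · rw [norm_neg]
        gcongr
        · simp
        · exact le_max_right _ _
    rw [norm_smul]
    calc _ ≤ ‖β k z‖ * (C₁ * (1 + ‖z‖) ^ max τ₁ τ₂ *
          (C₂ * (1 + ‖r k z‖) ^ max τ₁ τ₂ * ‖e‖)) := by gcongr
      _ = C₁ * C₂ * ‖e‖ * (‖β k z‖ * ((1 + ‖z‖) ^ max τ₁ τ₂ * (1 + ‖r k z‖) ^ max τ₁ τ₂)) := by
          ring
      _ ≤ C₁ * C₂ * ‖e‖ * (D * (bracket (n + 1) z * bracket (n + 1) (latticePt b' k))) := by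
          exact mul_le_mul_of_nonneg_left (hβb k z) (by positivity)
      _ = _ := by
          simp only [K]
          ring
  have hFm : ∀ k e, AEStronglyMeasurable (fun z => β k z • A.T z (A.M (-r k z) e)) volume :=
    fun k e => ((hβ k).smul
      (A.continuous_T_M hj hd continuous_id (hr k).neg e).stronglyMeasurable).aestronglyMeasurable
  have hFi : ∀ k e, Integrable fun z => β k z • A.T z (A.M (-r k z) e) := fun k e =>
    (integrable_bracket.const_mul _).mono' (hFm k e) (Eventually.of_forall fun z => hFb k z e)
  choose Q hQ hQb using fun k => exists_clm_integral (C := K * bracket (n + 1) (latticePt b' k))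
    (mul_nonneg hK (bracket_nonneg _ _)) (G := fun z => β k z • A.T z ∘L A.M (-r k z))
    (hFi k) (hFb k)
  have hQ' : ∀ k e, Q k e = ∫ z, β k z • A.T z (A.M (-r k z) e) := hQ
  have hQs : Summable Q := by
    refine Summable.of_norm_bounded (g := fun k => K * bracket (n + 1) (latticePt b' k) *
      ∫ z : Rn n, bracket (n + 1) z) (((summable_bracket_latticePt b').mul_left _).mul_right _) fun k => ?_
    exact hQb k
  let P := ∑' k, Q k
  have hP : ∀ e, HasSum (fun k => Q k e) (P e) := fun e =>
    (ContinuousLinearMap.apply ℂ E e).hasSum hQs.hasSum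
  refine ⟨P, fun e ψ hψ => ?_⟩
  -- For compactly supported ψ both sides of the frame formula are continuous functionals of e, the
  -- right one a finite sum; so the identity may be tested on Schwartz functions.
  obtain ⟨S, hS⟩ := hasSum_twistS (-B) b hχ hψ
  let c : (Fin n → ℤ) → ℂ := fun k => ∫ t, twistS (-B) (latticePt b k) χ t * ψ t
  have hc : ∀ k ∉ S, c k = 0 := fun k hk => by simp [c, hS k hk]
  suffices h : ι.toDist (P e) ψ = ∑ k ∈ S, ι.toDist e (twistS B (latticePt b k) χ) * c k by
    rw [h]
    exact hasSum_sum_of_ne_finset_zero fun k hk => by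
      change _ * c k = 0
      rw [hc k hk, mul_zero]
  let L₁ : E →L[ℂ] ℂ := ι.eval ψ ∘L P
  let L₂ : E →L[ℂ] ℂ := ∑ k ∈ S, c k • ι.eval (twistS B (latticePt b k) χ)
  suffices h : (L₁ : E → ℂ) = L₂ by
    have := congr_fun h e
    simp only [L₁, L₂, ContinuousLinearMap.comp_apply, Inclusion.eval_apply,
      sum_apply, smul_apply, smul_eq_mul] at this
    rw [this]
    exact Finset.sum_congr rfl fun k _ => mul_comm _ _
  refine hd.equalizer L₁.continuous L₂.continuous (funext fun φ => ?_)
  simp only [Function.comp_apply]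
  let H : (Fin n → ℤ) → Rn n × Rn n → ℂ := fun k p =>
    β k p.1 * (phase (inner ℝ (p.2 - p.1) (-r k p.1)) * φ (p.2 - p.1) * ψ p.2)
  let M : ℝ := schwartzNorm (0, 0) φ
  have hφM : ∀ t, ‖φ t‖ ≤ M := fun t => by
    have := norm_le_schwartzNorm 0 φ t
    simpa [bracket] using this
  have hβ' : ∀ k z, ‖β k z‖ ≤ D * (bracket (n + 1) z * bracket (n + 1) (latticePt b' k)) := by
    intro k z
    refine le_trans (le_mul_of_one_le_right (norm_nonneg _) ?_) (hβb k z)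
    exact one_le_mul_of_one_le_of_one_le (one_le_pow₀ (by simp)) (one_le_pow₀ (by simp))
  have hHb : ∀ k p, ‖H k p‖ ≤ D * bracket (n + 1) (latticePt b' k) * M *
      (bracket (n + 1) p.1 * ‖ψ p.2‖) := by
    rintro k ⟨z, t⟩
    simp only [H, norm_mul, norm_phase, one_mul]
    have := bracket_nonneg (n + 1) (latticePt b' k)
    have := bracket_nonneg (n + 1) z
    calc _ ≤ D * (bracket (n + 1) z * bracket (n + 1) (latticePt b' k)) * (M * ‖ψ t‖) := by
          gcongr
          · exact hβ' k z
          · exact hφM _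
      _ = _ := by ring
  have hGi : Integrable (fun p : Rn n × Rn n => bracket (n + 1) p.1 * ‖ψ p.2‖)
      (volume.prod volume) := integrable_bracket.mul_prod ψ.integrable.norm
  have hHm : ∀ k, AEStronglyMeasurable (H k) (volume.prod volume) := by
    intro k
    refine (((hβ k).comp_measurable measurable_fst).mul
      (Continuous.stronglyMeasurable ?_)).aestronglyMeasurable
    have := φ.continuous
    have := ψ.continuous
    have := hr k
    fun_prop
  have hHi : ∀ k, Integrable (H k) (volume.prod volume) := fun k =>
    (hGi.const_mul _).mono' (hHm k) (Eventually.of_forall (hHb k))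
  have hsum := hasSum_integral_of_summable_integral_norm hHi (by
    refine Summable.of_nonneg_of_le (fun k => integral_nonneg fun _ => norm_nonneg _)
      (fun k => ?_) ((((summable_bracket_latticePt b').mul_left D).mul_right M).mul_right
        (∫ p : Rn n × Rn n, bracket (n + 1) p.1 * ‖ψ p.2‖ ∂(volume.prod volume)))
    rw [← integral_const_mul]
    exact integral_mono_of_nonneg (Eventually.of_forall fun _ => norm_nonneg _)
      (hGi.const_mul _) (Eventually.of_forall (hHb k)))
  have hQH : ∀ k, ∫ p, H k p ∂(volume.prod volume) = ι.eval ψ (Q k (A.j φ)) := by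
    intro k
    rw [hQ', ← ContinuousLinearMap.integral_comp_comm _ (hFi k _), integral_prod _ (hHi k)]
    refine integral_congr_ae (Eventually.of_forall fun z => ?_)
    simp only [H, map_smul, smul_eq_mul, Inclusion.eval_apply, A.T_M_j, A.j_dist]
    rw [schwartz_apply, integral_const_mul]
    simp only [tfS_apply]
  simp only [hQH] at hsum
  have hL₁ : L₁ (A.j φ) = ∫ p, ∑' k, H k p ∂(volume.prod volume) :=
    ((ι.eval ψ).hasSum (hP (A.j φ))).unique hsum
  -- At p = (z, t) the kernel expansion is read backwards with s = t - z. It returns the sum over λ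
  -- of products in t - z and t, whose double integrals factorize.
  have hpt : ∀ p : Rn n × Rn n, ∑' k, H k p = ∑ k ∈ S,
      mulSchwartz (twistS B (latticePt b k) χ) φ (p.2 - p.1) *
        mulSchwartz (twistS (-B) (latticePt b k) χ) ψ p.2 := by
    rintro ⟨z, t⟩
    have h3 := (hker (t - z) z).mul_right (φ (t - z) * ψ t)
    have h4 : ∑' k, H k (z, t) = _ := (h3.congr_fun fun k => by
      simp only [H]
      rw [inner_neg_right]
      ring).tsum_eq
    rw [h4, sub_add_cancel, ← tsum_mul_right, tsum_eq_sum (s := S)]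
    · refine Finset.sum_congr rfl fun k _ => ?_
      simp only [mulSchwartz_apply]
      ring
    · intro k hk
      have := hS k hk t
      linear_combination (twistS B (latticePt b k) χ (t - z) * φ (t - z)) * this
  rw [hL₁]
  simp only [hpt]
  have hcs : ∀ k, HasCompactSupport (mulSchwartz (twistS B (latticePt b k) χ) φ) := fun k =>
    hasCompactSupport_mulSchwartz φ (hasCompactSupport_tfS _ _ hχ)
  have hcs' : ∀ k, HasCompactSupport (mulSchwartz (twistS (-B) (latticePt b k) χ) ψ) := fun k =>
    hasCompactSupport_mulSchwartz ψ (hasCompactSupport_tfS _ _ hχ)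
  rw [integral_finsetSum _ fun k _ => integrable_sub_mul (SchwartzMap.continuous _) (hcs k)
    (SchwartzMap.continuous _) (hcs' k)]
  simp only [L₂, sum_apply, smul_apply, smul_eq_mul,
    Inclusion.eval_apply, A.j_dist]
  refine Finset.sum_congr rfl fun k _ => ?_
  rw [integral_sub_mul (SchwartzMap.continuous _) (hcs k) (SchwartzMap.continuous _) (hcs' k),
    schwartz_apply, mul_comm]
  simp only [mulSchwartz_apply, c]
  congr 1
  simp only [mul_comm]

/-- On a dual space translations need not be strongly continuous, so the integral construction is
unavailable. Exchanging the roles of T^{-B}_λχ and T^B_λχ transposes the frame operator, so P is the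
adjoint of the operator Q for -B on the predual; it is evaluated by computing Qψ as a finite
combination. -/
theorem DualPair.exists_frameOperator_left {ι : Inclusion n E} {κ : Inclusion n F}
    {pair : E →L[ℂ] F →L[ℂ] ℂ} (D : DualPair ι κ pair) (h : IsStrongDual ι κ pair)
    {B : Matrix (Fin n) (Fin n) ℝ} {b : Module.Basis (Fin n) ℝ (Rn n)}
    {χ : 𝓢(Rn n, ℂ)} (hχ : HasCompactSupport χ)
    {Q : F →L[ℂ] F} (hQ : ∀ f (ψ : 𝓢(Rn n, ℂ)), HasCompactSupport ψ →
      HasSum (fun k => κ.toDist f (twistS (-B) (latticePt b k) χ) *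
        ∫ t, twistS (- -B) (latticePt b k) χ t * ψ t) (κ.toDist (Q f) ψ)) :
    ∃ P : E →L[ℂ] E, ∀ e (ψ : 𝓢(Rn n, ℂ)), HasCompactSupport ψ →
      HasSum (fun k => ι.toDist e (twistS B (latticePt b k) χ) *
        ∫ t, twistS (-B) (latticePt b k) χ t * ψ t) (ι.toDist (P e) ψ) := by
  obtain ⟨P, hP, -⟩ := h.exists_adjoint Q
  refine ⟨P, fun e ψ hψ => ?_⟩
  obtain ⟨S, hS⟩ := hasSum_twistS (-B) b hχ hψ
  let c : (Fin n → ℤ) → ℂ := fun k => ∫ t, twistS (-B) (latticePt b k) χ t * ψ t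
  have hc : ∀ k ∉ S, c k = 0 := fun k hk => by simp [c, hS k hk]
  have hc' : ∀ k, (ψ : 𝓢'(Rn n, ℂ)) (twistS (-B) (latticePt b k) χ) = c k := fun k => by
    rw [schwartz_apply]
    simp only [c, mul_comm]
  have hQψ : Q (D.right.j ψ) = ∑ k ∈ S, c k • D.right.j (twistS B (latticePt b k) χ) := by
    apply κ.injective
    rw [← sub_eq_zero]
    refine eq_zero_of_test _ fun θ hθ => ?_
    have h1 := hQ (D.right.j ψ) θ hθ
    simp only [D.right.j_dist, hc', neg_neg] at h1
    have h2 := h1.unique (hasSum_sum_of_ne_finset_zero (s := S) fun k hk => by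
      rw [hc k hk, zero_mul])
    change κ.eval θ _ - κ.eval θ _ = 0
    rw [map_sum, sub_eq_zero]
    simp only [map_smul, Inclusion.eval_apply, h2, D.right.j_dist, schwartz_apply, smul_eq_mul]
  have h1 : ι.toDist (P e) ψ = ∑ k ∈ S, ι.toDist e (twistS B (latticePt b k) χ) * c k := by
    rw [← D.pair_right, hP, hQψ, map_sum]
    refine Finset.sum_congr rfl fun k _ => ?_
    rw [map_smul, D.pair_right, smul_eq_mul, mul_comm]
  rw [h1]
  exact hasSum_sum_of_ne_finset_zero fun k hk => by
    change _ * c k = 0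
    rw [hc k hk, mul_zero]

/-- The standing assumption that one of the two spaces is a TMIB and the other one its dual
provides a dual pair and the operator `e ↦ ∑_λ ⟨e, T^{-B}_λ χ⟩ T^B_λ χ`. -/
theorem exists_dualPair_frameOperator {ι : Inclusion n E} {κ : Inclusion n F}
    {pair : E →L[ℂ] F →L[ℂ] ℂ}
    (hE : (IsTMIB ι ∧ IsStrongDual κ ι pair.flip) ∨ (IsTMIB κ ∧ IsStrongDual ι κ pair))
    (B : Matrix (Fin n) (Fin n) ℝ) (b : Module.Basis (Fin n) ℝ (Rn n))
    {χ : 𝓢(Rn n, ℂ)} (hχ : HasCompactSupport χ) :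
    ∃ (_ : DualPair ι κ pair) (P : E →L[ℂ] E), ∀ e (ψ : 𝓢(Rn n, ℂ)), HasCompactSupport ψ →
      HasSum (fun k => ι.toDist e (twistS B (latticePt b k) χ) *
        ∫ t, twistS (-B) (latticePt b k) χ t * ψ t) (ι.toDist (P e) ψ) := by
  rcases hE with ⟨h1, h2⟩ | ⟨h1, h2⟩
  · obtain ⟨A, hj, hd⟩ := h1.exists_shifts
    obtain ⟨D, -⟩ := h2.dualPair A
    exact ⟨D.flip, A.exists_frameOperator hj hd B b hχ⟩
  · obtain ⟨A, hj, hd⟩ := h1.exists_shifts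
    obtain ⟨D, -⟩ := h2.dualPair A
    obtain ⟨Q, hQ⟩ := A.exists_frameOperator hj hd (-B) b hχ
    exact ⟨D, D.exists_frameOperator_left h2 hχ hQ⟩

/-! ### Lattice coordinates -/

theorem exists_lattice_basis (Λ : Submodule ℤ (Rn n)) [DiscreteTopology Λ] [IsZLattice ℝ Λ] :
    ∃ (b : Module.Basis (Fin n) ℝ (Rn n)) (e : (Fin n → ℤ) ≃ Λ),
      ∀ k, (e k : Rn n) = latticePt b k := by
  have := ZLattice.module_finite ℝ Λ
  have := ZLattice.module_free ℝ Λ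
  let b₀ : Module.Basis (Fin n) ℤ Λ := Module.finBasisOfFinrankEq ℤ Λ (by
    rw [ZLattice.rank ℝ Λ]; simp)
  let b := b₀.ofZLatticeBasis ℝ Λ
  have hspan : Submodule.span ℤ (Set.range b) = Λ := b₀.ofZLatticeBasis_span ℝ
  refine ⟨b, (latticeEquiv b).trans (Equiv.setCongr (congrArg SetLike.coe hspan)), fun k => ?_⟩
  exact coe_latticeEquiv b k

theorem add_latticePt_notMem {Λ : Submodule ℤ (Rn n)} {U : Set (Rn n)}
    (hUd : Pairwise fun l m : Λ => Disjoint ((l : Rn n) +ᵥ U) ((m : Rn n) +ᵥ U))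
    {b : Module.Basis (Fin n) ℝ (Rn n)} {e : (Fin n → ℤ) ≃ Λ}
    (he : ∀ k, (e k : Rn n) = latticePt b k) :
    ∀ k, k ≠ 0 → ∀ t ∈ U, t + latticePt b k ∉ U := by
  intro k hk t ht ht'
  have h := hUd (e.injective.ne hk)
  have h1 : t + latticePt b k ∈ (e k : Rn n) +ᵥ U :=
    ⟨t, ht, by simp only [he, vadd_eq_add]; rw [add_comm]⟩
  have h2 : t + latticePt b k ∈ (e 0 : Rn n) +ᵥ U :=
    ⟨t + latticePt b k, ht', by simp only [he, vadd_eq_add]; simp [latticePt]⟩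
  exact Set.disjoint_left.1 h h1 h2

theorem isSynthesis_iff {B : Matrix (Fin n) (Fin n) ℝ} {Λ : Submodule ℤ (Rn n)}
    {b : Module.Basis (Fin n) ℝ (Rn n)} {e : (Fin n → ℤ) ≃ Λ}
    (he : ∀ k, (e k : Rn n) = latticePt b k) (φ ψ : 𝓢(Rn n, ℂ)) (c : Λ → ℂ) (a : ℂ) :
    HasSum (fun l : Λ => c l * ∫ t, twistedTranslate B (l : Rn n) φ t * ψ t) a ↔
      HasSum (fun k => c (e k) * ∫ t, twistS (-B) (latticePt b k) φ t * ψ t) a := by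
  rw [← e.hasSum_iff]
  simp only [Function.comp_def, he, twistS_neg_apply]

/-! ### Pairings of twisted translates -/

theorem integral_twistS_mul_self (B : Matrix (Fin n) (Fin n) ℝ) (x : Rn n) (χ θ : 𝓢(Rn n, ℂ)) :
    ∫ t, twistS (-B) x χ t * twistS B x θ t = ∫ t, χ t * θ t := by
  rw [← integral_sub_right_eq_self (fun t => χ t * θ t) x]
  refine integral_congr_ae (Eventually.of_forall fun t => ?_)
  simp only [twistS, tfS_apply]
  rw [mulVec_neg, inner_neg_right, mul_mul_mul_comm, mul_comm (phase _), phase_mul_phase_neg,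
    one_mul]

theorem twistS_mul_twistS_eq_zero (B B' : Matrix (Fin n) (Fin n) ℝ)
    {b : Module.Basis (Fin n) ℝ (Rn n)} {U : Set (Rn n)}
    (hU : ∀ k, k ≠ 0 → ∀ t ∈ U, t + latticePt b k ∉ U) {χ θ : 𝓢(Rn n, ℂ)}
    (hχ : tsupport χ ⊆ U) (hθ : tsupport θ ⊆ U) {k l : Fin n → ℤ} (h : k ≠ l) (t : Rn n) :
    twistS B (latticePt b k) χ t * twistS B' (latticePt b l) θ t = 0 := by
  simp only [twistS, tfS_apply]
  by_cases h1 : χ (t - latticePt b k) = 0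
  · simp [h1]
  by_cases h2 : θ (t - latticePt b l) = 0
  · simp [h2]
  refine absurd (hχ (subset_tsupport _ h1)) ?_
  have h3 := hU (l - k) (sub_ne_zero.2 h.symm) _ (hθ (subset_tsupport _ h2))
  rwa [sub_eq_add_neg l k, latticePt_add, latticePt_neg, ← add_assoc, sub_add_cancel,
    ← sub_eq_add_neg] at h3

/-- Biorthogonality: distinct twisted translates have disjoint supports, and for equal indices the
opposite twists cancel. This recovers the coefficients of a synthesis. -/
theorem hasSum_mul_integral_twistS (B : Matrix (Fin n) (Fin n) ℝ)
    {b : Module.Basis (Fin n) ℝ (Rn n)} {U : Set (Rn n)}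
    (hU : ∀ k, k ≠ 0 → ∀ t ∈ U, t + latticePt b k ∉ U) {χ θ : 𝓢(Rn n, ℂ)}
    (hχ : tsupport χ ⊆ U) (hθ : tsupport θ ⊆ U) (a : (Fin n → ℤ) → ℂ) (l : Fin n → ℤ) :
    HasSum (fun k => a k * ∫ t, twistS (-B) (latticePt b k) χ t * twistS B (latticePt b l) θ t)
      (a l * ∫ t, χ t * θ t) := by
  have h := hasSum_single (f := fun k => a k * ∫ t, twistS (-B) (latticePt b k) χ t *
    twistS B (latticePt b l) θ t) l fun k hk => by
      simp only [twistS_mul_twistS_eq_zero (-B) B hU hχ hθ hk, integral_zero, mul_zero]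
  rwa [integral_twistS_mul_self] at h

/-- The two orders differ by the phase of Bλ·p + λ·q, which the field `commute` makes trivial. -/
theorem AtomicSystem.tfS_twistS {B : Matrix (Fin n) (Fin n) ℝ} {b : Module.Basis (Fin n) ℝ (Rn n)}
    {χ : 𝓢(Rn n, ℂ)} (A : AtomicSystem B b χ) (j : (Fin n → ℤ) × (Fin n → ℤ)) (k : Fin n → ℤ)
    (φ : 𝓢(Rn n, ℂ)) : tfS (A.p j) (A.q j) (twistS (-B) (latticePt b k) φ) =
      twistS (-B) (latticePt b k) (tfS (A.p j) (A.q j) φ) := by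
  ext t
  simp only [twistS, tfS_apply]
  rw [mulVec_neg, sub_right_comm t (latticePt b k), ← mul_assoc, ← mul_assoc, ← phase_add,
    ← phase_add]
  congr 1
  rw [← one_mul (phase (_ + inner ℝ (t - A.p j - latticePt b k) (A.q j))), ← A.commute j k,
    ← phase_add]
  congr 1
  rw [real_inner_comm (A.p j)]
  simp only [inner_sub_left, inner_neg_right]
  ring

/-! ### Series with polynomially bounded coefficients -/

/-- The dependence on the offset x is kept explicit and polynomial: later x = p_j runs over the
atoms, and the bound must still be summable against the atomic coefficients. -/
theorem exists_tsum_integral_le (b : Module.Basis (Fin n) ℝ (Rn n)) (φ : 𝓢(Rn n, ℂ)) (M : ℕ) :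
    ∃ (m : ℕ × ℕ) (C : ℝ), 0 ≤ C ∧ ∀ (ψ : 𝓢(Rn n, ℂ)) (x : Rn n),
      (Summable fun k => (1 + ‖latticePt b k‖) ^ M *
        ∫ t, ‖φ (t - (latticePt b k + x))‖ * ‖ψ t‖) ∧
      ∑' k, (1 + ‖latticePt b k‖) ^ M * ∫ t, ‖φ (t - (latticePt b k + x))‖ * ‖ψ t‖ ≤
        C * schwartzNorm m ψ * (1 + ‖x‖) ^ M := by
  obtain ⟨N, C, hC, h⟩ := (moderate_pow (n := n) M).exists_tsum_le b
  obtain ⟨m, D, hD, h'⟩ := exists_integral_mul_le φ N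
  refine ⟨m, D * C, by positivity, fun ψ x => ?_⟩
  have h1 := h 0 (-x)
  rw [← ENNReal.ofReal_mul hC, norm_neg] at h1
  simp only [← ENNReal.ofReal_mul (pow_nonneg (add_nonneg zero_le_one (norm_nonneg _)) M : (0 : ℝ) ≤
    (1 + ‖(_ : Rn n)‖) ^ M), add_zero, sub_neg_eq_add] at h1
  obtain ⟨h2, h3⟩ := tsum_ofReal_le (fun k => mul_nonneg (by positivity) (bracket_nonneg _ _))
    ENNReal.ofReal_ne_top h1
  rw [ENNReal.toReal_ofReal (by positivity)] at h3
  have hle : ∀ k, (1 + ‖latticePt b k‖) ^ M * ∫ t, ‖φ (t - (latticePt b k + x))‖ * ‖ψ t‖ ≤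
      D * schwartzNorm m ψ * ((1 + ‖latticePt b k‖) ^ M * bracket N (latticePt b k + x)) := by
    intro k
    rw [mul_left_comm]
    exact mul_le_mul_of_nonneg_left (h' ψ _) (by positivity)
  have hs := Summable.of_nonneg_of_le (fun k => mul_nonneg (by positivity)
    (integral_nonneg fun t => by positivity)) hle (h2.mul_left _)
  refine ⟨hs, (hs.tsum_le_tsum hle (h2.mul_left _)).trans ?_⟩
  rw [tsum_mul_left]
  calc _ ≤ D * schwartzNorm m ψ * (C * (1 + ‖x‖) ^ M) := by gcongr
    _ = _ := by ring

theorem norm_integral_twistS_le (B : Matrix (Fin n) (Fin n) ℝ) (x p q : Rn n)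
    (φ ψ : 𝓢(Rn n, ℂ)) : ‖∫ t, twistS B x (tfS p q φ) t * ψ t‖ ≤
      ∫ t, ‖φ (t - (x + p))‖ * ‖ψ t‖ := by
  refine (norm_integral_le_integral_norm _).trans (le_of_eq ?_)
  simp only [norm_mul, twistS, norm_tfS_apply, sub_add_eq_sub_sub]

/-- Sequences on the lattice of polynomial growth. -/
def PolyBounded (b : Module.Basis (Fin n) ℝ (Rn n)) (a : (Fin n → ℤ) → ℂ) : Prop :=
  ∃ (K : ℝ) (M : ℕ), 0 ≤ K ∧ ∀ k, ‖a k‖ ≤ K * (1 + ‖latticePt b k‖) ^ M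

theorem PolyBounded.exists_dist {b : Module.Basis (Fin n) ℝ (Rn n)} {a : (Fin n → ℤ) → ℂ}
    (ha : PolyBounded b a) (B : Matrix (Fin n) (Fin n) ℝ) (φ : 𝓢(Rn n, ℂ)) :
    ∃ u : 𝓢'(Rn n, ℂ), ∀ ψ : 𝓢(Rn n, ℂ),
      HasSum (fun k => a k * ∫ t, twistS B (latticePt b k) φ t * ψ t) (u ψ) := by
  obtain ⟨K, M, hK, ha⟩ := ha
  obtain ⟨m, C, hC, h⟩ := exists_tsum_integral_le b φ M
  have hle : ∀ (ψ : 𝓢(Rn n, ℂ)) k, ‖a k * ∫ t, twistS B (latticePt b k) φ t * ψ t‖ ≤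
      K * ((1 + ‖latticePt b k‖) ^ M * ∫ t, ‖φ (t - (latticePt b k + 0))‖ * ‖ψ t‖) := by
    intro ψ k
    rw [norm_mul, ← mul_assoc]
    have h1 := norm_integral_twistS_le B (latticePt b k) 0 0 φ ψ
    rw [tfS_zero] at h1
    exact mul_le_mul (ha k) h1 (norm_nonneg _) (by positivity)
  have hs : ∀ ψ : 𝓢(Rn n, ℂ), Summable fun k => ‖a k * ∫ t, twistS B (latticePt b k) φ t * ψ t‖ :=
    fun ψ => Summable.of_nonneg_of_le (fun _ => norm_nonneg _) (hle ψ) ((h ψ 0).1.mul_left K)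
  have hint : ∀ (k : Fin n → ℤ) (ψ : 𝓢(Rn n, ℂ)),
      Integrable fun t => twistS B (latticePt b k) φ t * ψ t := fun k ψ =>
    SchwartzMap.integrable (mulSchwartz (twistS B (latticePt b k) φ) ψ)
  let u : 𝓢(Rn n, ℂ) →L[ℂ] ℂ := SchwartzMap.mkCLMtoNormedSpace (𝕜 := ℂ) (𝕜' := ℂ)
    (σ := RingHom.id ℂ)
    (fun ψ => ∑' k, a k * ∫ t, twistS B (latticePt b k) φ t * ψ t)
    (fun ψ θ => by
      rw [← (hs ψ).of_norm.tsum_add (hs θ).of_norm]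
      refine tsum_congr fun k => ?_
      rw [← mul_add, ← integral_add (hint k ψ) (hint k θ)]
      simp only [add_apply, mul_add])
    (fun s ψ => by
      rw [RingHom.id_apply, smul_eq_mul, ← tsum_mul_left]
      refine tsum_congr fun k => ?_
      rw [mul_left_comm, ← integral_const_mul s]
      simp only [smul_apply, smul_eq_mul, mul_left_comm s])
    ⟨Finset.Iic m, K * C, by positivity, fun ψ => by
      refine (norm_tsum_le_tsum_norm (hs ψ)).trans
        (((hs ψ).tsum_le_tsum (hle ψ) ((h ψ 0).1.mul_left K)).trans ?_)
      rw [tsum_mul_left, mul_assoc]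
      refine mul_le_mul_of_nonneg_left ((h ψ 0).2.trans (le_of_eq ?_)) hK
      rw [norm_zero, add_zero, one_pow, mul_one]
      rfl⟩
  exact ⟨ContinuousLinearMap.toPointwiseConvergenceCLM ℂ (RingHom.id ℂ) 𝓢(Rn n, ℂ) ℂ u,
    fun ψ => (hs ψ).of_norm.hasSum⟩

/-- Fubini for sums, used to exchange the sum over atoms with the sum over the lattice. -/
theorem HasSum.of_fiberwise_comm {α β : Type*} {f : α × β → ℂ} (hf : Summable f) {g : α → ℂ}
    {h : β → ℂ} {s : ℂ} (hg : ∀ a, HasSum (fun b => f (a, b)) (g a))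
    (hh : ∀ b, HasSum (fun a => f (a, b)) (h b)) (hs : HasSum g s) : HasSum h s := by
  have h1 := hf.hasSum.prod_fiberwise hg
  rw [hs.unique h1]
  exact ((Equiv.prodComm β α).hasSum_iff.2 hf.hasSum).prod_fiberwise hh

/-! ### Synthesis operators -/

section Synthesis

variable {ι : Inclusion n E} {κ : Inclusion n F} {pair : E →L[ℂ] F →L[ℂ] ℂ}
  {B : Matrix (Fin n) (Fin n) ℝ} {Λ : Submodule ℤ (Rn n)} {b : Module.Basis (Fin n) ℝ (Rn n)}
  {e : (Fin n → ℤ) ≃ Λ} {U : Set (Rn n)} {χ : 𝓢(Rn n, ℂ)}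

theorem exists_norm_mulVec_le (B : Matrix (Fin n) (Fin n) ℝ) :
    ∃ C : ℝ, 0 < C ∧ ∀ x, 1 + ‖mulVec B x‖ ≤ C * (1 + ‖x‖) := by
  refine ⟨1 + ‖Matrix.toEuclideanCLM (𝕜 := ℝ) B‖, by positivity, fun x => ?_⟩
  have := (Matrix.toEuclideanCLM (𝕜 := ℝ) B).le_opNorm x
  rw [mulVec]
  nlinarith [norm_nonneg x, norm_nonneg (Matrix.toEuclideanCLM (𝕜 := ℝ) B)]

theorem Shifts.j_twistS (A : Shifts ι) (B : Matrix (Fin n) (Fin n) ℝ) (x : Rn n)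
    (φ : 𝓢(Rn n, ℂ)) : A.j (twistS B x φ) = A.T x (A.M (mulVec B x) (A.j φ)) :=
  (A.T_M_j x _ φ).symm

/-- The value is a pairing with T_λM_{Bλ}θ in the dual partner, whose translation and modulation
norms grow polynomially; Bλ grows at most linearly in λ. -/
theorem DualPair.polyBounded_twistS (D : DualPair ι κ pair) (B : Matrix (Fin n) (Fin n) ℝ)
    (b : Module.Basis (Fin n) ℝ (Rn n)) (u : E) (θ : 𝓢(Rn n, ℂ)) :
    PolyBounded b fun k => ι.toDist u (twistS B (latticePt b k) θ) := by
  obtain ⟨C₁, τ₁, hC₁, h₁⟩ := D.right.T_bound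
  obtain ⟨C₂, τ₂, hC₂, h₂⟩ := D.right.M_bound
  obtain ⟨C₃, hC₃, h₃⟩ := exists_norm_mulVec_le B
  refine ⟨‖pair u‖ * (C₁ * (C₂ * C₃ ^ τ₂ * ‖D.right.j θ‖)), τ₁ + τ₂, by positivity, fun k => ?_⟩
  simp only
  rw [← D.pair_right, D.right.j_twistS]
  set x := latticePt b k
  have e1 : ‖D.right.M (mulVec B x) (D.right.j θ)‖ ≤
      C₂ * (C₃ * (1 + ‖x‖)) ^ τ₂ * ‖D.right.j θ‖ := by
    refine ((D.right.M _).le_opNorm _).trans (mul_le_mul_of_nonneg_right ((h₂ _).trans ?_)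
      (norm_nonneg _))
    gcongr
    exact h₃ x
  have e2 : ‖D.right.T x (D.right.M (mulVec B x) (D.right.j θ))‖ ≤
      C₁ * (1 + ‖x‖) ^ τ₁ * (C₂ * (C₃ * (1 + ‖x‖)) ^ τ₂ * ‖D.right.j θ‖) :=
    ((D.right.T _).le_opNorm _).trans (mul_le_mul (h₁ x) e1 (norm_nonneg _) (by positivity))
  refine ((pair u).le_opNorm _).trans ((mul_le_mul_of_nonneg_left e2 (norm_nonneg _)).trans
    (le_of_eq ?_))
  rw [mul_pow, pow_add]
  ring

theorem Discrete.hasSum_test (he : ∀ k, (e k : Rn n) = latticePt b k) (c : Discrete ι B Λ χ)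
    {ψ : 𝓢(Rn n, ℂ)} (hψ : HasCompactSupport ψ) :
    HasSum (fun k => c (e k) * ∫ t, twistS (-B) (latticePt b k) χ t * ψ t)
      (ι.toDist (Discrete.synthesis c) ψ) :=
  (isSynthesis_iff he χ ψ _ _).1 (Discrete.synthesis_spec c ψ hψ)

theorem Discrete.synthesis_twistS (he : ∀ k, (e k : Rn n) = latticePt b k)
    (hU : ∀ k, k ≠ 0 → ∀ t ∈ U, t + latticePt b k ∉ U) (hχ : IsTest U χ) {θ : 𝓢(Rn n, ℂ)}
    (hθc : HasCompactSupport θ) (hθ : tsupport θ ⊆ U) (c : Discrete ι B Λ χ) (k : Fin n → ℤ) :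
    ι.toDist (Discrete.synthesis c) (twistS B (latticePt b k) θ) = c (e k) * ∫ t, χ t * θ t :=
  (c.hasSum_test he (hasCompactSupport_tfS _ _ hθc)).unique
    (hasSum_mul_integral_twistS B hU hχ.2.1 hθ (fun k => c (e k)) k)

/-- By biorthogonality with the conjugate of χ, the coefficient c_λ is a constant multiple of
⟨S_χ(c), T^{-B}_λ conj χ⟩. -/
theorem DualPair.polyBounded (D : DualPair ι κ pair) (he : ∀ k, (e k : Rn n) = latticePt b k)
    (hU : ∀ k, k ≠ 0 → ∀ t ∈ U, t + latticePt b k ∉ U) (hχ : IsTest U χ)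
    (c : Discrete ι B Λ χ) : PolyBounded b fun k => c (e k) := by
  obtain ⟨K, M, hK, h⟩ := D.polyBounded_twistS B b (Discrete.synthesis c) (conjS χ)
  have h0 : 0 < ‖∫ t, χ t * conjS χ t‖ :=
    norm_pos_iff.2 (integral_mul_conjS_ne_zero hχ.1 hχ.2.2)
  refine ⟨K / ‖∫ t, χ t * conjS χ t‖, M, by positivity, fun k => ?_⟩
  have h1 := h k
  simp only at h1 ⊢
  rw [Discrete.synthesis_twistS he hU hχ (hasCompactSupport_conjS hχ.1)
    ((tsupport_conjS χ).trans_subset hχ.2.1) c k, norm_mul] at h1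
  rw [div_mul_eq_mul_div, le_div_iff₀ h0]
  exact h1

/-- E^B_d(Λ) is defined by testing on compactly supported functions only. Polynomial growth of c
makes the series converge against all Schwartz functions, and a tempered distribution is determined
by its values on test functions. -/
theorem DualPair.hasSum_synthesis (D : DualPair ι κ pair)
    (he : ∀ k, (e k : Rn n) = latticePt b k)
    (hU : ∀ k, k ≠ 0 → ∀ t ∈ U, t + latticePt b k ∉ U) (hχ : IsTest U χ)
    (c : Discrete ι B Λ χ) (ψ : 𝓢(Rn n, ℂ)) :
    HasSum (fun k => c (e k) * ∫ t, twistS (-B) (latticePt b k) χ t * ψ t)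
      (ι.toDist (Discrete.synthesis c) ψ) := by
  obtain ⟨u, hu⟩ := (D.polyBounded he hU hχ c).exists_dist (-B) χ
  have h : u - ι.toDist (Discrete.synthesis c) = 0 := eq_zero_of_test _ fun θ hθ => by
    change u θ - ι.toDist (Discrete.synthesis c) θ = 0
    rw [sub_eq_zero]
    exact (hu θ).unique (c.hasSum_test he hθ)
  rw [← sub_eq_zero.1 h]
  exact hu ψ

theorem integral_twistS_mul_modS (A : AtomicSystem B b χ) (j : (Fin n → ℤ) × (Fin n → ℤ))
    (k : Fin n → ℤ) (φ ψ : 𝓢(Rn n, ℂ)) :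
    ∫ t, twistS (-B) (latticePt b k) φ t * modS (A.q j) (transS (-A.p j) ψ) t =
      ∫ t, twistS (-B) (latticePt b k) (tfS (A.p j) (A.q j) φ) t * ψ t := by
  rw [← A.tfS_twistS, ← integral_sub_right_eq_self _ (A.p j)]
  refine integral_congr_ae (Eventually.of_forall fun t => ?_)
  simp only [modS_apply, transS_apply, sub_neg_eq_add, sub_add_cancel,
    tfS_apply (A.p j) (A.q j)]
  ring

theorem AtomicSystem.hasSum_integral_twistS {ν w : Rn n → ℝ} {η : 𝓢(Rn n, ℂ)}
    {hη : HasCompactSupport η} (A : AtomicSystem B b χ) (hν : Moderate ν) (hν1 : ∀ x, 1 ≤ ν x)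
    (hw : Moderate w) (hη0 : η ≠ 0) (φ ψ : 𝓢(Rn n, ℂ)) {k : Fin n → ℤ}
    (hs : Summable fun j => ‖A.coeff j φ‖ *
      ∫ t, ‖χ (t - (latticePt b k + A.p j))‖ * ‖ψ t‖) :
    HasSum (fun j => A.coeff j φ *
        ∫ t, twistS (-B) (latticePt b k) (tfS (A.p j) (A.q j) χ) t * ψ t)
      (∫ t, twistS (-B) (latticePt b k) φ t * ψ t) := by
  have h1 := hasSum_integral_of_summable_integral_norm (μ := (volume : Measure (Rn n)))
    (F := fun j t => A.coeff j φ *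
      (twistS (-B) (latticePt b k) (tfS (A.p j) (A.q j) χ) t * ψ t))
    (fun j => (SchwartzMap.integrable (mulSchwartz (twistS (-B) (latticePt b k)
      (tfS (A.p j) (A.q j) χ)) ψ)).const_mul _) (by
      refine hs.congr fun j => ?_
      rw [← integral_const_mul]
      simp only [norm_mul, twistS, norm_tfS_apply, sub_add_eq_sub_sub])
  simp only [integral_const_mul] at h1
  have h2 : ∀ t, ∑' j, A.coeff j φ *
      (twistS (-B) (latticePt b k) (tfS (A.p j) (A.q j) χ) t * ψ t) =
      twistS (-B) (latticePt b k) φ t * ψ t := by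
    intro t
    have h3 := A.hasSum hν hν1 hw hη hη0 φ (schwartz_mem_amalgam hν hw hη φ) (t - latticePt b k)
    have h4 := (h3.mul_left (phase (inner ℝ (t - latticePt b k)
      (mulVec (-B) (latticePt b k))))).mul_right (ψ t)
    have e1 : ∀ θ : 𝓢(Rn n, ℂ), twistS (-B) (latticePt b k) θ t =
      phase (inner ℝ (t - latticePt b k) (mulVec (-B) (latticePt b k))) * θ (t - latticePt b k) :=
        fun θ => tfS_apply _ _ θ t
    rw [e1 φ, ← h4.tsum_eq]
    refine tsum_congr fun j => ?_
    rw [e1]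
    ring
  simp only [h2] at h1
  exact h1

theorem summable_prod_mul {α β : Type*} {a d : α → ℝ} {g : α → β → ℝ} {C : ℝ}
    (ha : ∀ j, 0 ≤ a j) (hg : ∀ j k, 0 ≤ g j k) (hs : ∀ j, Summable (g j))
    (hle : ∀ j, ∑' k, g j k ≤ C * d j) (had : Summable fun j => a j * d j) :
    Summable fun x : α × β => a x.1 * g x.1 x.2 := by
  rw [summable_prod_of_nonneg fun x => mul_nonneg (ha _) (hg _ _)]
  have h1 : ∀ j, Summable fun k => a j * g j k := fun j => (hs j).mul_left (a j)
  have h2 : Summable fun j => ∑' k, a j * g j k := by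
    refine Summable.of_nonneg_of_le
      (fun j => tsum_nonneg fun k => mul_nonneg (ha j) (hg j k)) (fun j => ?_) (had.mul_left C)
    rw [tsum_mul_left, mul_left_comm]
    exact mul_le_mul_of_nonneg_left (hle j) (ha j)
  exact ⟨h1, h2⟩

theorem toFun_schwartzToAmalgam {ν w : Rn n → ℝ} (hν : Moderate ν) (hw : Moderate w)
    {η : 𝓢(Rn n, ℂ)} (hη : HasCompactSupport η) (φ : 𝓢(Rn n, ℂ)) :
    Amalgam.toFun (schwartzToAmalgam hν hw hη φ) = φ := rfl

/-- The identity S_φ(c) = L_φS_χ(c) in tested form: expand φ into atoms, use that they commute with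
T^B_λ, and exchange the two sums. -/
theorem DualPair.hasSum_of_hasSum_atoms (D : DualPair ι κ pair)
    (he : ∀ k, (e k : Rn n) = latticePt b k)
    (hU : ∀ k, k ≠ 0 → ∀ t ∈ U, t + latticePt b k ∉ U) (hχ : IsTest U χ)
    (A : AtomicSystem B b χ) {η : 𝓢(Rn n, ℂ)} (hη : HasCompactSupport η) (hη0 : η ≠ 0)
    {ν w : Rn n → ℝ} (hν : Moderate ν) (hν1 : ∀ x, 1 ≤ ν x) (hw : Moderate w)
    (c : Discrete ι B Λ χ) (φ ψ : 𝓢(Rn n, ℂ)) {a : ℂ}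
    (h1 : HasSum (fun j => A.coeff j φ * ι.toDist (Discrete.synthesis c)
      (modS (A.q j) (transS (-A.p j) ψ))) a) :
    HasSum (fun k => c (e k) * ∫ t, twistS (-B) (latticePt b k) φ t * ψ t) a := by
  obtain ⟨K, M, hK, hc⟩ := D.polyBounded he hU hχ c
  obtain ⟨m, C, hC, hi⟩ := exists_tsum_integral_le b χ M
  -- The coefficient functionals do not depend on the weights, and a Schwartz function lies in every
  -- amalgam space. The atomic bound is therefore used here with the weights 1 and (1 + ‖x‖)^M
  -- instead of those of E.
  have hαs : Summable fun j => ‖A.coeff j φ‖ * (1 + ‖A.p j‖) ^ M := by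
    obtain ⟨_, _, h⟩ := A.bound (moderate_one (n := n)) (fun _ => le_rfl)
      (moderate_pow (n := n) M) hη hη0
    simpa using (h φ (schwartz_mem_amalgam moderate_one (moderate_pow M) hη φ)).1
  have hint0 : ∀ x, 0 ≤ ∫ t, ‖χ (t - x)‖ * ‖ψ t‖ := fun x => integral_nonneg fun t => by
    positivity
  have hG := summable_prod_mul (a := fun j => ‖A.coeff j φ‖) (d := fun j => (1 + ‖A.p j‖) ^ M)
    (g := fun j k => (1 + ‖latticePt b k‖) ^ M *
      ∫ t, ‖χ (t - (latticePt b k + A.p j))‖ * ‖ψ t‖) (C := C * schwartzNorm m ψ)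
    (fun j => norm_nonneg _) (fun j k => mul_nonneg (by positivity) (hint0 _))
    (fun j => (hi ψ (A.p j)).1) (fun j => (hi ψ (A.p j)).2) hαs
  refine HasSum.of_fiberwise_comm (f := fun x => A.coeff x.1 φ * (c (e x.2) *
    ∫ t, twistS (-B) (latticePt b x.2) (tfS (A.p x.1) (A.q x.1) χ) t * ψ t)) ?_ (fun j => ?_)
    (fun k => ?_) h1
  · refine Summable.of_norm_bounded (hG.mul_left K) fun x => ?_
    rw [norm_mul, norm_mul]
    calc _ ≤ ‖A.coeff x.1 φ‖ * (K * (1 + ‖latticePt b x.2‖) ^ M *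
          ∫ t, ‖χ (t - (latticePt b x.2 + A.p x.1))‖ * ‖ψ t‖) :=
          mul_le_mul_of_nonneg_left (mul_le_mul (hc _) (norm_integral_twistS_le _ _ _ _ _ _)
            (norm_nonneg _) (by positivity)) (norm_nonneg _)
      _ = _ := by
          ring
  · have h2 := (D.hasSum_synthesis he hU hχ c
      (modS (A.q j) (transS (-A.p j) ψ))).mul_left (A.coeff j φ)
    simp only [integral_twistS_mul_modS] at h2
    exact h2
  · have h2 : Summable fun j => ‖A.coeff j φ‖ *
        ∫ t, ‖χ (t - (latticePt b k + A.p j))‖ * ‖ψ t‖ := by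
      refine Summable.of_nonneg_of_le (fun j => mul_nonneg (norm_nonneg _) (hint0 _))
        (fun j => ?_) (hG.prod_symm.prod_factor k)
      exact mul_le_mul_of_nonneg_left (le_mul_of_one_le_left (hint0 _)
        (one_le_pow₀ (by simp))) (norm_nonneg _)
    have h3 := (A.hasSum_integral_twistS (hη := hη) hν hν1 hw hη0 φ ψ h2).mul_left (c (e k))
    refine h3.congr_fun fun j => ?_
    simp only
    ring

/-- The synthesis map `S_χ : E^B_d(Λ) → E` as an isometric embedding. -/
noncomputable def Discrete.synthesisL : Discrete ι B Λ χ →L[ℂ] E :=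
  (Discrete.synthesis (ι := ι) (B := B) (Λ := Λ) (χ := χ)).mkContinuous 1 fun c => by
    rw [one_mul, Discrete.norm_def]

theorem Discrete.synthesisL_apply (c : Discrete ι B Λ χ) :
    Discrete.synthesisL c = Discrete.synthesis c := rfl

theorem one_le_modWeightTilde (x : Rn n) : 1 ≤ modWeightTilde ι x := le_max_left _ _

theorem DualPair.norm_left_M_le (D : DualPair ι κ pair) (q : Rn n) :
    ‖D.left.M q‖ ≤ modWeightTilde ι (-q) := by
  rw [modWeightTilde, D.left.modWeight_eq, neg_neg]
  exact le_max_right _ _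

theorem DualPair.exists_left_clm (D : DualPair ι κ pair) (A : AtomicSystem B b χ)
    {η : 𝓢(Rn n, ℂ)} (hη : HasCompactSupport η) (hη0 : η ≠ 0)
    (hν : Moderate (modWeightTilde ι)) (hw : Moderate (transWeight ι)) :
    ∃ L : Amalgam (modWeightTilde ι) (transWeight ι) η hη →L[ℂ] E →L[ℂ] E,
      ∀ f, HasSum (fun j => A.coeff j (Amalgam.toFun f) • (D.left.T (A.p j) ∘L D.left.M (A.q j))) (L f) := by
  have := D.left.complete
  refine A.exists_clm (η := η) (hη := hη) hν one_le_modWeightTilde hw hη0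
    (v := fun j => D.left.T (A.p j) ∘L D.left.M (A.q j)) ⟨1, fun j => ?_⟩
  rw [one_mul, D.left.transWeight_eq]
  exact (ContinuousLinearMap.opNorm_comp_le _ _).trans
    (mul_le_mul_of_nonneg_left (D.norm_left_M_le _) (norm_nonneg _))

theorem DualPair.exists_right_clm (D : DualPair ι κ pair) (A : AtomicSystem B b χ)
    {η : 𝓢(Rn n, ℂ)} (hη : HasCompactSupport η) (hη0 : η ≠ 0)
    (hν : Moderate (modWeightTilde ι)) (hw : Moderate (transWeight ι)) :
    ∃ L : Amalgam (modWeightTilde ι) (transWeight ι) η hη →L[ℂ] F →L[ℂ] F,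
      ∀ f, HasSum (fun j => A.coeff j (Amalgam.toFun f) • (D.right.M (A.q j) ∘L D.right.T (-A.p j))) (L f) := by
  have := D.right.complete
  refine A.exists_clm (η := η) (hη := hη) hν one_le_modWeightTilde hw hη0
    (v := fun j => D.right.M (A.q j) ∘L D.right.T (-A.p j)) ⟨1, fun j => ?_⟩
  rw [one_mul, D.left.transWeight_eq, D.norm_T, mul_comm]
  refine (ContinuousLinearMap.opNorm_comp_le _ _).trans
    (mul_le_mul_of_nonneg_right ?_ (norm_nonneg _))
  rw [← D.norm_M]
  exact D.norm_left_M_le _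

/-- The two operator series are termwise transposes. This is what furnishes h in the space F itself,
and not only in its bidual. -/
theorem DualPair.hasSum_pair_clm (D : DualPair ι κ pair) (A : AtomicSystem B b χ)
    {f : Rn n → ℂ} {L : E →L[ℂ] E} {L' : F →L[ℂ] F}
    (hL : HasSum (fun j => A.coeff j f • (D.left.T (A.p j) ∘L D.left.M (A.q j))) L)
    (hL' : HasSum (fun j => A.coeff j f • (D.right.M (A.q j) ∘L D.right.T (-A.p j))) L')
    (u : E) (g : F) : pair (L u) g = pair u (L' g) := by
  have h1 := (pair.flip g ∘L ContinuousLinearMap.apply ℂ E u).hasSum hL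
  have h2 := (pair u ∘L ContinuousLinearMap.apply ℂ F g).hasSum hL'
  have h3 : ∀ j, pair (D.left.T (A.p j) (D.left.M (A.q j) u)) g =
      pair u (D.right.M (A.q j) (D.right.T (-A.p j) g)) := fun j => by
    rw [D.pair_T, D.pair_M]
  simp only [map_smul, ContinuousLinearMap.flip_apply,
    ContinuousLinearMap.comp_apply, ContinuousLinearMap.apply_apply, h3] at h1 h2
  exact h1.unique h2

theorem DualPair.isSynthesis_clm (D : DualPair ι κ pair)
    (he : ∀ k, (e k : Rn n) = latticePt b k)
    (hU : ∀ k, k ≠ 0 → ∀ t ∈ U, t + latticePt b k ∉ U) (hχ : IsTest U χ)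
    (A : AtomicSystem B b χ) {η : 𝓢(Rn n, ℂ)} (hη : HasCompactSupport η) (hη0 : η ≠ 0)
    {ν w : Rn n → ℝ} (hν : Moderate ν) (hν1 : ∀ x, 1 ≤ ν x) (hw : Moderate w)
    (c : Discrete ι B Λ χ) (φ : 𝓢(Rn n, ℂ)) {L : E →L[ℂ] E}
    (hL : HasSum (fun j => A.coeff j φ • (D.left.T (A.p j) ∘L D.left.M (A.q j))) L) :
    IsSynthesis B Λ φ (Discrete.toSeq c) (ι.toDist (L (Discrete.synthesis c))) := by
  intro ψ
  rw [isSynthesis_iff he]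
  have h1 := (ι.eval ψ ∘L ContinuousLinearMap.apply ℂ E (Discrete.synthesis c)).hasSum hL
  have h2 : ∀ j, ι.toDist (D.left.T (A.p j) (D.left.M (A.q j) (Discrete.synthesis c))) ψ =
      ι.toDist (Discrete.synthesis c) (modS (A.q j) (transS (-A.p j) ψ)) := fun j => by
    rw [D.left.dist_T_M]
  simp only [map_smul, smul_eq_mul, Inclusion.eval_apply, h2,
    ContinuousLinearMap.comp_apply, ContinuousLinearMap.apply_apply] at h1
  exact D.hasSum_of_hasSum_atoms he hU hχ A hη hη0 hν hν1 hw c φ ψ h1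

theorem DualPair.exists_synthesis_clm (D : DualPair ι κ pair)
    (he : ∀ k, (e k : Rn n) = latticePt b k)
    (hU : ∀ k, k ≠ 0 → ∀ t ∈ U, t + latticePt b k ∉ U) (hχ : IsTest U χ)
    (A : AtomicSystem B b χ) {η : 𝓢(Rn n, ℂ)} (hη : HasCompactSupport η) (hη0 : η ≠ 0)
    (hν : Moderate (modWeightTilde ι)) (hw : Moderate (transWeight ι)) :
    ∃ S : Discrete ι B Λ χ →L[ℂ] Amalgam (modWeightTilde ι) (transWeight ι) η hη →L[ℂ] E,
      (∀ (c : Discrete ι B Λ χ) (φ : 𝓢(Rn n, ℂ)),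
        IsSynthesis B Λ φ c (ι.toDist (S c (schwartzToAmalgam hν hw hη φ)))) ∧
      ∀ (g : F) (f : Amalgam (modWeightTilde ι) (transWeight ι) η hη),
        ∃ h : F, ∀ c : Discrete ι B Λ χ, pair (S c f) g = pair (Discrete.synthesis c) h := by
  obtain ⟨L, hL⟩ := D.exists_left_clm A hη hη0 hν hw
  obtain ⟨L', hL'⟩ := D.exists_right_clm A hη hη0 hν hw
  refine ⟨L.flip ∘L Discrete.synthesisL, fun c φ => ?_, fun g f => ⟨L' f g, fun c => ?_⟩⟩
  · have h := hL (schwartzToAmalgam hν hw hη φ)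
    rw [toFun_schwartzToAmalgam] at h
    rw [ContinuousLinearMap.comp_apply, ContinuousLinearMap.flip_apply,
      Discrete.synthesisL_apply]
    exact D.isSynthesis_clm he hU hχ A hη hη0 hν one_le_modWeightTilde hw c φ h
  · rw [ContinuousLinearMap.comp_apply, ContinuousLinearMap.flip_apply,
      Discrete.synthesisL_apply]
    exact D.hasSum_pair_clm A (hL f) (hL' f) _ g

end Synthesis

/-! ### Sampling operators -/

section Sampling

variable {ι : Inclusion n E} {κ : Inclusion n F} {pair : E →L[ℂ] F →L[ℂ] ℂ}
  {B : Matrix (Fin n) (Fin n) ℝ} {Λ : Submodule ℤ (Rn n)} {b : Module.Basis (Fin n) ℝ (Rn n)}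
  {e : (Fin n → ℤ) ≃ Λ} {U : Set (Rn n)} {χ : 𝓢(Rn n, ℂ)}

theorem integrable_of_hasSum {α I : Type*} [Countable I] [MeasurableSpace α] {μ : Measure α}
    {f : I → α → ℂ} {g : α → ℂ} (hf : ∀ i, Integrable (f i) μ) (hg : AEStronglyMeasurable g μ)
    (hs : Summable fun i => ∫ t, ‖f i t‖ ∂μ) (h : ∀ t, HasSum (fun i => f i t) (g t)) :
    Integrable g μ ∧ HasSum (fun i => ∫ t, f i t ∂μ) (∫ t, g t ∂μ) := by
  refine ⟨⟨hg, ?_⟩, ?_⟩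
  · have h1 : ∫⁻ t, ‖g t‖ₑ ∂μ ≤ ∑' i, ∫⁻ t, ‖f i t‖ₑ ∂μ := by
      rw [← lintegral_tsum fun i => (hf i).aestronglyMeasurable.enorm]
      refine lintegral_mono fun t => ?_
      rw [← (h t).tsum_eq]
      exact enorm_tsum_le_tsum_enorm
    refine h1.trans_lt ?_
    have h2 : ∀ i, ∫⁻ t, ‖f i t‖ₑ ∂μ = ENNReal.ofReal (∫ t, ‖f i t‖ ∂μ) := fun i => by
      rw [ofReal_integral_norm_eq_lintegral_enorm (hf i)]
    simp only [h2]
    rw [← ENNReal.ofReal_tsum_of_nonneg (fun i => integral_nonneg fun t => norm_nonneg _) hs]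
    exact ENNReal.ofReal_lt_top
  · have h1 := hasSum_integral_of_summable_integral_norm hf hs
    simpa only [(h _).tsum_eq] using h1

/-- The atomic series also converges pointwise to f, with summable integrals against any ψ; hence
the distribution it defines is integration against f. -/
theorem AtomicSystem.isFunction (A : AtomicSystem B b χ) {ν w : Rn n → ℝ} {η : 𝓢(Rn n, ℂ)}
    {hη : HasCompactSupport η} (hν : Moderate ν) (hν1 : ∀ x, 1 ≤ ν x) (hw : Moderate w)
    (hη0 : η ≠ 0) {f : Rn n → ℂ} (hf : f ∈ amalgam ν w η hη) {u : 𝓢'(Rn n, ℂ)}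
    (hu : ∀ ψ : 𝓢(Rn n, ℂ), HasSum (fun j => A.coeff j f *
      ∫ t, tfS (A.p j) (A.q j) χ t * ψ t) (u ψ)) : IsFunction u f := by
  intro ψ
  obtain ⟨_, _, hb⟩ := A.bound hν hν1 hw hη hη0
  obtain ⟨C, hC, hC'⟩ := hw.exists_integral_mul_window_le χ ψ
  have hw0 : 0 < w 0 := hw.1 0
  have h1 : ∀ p, ∫ t, ‖χ (t - p)‖ * ‖ψ t‖ ≤ C / w 0 * w p := fun p => by
    have := hC' p 0
    simp only [sub_zero] at this
    rw [div_mul_eq_mul_div, le_div_iff₀ hw0, mul_comm]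
    exact this
  have hs : Summable fun j => ∫ t, ‖A.coeff j f * (tfS (A.p j) (A.q j) χ t * ψ t)‖ := by
    refine Summable.of_nonneg_of_le (fun j => integral_nonneg fun t => norm_nonneg _)
      (fun j => ?_) ((hb f hf).1.mul_left (C / w 0))
    simp only [norm_mul, norm_tfS_apply]
    rw [integral_const_mul, mul_left_comm]
    refine mul_le_mul_of_nonneg_left ((h1 _).trans ?_) (norm_nonneg _)
    rw [← mul_assoc]
    exact le_mul_of_one_le_right (mul_nonneg (by positivity) (hw.1 _).le) (hν1 _)
  have h2 := integrable_of_hasSum (μ := (volume : Measure (Rn n)))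
    (f := fun j t => A.coeff j f * (tfS (A.p j) (A.q j) χ t * ψ t)) (g := fun t => f t * ψ t)
    (fun j => (SchwartzMap.integrable (mulSchwartz (tfS (A.p j) (A.q j) χ) ψ)).const_mul _)
    (hf.1.mul ψ.continuous).aestronglyMeasurable hs (fun t => by
      simpa only [mul_assoc] using (A.hasSum hν hν1 hw hη hη0 f hf t).mul_right (ψ t))
  refine ⟨h2.1, (hu ψ).unique ?_⟩
  simpa only [integral_const_mul] using h2.2

theorem IsFunction.twistedTranslate {A : Shifts κ} {f : F} {h : Rn n → ℂ}
    (hf : IsFunction (κ.toDist f) h) (B : Matrix (Fin n) (Fin n) ℝ) (x : Rn n) :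
    IsFunction (κ.toDist (A.T x (A.M (mulVec B x) f))) (twistedTranslate (-B) x h) := by
  intro ψ
  obtain ⟨h1, h2⟩ := hf (modS (mulVec B x) (transS (-x) ψ))
  have h3 : ∀ t, h t * modS (mulVec B x) (transS (-x) ψ) t =
      TwistedSeq.twistedTranslate (-B) x h (t + x) * ψ (t + x) := fun t => by
    rw [twistedTranslate_eq, mulVec_neg, inner_neg_left, neg_neg, real_inner_comm]
    simp only [modS_apply, transS_apply, sub_neg_eq_add, add_sub_cancel_right]
    ring
  simp only [h3] at h1 h2
  refine ⟨by simpa using h1.comp_sub_right x, ?_⟩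
  rw [A.dist_T_M, h2]
  exact integral_add_right_eq_self
    (fun t => TwistedSeq.twistedTranslate (-B) x h t * ψ t) x

theorem IsFunction.eq {f g : F} {h : Rn n → ℂ} (hf : IsFunction (κ.toDist f) h)
    (hg : IsFunction (κ.toDist g) h) : f = g :=
  κ.injective (by ext ψ; rw [(hf ψ).2, (hg ψ).2])

theorem Shifts.isFunction_j (A : Shifts κ) (φ : 𝓢(Rn n, ℂ)) : IsFunction (κ.toDist (A.j φ)) φ :=
  fun ψ => ⟨SchwartzMap.integrable (mulSchwartz φ ψ), by rw [A.j_dist, schwartz_apply]⟩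

/-- Embeds the amalgam space with reflected weight into the space paired with E: on that space ‖T_p‖
= ω_E(-p), so the atoms have norm at most a constant times ω_E(-p)ν̃_E(-q). -/
theorem DualPair.exists_function_clm (D : DualPair ι κ pair) (A : AtomicSystem (-B) b χ)
    {η : 𝓢(Rn n, ℂ)} (hη : HasCompactSupport η) (hη0 : η ≠ 0)
    (hν : Moderate (modWeightTilde ι)) (hw : Moderate fun x => transWeight ι (-x)) :
    ∃ G : Amalgam (modWeightTilde ι) (fun x => transWeight ι (-x)) η hη →L[ℂ] F,
      ∀ f, HasSum (fun j => A.coeff j (Amalgam.toFun f) •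
        D.right.T (A.p j) (D.right.M (A.q j) (D.right.j χ))) (G f) := by
  have := D.right.complete
  refine A.exists_clm (η := η) (hη := hη) hν one_le_modWeightTilde hw hη0
    (v := fun j => D.right.T (A.p j) (D.right.M (A.q j) (D.right.j χ)))
    ⟨‖D.right.j χ‖, fun j => ?_⟩
  rw [D.left.transWeight_eq, D.norm_T, neg_neg, mul_comm ‖D.right.j χ‖, mul_assoc]
  refine ((D.right.T _).le_opNorm _).trans (mul_le_mul_of_nonneg_left ?_ (norm_nonneg _))
  refine ((D.right.M _).le_opNorm _).trans (mul_le_mul_of_nonneg_right ?_ (norm_nonneg _))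
  rw [← D.norm_M]
  exact D.norm_left_M_le _

theorem DualPair.exists_left_clm_reflect (D : DualPair ι κ pair) (A : AtomicSystem (-B) b χ)
    {η : 𝓢(Rn n, ℂ)} (hη : HasCompactSupport η) (hη0 : η ≠ 0)
    (hν : Moderate (modWeightTilde ι)) (hw : Moderate fun x => transWeight ι (-x)) :
    ∃ L : Amalgam (modWeightTilde ι) (fun x => transWeight ι (-x)) η hη →L[ℂ] E →L[ℂ] E,
      ∀ f, HasSum (fun j => A.coeff j (Amalgam.toFun f) •
        (D.left.M (A.q j) ∘L D.left.T (-A.p j))) (L f) := by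
  have := D.left.complete
  refine A.exists_clm (η := η) (hη := hη) hν one_le_modWeightTilde hw hη0
    (v := fun j => D.left.M (A.q j) ∘L D.left.T (-A.p j)) ⟨1, fun j => ?_⟩
  rw [one_mul, D.left.transWeight_eq, mul_comm]
  exact (ContinuousLinearMap.opNorm_comp_le _ _).trans
    (mul_le_mul_of_nonneg_right (D.norm_left_M_le _) (norm_nonneg _))

theorem DualPair.pair_tfS (D : DualPair ι κ pair) (p q : Rn n) (u : E) (φ : 𝓢(Rn n, ℂ)) :
    pair u (D.right.j (tfS p q φ)) = ι.toDist (D.left.M q (D.left.T (-p) u)) φ := by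
  rw [← D.pair_right, D.pair_M, D.pair_T, neg_neg, D.right.T_M_j]

/-- Atoms for -B commute with T^{-B}_λ and can be moved across the pairing, so sampling u against φ
amounts to sampling L u against the fixed window χ. -/
theorem DualPair.isTwistedConvolution (D : DualPair ι κ pair) (A : AtomicSystem (-B) b χ)
    {η : 𝓢(Rn n, ℂ)} {hη : HasCompactSupport η} (hη0 : η ≠ 0) {ν w : Rn n → ℝ}
    (hν : Moderate ν) (hν1 : ∀ x, 1 ≤ ν x) (hw : Moderate w) {φ : Rn n → ℂ}
    (hφ : chirpReflect B φ ∈ amalgam ν w η hη) {G : F} {L : E →L[ℂ] E}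
    (hG : HasSum (fun j => A.coeff j (chirpReflect B φ) •
        D.right.T (A.p j) (D.right.M (A.q j) (D.right.j χ))) G)
    (hL : HasSum (fun j => A.coeff j (chirpReflect B φ) •
        (D.left.M (A.q j) ∘L D.left.T (-A.p j))) L) (u : E) (k : Fin n → ℤ) :
    IsTwistedConvolution κ pair B u φ (latticePt b k)
      (ι.toDist (L u) (twistS B (latticePt b k) χ)) := by
  refine ⟨D.right.T (latticePt b k) (D.right.M (mulVec B (latticePt b k)) G), ?_, ?_⟩
  · refine IsFunction.twistedTranslate (A.isFunction hν hν1 hw hη0 hφ fun ψ => ?_) B _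
    have h1 := (κ.eval ψ).hasSum hG
    simpa only [map_smul, smul_eq_mul, Inclusion.eval_apply, D.right.T_M_j, D.right.j_dist,
      schwartz_apply] using h1
  · have h1 := (pair u ∘L D.right.T (latticePt b k) ∘L
      D.right.M (mulVec B (latticePt b k))).hasSum hG
    have h2 := (ι.eval (twistS B (latticePt b k) χ) ∘L ContinuousLinearMap.apply ℂ E u).hasSum hL
    have h3 : ∀ j, pair u (D.right.T (latticePt b k) (D.right.M (mulVec B (latticePt b k))
        (D.right.T (A.p j) (D.right.M (A.q j) (D.right.j χ))))) =
        ι.toDist (D.left.M (A.q j) (D.left.T (-A.p j) u)) (twistS B (latticePt b k) χ) := by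
      intro j
      have h4 := A.tfS_twistS j k χ
      rw [neg_neg] at h4
      rw [D.right.T_M_j, ← D.right.j_twistS, ← h4, D.pair_tfS]
    simp only [map_smul, smul_eq_mul, Inclusion.eval_apply, ContinuousLinearMap.comp_apply,
      ContinuousLinearMap.apply_apply, h3] at h1 h2
    exact h2.unique h1

/-- If the frame operator acts on `E`, the twisted coefficients of an element of `E` form an
element of `E^B_d(Λ)`. -/
theorem exists_coefficient_clm (he : ∀ k, (e k : Rn n) = latticePt b k) {P : E →L[ℂ] E}
    (hP : ∀ u (ψ : 𝓢(Rn n, ℂ)), HasCompactSupport ψ →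
      HasSum (fun k => ι.toDist u (twistS B (latticePt b k) χ) *
        ∫ t, twistS (-B) (latticePt b k) χ t * ψ t) (ι.toDist (P u) ψ)) :
    ∃ R : E →L[ℂ] Discrete ι B Λ χ, ∀ u k,
      R u (e k) = ι.toDist u (twistS B (latticePt b k) χ) := by
  have hm : ∀ u, IsLocalSynthesis B Λ χ (fun l => ι.toDist u (twistS B (l : Rn n) χ))
      (ι.toDist (P u)) := fun u ψ hψ => by
    rw [isSynthesis_iff he]
    simp only [he]
    exact hP u ψ hψ
  have hadd : ∀ (u v : E) (l : Λ), ι.toDist (u + v) (twistS B (l : Rn n) χ) =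
      ι.toDist u (twistS B (l : Rn n) χ) + ι.toDist v (twistS B (l : Rn n) χ) := fun u v l => by
    rw [map_add]; rfl
  have hsmul : ∀ (a : ℂ) (u : E) (l : Λ), ι.toDist (a • u) (twistS B (l : Rn n) χ) =
      a * ι.toDist u (twistS B (l : Rn n) χ) := fun a u l => by
    rw [map_smul]; rfl
  let R : E →ₗ[ℂ] Discrete ι B Λ χ :=
    { toFun := fun u => ⟨_, P u, hm u⟩
      map_add' := fun u v => Subtype.ext (funext (hadd u v))
      map_smul' := fun a u => Subtype.ext (funext (hsmul a u)) }
  have hR : ∀ u, Discrete.synthesis (R u) = P u := fun u =>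
    Discrete.synthesis_unique (Discrete.synthesis_spec (R u)) (hm u)
  refine ⟨R.mkContinuous ‖P‖ fun u => ?_, fun u k => ?_⟩
  · rw [Discrete.norm_def, hR]
    exact P.le_opNorm u
  · change ι.toDist u (twistS B (e k : Rn n) χ) = _
    rw [he]

/-- The isometry `φ ↦ θ_B(φˇ)` into the amalgam space as a continuous linear map. -/
noncomputable def SamplingDomain.toAmalgamL {ν w : Rn n → ℝ} {η : 𝓢(Rn n, ℂ)}
    {hη : HasCompactSupport η} : SamplingDomain B ν w η hη →L[ℂ] Amalgam ν w η hη :=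
  (SamplingDomain.toAmalgam (B := B) (ν := ν) (w := w) (η := η) (hη := hη)).mkContinuous 1
    fun φ => by rw [one_mul, SamplingDomain.norm_def]

theorem SamplingDomain.toFun_toAmalgamL {ν w : Rn n → ℝ} {η : 𝓢(Rn n, ℂ)}
    {hη : HasCompactSupport η} (φ : SamplingDomain B ν w η hη) :
    Amalgam.toFun (SamplingDomain.toAmalgamL φ) = chirpReflect B (SamplingDomain.toFun φ) := rfl

theorem SamplingDomain.chirpReflect_mem {ν w : Rn n → ℝ} {η : 𝓢(Rn n, ℂ)}
    {hη : HasCompactSupport η} (φ : SamplingDomain B ν w η hη) :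
    chirpReflect B (SamplingDomain.toFun φ) ∈ amalgam ν w η hη := φ.2

/-- A composition of two bounded maps: (u, φ) ↦ L_φ u on E, followed by the coefficient map of the
frame operator. -/
theorem DualPair.exists_sampling_clm (D : DualPair ι κ pair)
    (he : ∀ k, (e k : Rn n) = latticePt b k) {P : E →L[ℂ] E}
    (hP : ∀ u (ψ : 𝓢(Rn n, ℂ)), HasCompactSupport ψ →
      HasSum (fun k => ι.toDist u (twistS B (latticePt b k) χ) *
        ∫ t, twistS (-B) (latticePt b k) χ t * ψ t) (ι.toDist (P u) ψ))
    (A : AtomicSystem (-B) b χ) {η : 𝓢(Rn n, ℂ)} (hη : HasCompactSupport η) (hη0 : η ≠ 0)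
    (hν : Moderate (modWeightTilde ι)) (hw : Moderate (transWeight ι)) :
    ∃ R : E →L[ℂ] SamplingDomain B (modWeightTilde ι) (fun x => transWeight ι (-x)) η hη →L[ℂ]
      Discrete ι B Λ χ, ∀ (u : E) (φ : SamplingDomain B (modWeightTilde ι)
        (fun x => transWeight ι (-x)) η hη) (l : Λ),
        IsTwistedConvolution κ pair B u (SamplingDomain.toFun φ) (l : Rn n) (R u φ l) := by
  obtain ⟨G, hG⟩ := D.exists_function_clm A hη hη0 hν hw.reflect
  obtain ⟨L, hL⟩ := D.exists_left_clm_reflect A hη hη0 hν hw.reflect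
  obtain ⟨R, hR⟩ := exists_coefficient_clm he hP
  refine ⟨((ContinuousLinearMap.compL ℂ (SamplingDomain B (modWeightTilde ι)
    (fun x => transWeight ι (-x)) η hη) _ _).flip SamplingDomain.toAmalgamL) ∘L
    (ContinuousLinearMap.compL ℂ (Amalgam (modWeightTilde ι)
      (fun x => transWeight ι (-x)) η hη) _ _ R) ∘L L.flip, fun u φ l => ?_⟩
  obtain ⟨k, rfl⟩ := e.surjective l
  have h1 := hG (SamplingDomain.toAmalgamL φ)
  have h2 := hL (SamplingDomain.toAmalgamL φ)
  rw [SamplingDomain.toFun_toAmalgamL] at h1 h2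
  have h3 := D.isTwistedConvolution A hη0 hν one_le_modWeightTilde hw.reflect
    φ.chirpReflect_mem h1 h2 u k
  rw [← hR, ← he] at h3
  exact h3

end Sampling

/-! ### Reconstruction and complementation -/

section Reconstruction

variable {ι : Inclusion n E} {κ : Inclusion n F} {pair : E →L[ℂ] F →L[ℂ] ℂ}
  {B : Matrix (Fin n) (Fin n) ℝ} {Λ : Submodule ℤ (Rn n)} {b : Module.Basis (Fin n) ℝ (Rn n)}
  {e : (Fin n → ℤ) ≃ Λ} {U : Set (Rn n)} {χ : 𝓢(Rn n, ℂ)}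

theorem exists_schwartz_chirp (B : Matrix (Fin n) (Fin n) ℝ) {ψ : 𝓢(Rn n, ℂ)}
    (hψ : HasCompactSupport ψ) :
    ∃ θ : 𝓢(Rn n, ℂ), (θ : Rn n → ℂ) = chirp B ψ ∧ HasCompactSupport θ ∧
      tsupport θ ⊆ tsupport ψ := by
  have h1 : chirp B ψ = fun x => phase (inner ℝ (mulVec B x) x) * ψ x := funext (chirp_eq B ψ)
  have h2 : ContDiff ℝ (⊤ : ℕ∞) (mulVec B) := (Matrix.toEuclideanCLM (𝕜 := ℝ) B).contDiff
  have hs : ContDiff ℝ (⊤ : ℕ∞) (chirp B ψ) := by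
    rw [h1]
    exact (contDiff_phase.comp (h2.inner ℝ contDiff_id)).mul (ψ.smooth _)
  have hc : HasCompactSupport (chirp B ψ) := by
    rw [h1]
    exact hψ.mul_left
  refine ⟨hc.toSchwartzMap hs, rfl, hc, ?_⟩
  change tsupport (chirp B ψ) ⊆ _
  rw [h1]
  exact tsupport_mul_subset_right

theorem chirp_chirp_neg (B : Matrix (Fin n) (Fin n) ℝ) (f : Rn n → ℂ) :
    chirp B (chirp (-B) f) = f := by
  ext x
  have h : mulVec (-B) x = -mulVec B x := by simp [mulVec]
  rw [chirp_eq, chirp_eq, h, inner_neg_left, ← mul_assoc, phase_mul_phase_neg, one_mul]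

theorem IsTwistedConvolution.eq_toDist (D : DualPair ι κ pair) {u : E} {φ : Rn n → ℂ}
    {x : Rn n} {z : ℂ} (h : IsTwistedConvolution κ pair B u φ x z) {θ : 𝓢(Rn n, ℂ)}
    (hθ : chirpReflect B φ = θ) : z = ι.toDist u (twistS B x θ) := by
  obtain ⟨f, hf, rfl⟩ := h
  rw [hθ, ← twistS_apply] at hf
  rw [hf.eq (D.right.isFunction_j _), D.pair_right]

/-- Sampling with a Schwartz window is evaluation of the distribution at T^{-B}_λθ, and
biorthogonality extracts the coefficient at λ. -/
theorem DualPair.sampling_synthesis (D : DualPair ι κ pair)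
    (he : ∀ k, (e k : Rn n) = latticePt b k)
    (hU : ∀ k, k ≠ 0 → ∀ t ∈ U, t + latticePt b k ∉ U) {c d : Discrete ι B Λ χ} {u : E}
    {χ₁ θ : 𝓢(Rn n, ℂ)} (hχ₁ : tsupport χ₁ ⊆ U) (hθ : tsupport θ ⊆ U)
    (hu : IsSynthesis B Λ χ₁ (Discrete.toSeq c) (ι.toDist u)) {φ : Rn n → ℂ}
    (hφ : chirpReflect B φ = θ)
    (hd : ∀ l : Λ, IsTwistedConvolution κ pair B u φ (l : Rn n) (Discrete.toSeq d l)) :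
    d = (∫ t, θ t * χ₁ t) • c := by
  refine Subtype.ext (funext fun l => ?_)
  obtain ⟨k, rfl⟩ := e.surjective l
  have h1 := (hd (e k)).eq_toDist D hφ
  have h2 := (isSynthesis_iff he χ₁ _ _ _).1 (hu (twistS B (latticePt b k) θ))
  have h3 := hasSum_mul_integral_twistS B hU hχ₁ hθ (fun k => Discrete.toSeq c (e k)) k
  rw [he, h2.unique h3, mul_comm] at h1
  simp only [mul_comm (χ₁ _)] at h1
  exact h1

theorem exists_samplingDomain (B : Matrix (Fin n) (Fin n) ℝ) {ν w : Rn n → ℝ} (hν : Moderate ν)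
    (hw : Moderate w) {η : 𝓢(Rn n, ℂ)} (hη : HasCompactSupport η) {ψ θ : 𝓢(Rn n, ℂ)}
    (hθ : (θ : Rn n → ℂ) = chirp B ψ) :
    ∃ φ : SamplingDomain B ν w η hη, (∀ t, SamplingDomain.toFun φ t = ψ (-t)) ∧
      chirpReflect B (SamplingDomain.toFun φ) = θ := by
  have h : chirpReflect B (fun t => ψ (-t)) = θ := by
    rw [hθ]
    ext x
    simp [chirpReflect]
  refine ⟨⟨fun t => ψ (-t), ?_⟩, fun t => rfl, h⟩
  rw [Submodule.mem_comap, h]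
  exact schwartz_mem_amalgam hν hw hη θ

/-- The projection is a⁻¹·S∘R. No topology on V is needed, only continuity of the composite on E. -/
theorem closedComplemented_range {V : Type*} [AddCommGroup V] [Module ℂ V] (S : V →ₗ[ℂ] E)
    (R : E →ₗ[ℂ] V) (hSR : Continuous fun u => S (R u)) {a : ℂ} (ha : a ≠ 0)
    (h : ∀ c, R (S c) = a • c) : (LinearMap.range S).ClosedComplemented := by
  let Q : E →L[ℂ] E := a⁻¹ • ⟨S ∘ₗ R, hSR⟩
  have hQ : ∀ u, Q u = a⁻¹ • S (R u) := fun u => rfl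
  refine ⟨Q.codRestrict _ fun u => ⟨a⁻¹ • R u, by rw [map_smul, hQ]⟩, ?_⟩
  rintro ⟨_, c, rfl⟩
  refine Subtype.ext ?_
  change Q (S c) = S c
  rw [hQ, h, map_smul, inv_smul_smul₀ ha]

end Reconstruction

end TwistedSeq

/-! ### The main theorem -/

open TwistedSeq
theorem proposition5p6 {n : ℕ} {E F : Type*}
    [NormedAddCommGroup E] [NormedSpace ℂ E] [NormedAddCommGroup F] [NormedSpace ℂ F]
    (ι : Inclusion n E) (κ : Inclusion n F) (pair : E →L[ℂ] F →L[ℂ] ℂ)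
    -- `E` is a TMIB and `F = E'`, or `E` is a DTMIB, `E = F'` with a TMIB `F = E₀`
    (hE : (IsTMIB ι ∧ IsStrongDual κ ι pair.flip) ∨
      (IsTMIB κ ∧ IsStrongDual ι κ pair))
    (B : Matrix (Fin n) (Fin n) ℝ)
    (Λ : Submodule ℤ (Rn n)) [DiscreteTopology Λ] [IsZLattice ℝ Λ]
    (U : Set (Rn n)) (hUo : IsOpen U) (hU0 : (0 : Rn n) ∈ U)
    (hUb : Bornology.IsBounded U)
    (hUd : Pairwise fun l m : Λ =>
      Disjoint ((l : Rn n) +ᵥ U) ((m : Rn n) +ᵥ U))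
    -- the test function that defines `E^B_d(Λ)`
    (χ : 𝓢(Rn n, ℂ)) (hχ : IsTest U χ)
    -- the window that defines the norms of the amalgam spaces
    (η : 𝓢(Rn n, ℂ)) (hη : HasCompactSupport η) (hη0 : η ≠ 0) :
    -- synthesis on `E^B_d(Λ) × 𝓢(ℝⁿ)`
    ∃ S₀ : Discrete ι B Λ χ →ₗ[ℂ] 𝓢(Rn n, ℂ) →ₗ[ℂ] E,
      (∀ (c : Discrete ι B Λ χ) (φ : 𝓢(Rn n, ℂ)),
        IsSynthesis B Λ φ c (ι.toDist (S₀ c φ))) ∧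
      (Continuous fun p : Discrete ι B Λ χ × 𝓢(Rn n, ℂ) => S₀ p.1 p.2) ∧
      -- unique continuous bilinear extension to `E^B_d(Λ) × W(𝓕L¹_ν̃, L¹_ω)`
      (∃ (J : 𝓢(Rn n, ℂ) →L[ℂ] Amalgam (modWeightTilde ι)
            (transWeight ι) η hη)
          (S : Discrete ι B Λ χ →L[ℂ] Amalgam (modWeightTilde ι)
            (transWeight ι) η hη →L[ℂ] E),
        (∀ (φ : 𝓢(Rn n, ℂ)) (t : Rn n), J φ t = φ t) ∧
        (∀ c φ, S c (J φ) = S₀ c φ) ∧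
        (∀ S' : Discrete ι B Λ χ →L[ℂ] Amalgam (modWeightTilde ι)
            (transWeight ι) η hη →L[ℂ] E,
          (∀ c φ, S' c (J φ) = S₀ c φ) → S' = S) ∧
        -- if `E` is the DTMIB `E = F'`, `F = E₀`
        (IsTMIB κ ∧ IsStrongDual ι κ pair →
          ∃ χ₀ : 𝓢(Rn n, ℂ), IsTest U χ₀ ∧
            ∀ (g : F) (f : Amalgam (modWeightTilde ι)
                (transWeight ι) η hη),
              ∃ h : F, ∀ c, pair (S c f) g = pair (S₀ c χ₀) h)) ∧
      -- sampling on `E × (θ_{-B} W(𝓕L¹_ν̃, L¹_ω̌))ˇ`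
      (∃ R : E →L[ℂ] SamplingDomain B (modWeightTilde ι)
            (fun x => transWeight ι (-x)) η hη →L[ℂ] Discrete ι B Λ χ,
        (∀ (e : E) (φ : SamplingDomain B (modWeightTilde ι)
            (fun x => transWeight ι (-x)) η hη) (l : Λ),
          IsTwistedConvolution κ pair B e φ (l : Rn n) (R e φ l)) ∧
        -- `R_{ψˇ} ∘ S_{χ₁} = (∫ θ_B(ψ) χ₁) • id`
        (∀ χ₁ ψ : 𝓢(Rn n, ℂ), IsTest U χ₁ → IsTest U ψ →
          (∫ t, chirp B ψ t * χ₁ t) ≠ 0 →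
          ∃ φ : SamplingDomain B (modWeightTilde ι)
              (fun x => transWeight ι (-x)) η hη,
            (∀ t, φ t = ψ (-t)) ∧
            ∀ c, R (S₀ c χ₁) φ = (∫ t, chirp B ψ t * χ₁ t) • c)) ∧
      -- the range of `S_{χ₁}` is complemented in `E`
      (∀ χ₁ : 𝓢(Rn n, ℂ), IsTest U χ₁ →
        (LinearMap.range (S₀.flip χ₁)).ClosedComplemented) := by
  obtain ⟨b, e, he⟩ := exists_lattice_basis Λ
  have hU := add_latticePt_notMem hUd he
  obtain ⟨D, P, hP⟩ := exists_dualPair_frameOperator hE B b hχ.1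
  obtain ⟨A⟩ := exists_atomicSystem B b hU hχ
  -- Synthesis needs atoms commuting with T^B_λ, sampling needs atoms commuting with T^{-B}_λ; hence
  -- two systems over the same window.
  obtain ⟨A'⟩ := exists_atomicSystem (-B) b hU hχ
  -- Guarantees that the weights ω_E and ν_E are strictly positive.
  have : Nontrivial E := ⟨D.left.j χ, 0, D.left.j_ne_zero hχ.1 hχ.2.2⟩
  have hν := D.left.moderate_modWeightTilde
  have hw := D.left.moderate_transWeight
  obtain ⟨S, hS, hS'⟩ := D.exists_synthesis_clm he hU hχ A hη hη0 hν hw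
  obtain ⟨R, hR⟩ := D.exists_sampling_clm he hP A' hη hη0 hν hw
  let J := schwartzToAmalgam hν hw hη
  let S₀ : Discrete ι B Λ χ →ₗ[ℂ] 𝓢(Rn n, ℂ) →ₗ[ℂ] E := LinearMap.mk₂ ℂ (fun c φ => S c (J φ))
    (fun c d φ => by rw [map_add, add_apply]) (fun a c φ => by rw [map_smul, smul_apply])
    (fun c φ ψ => by rw [map_add, map_add]) (fun a c φ => by rw [map_smul, map_smul])
  have hsyn : ∀ (c : Discrete ι B Λ χ) (φ : 𝓢(Rn n, ℂ)),
      IsSynthesis B Λ φ c (ι.toDist (S₀ c φ)) := hS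
  have hrec : ∀ χ₁ ψ : 𝓢(Rn n, ℂ), IsTest U χ₁ → IsTest U ψ →
      ∃ φ : SamplingDomain B (modWeightTilde ι) (fun x => transWeight ι (-x)) η hη,
        (∀ t, φ t = ψ (-t)) ∧ ∀ c, R (S₀ c χ₁) φ = (∫ t, chirp B ψ t * χ₁ t) • c := by
    intro χ₁ ψ hχ₁ hψ
    obtain ⟨θ, hθ, -, hθs⟩ := exists_schwartz_chirp B hψ.1
    obtain ⟨φ, hφ, hφθ⟩ := exists_samplingDomain B hν hw.reflect hη hθ
    refine ⟨φ, hφ, fun c => ?_⟩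
    rw [← hθ]
    exact D.sampling_synthesis he hU hχ₁.2.1 (hθs.trans hψ.2.1) (hsyn c χ₁) hφθ
      (hR (S₀ c χ₁) φ)
  refine ⟨S₀, hsyn, ?_, ⟨J, S, fun φ t => schwartzToAmalgam_apply hν hw hη φ t, fun c φ => rfl,
    fun S' hS'' => ?_, fun _ => ⟨χ, hχ, fun g f => ?_⟩⟩,
    ⟨R, hR, fun χ₁ ψ hχ₁ hψ _ => hrec χ₁ ψ hχ₁ hψ⟩, fun χ₁ hχ₁ => ?_⟩
  · exact (S.continuous.comp continuous_fst).clm_apply (J.continuous.comp continuous_snd)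
  · refine ContinuousLinearMap.ext fun c => DFunLike.coe_injective ?_
    exact (A.denseRange_schwartzToAmalgam hν one_le_modWeightTilde hw hη0).equalizer
      (S' c).continuous (S c).continuous (funext (hS'' c))
  · obtain ⟨h, hh⟩ := hS' g f
    refine ⟨h, fun c => ?_⟩
    rw [hh, Discrete.synthesis_unique (Discrete.synthesis_spec c) fun ψ _ => hsyn c χ ψ]
  -- Taking ψ = θ_{-B}(conj χ₁) gives θ_B(ψ) = conj χ₁, so the constant in the reconstruction
  -- formula is ∫ |χ₁|² > 0.
  · obtain ⟨ψ, hψ, hψc, hψs⟩ := exists_schwartz_chirp (-B) (hasCompactSupport_conjS hχ₁.1)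
    have h1 : chirp B ψ = conjS χ₁ := by rw [hψ, chirp_chirp_neg]
    have h2 : ∫ t, chirp B ψ t * χ₁ t ≠ 0 := by
      simp only [h1, mul_comm _ (χ₁ _)]
      exact integral_mul_conjS_ne_zero hχ₁.1 hχ₁.2.2
    have h3 : ψ ≠ 0 := by
      rintro rfl
      exact h2 (by simp [chirp_eq])
    obtain ⟨φ, -, hφ⟩ := hrec χ₁ ψ hχ₁
      ⟨hψc, hψs.trans ((tsupport_conjS χ₁).trans_subset hχ₁.2.1), h3⟩
    exact closedComplemented_range (S₀.flip χ₁) (R.flip φ).toLinearMap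
      ((S.flip (J χ₁)).continuous.comp (R.flip φ).continuous) h2 hφ
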